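/- Let $n\ge 0$ and let $W_n$ be the Weyl group of type $B_n$: the group of permutations of $I_n=\{\pm1,\dots,\pm n\}$ generated by $s_0=(-1,1)$ and $s_i=(i,i+1)(-i,-i-1)$ for $1\le i\le n-1$, where products are composed from right to left; each $w\in W_n$ satisfies $w(-k)=-w(k)$. A reduced expression of $w$ is an expression of $w$ as a product of the $s_i$ of minimal length. Let $W_b\subseteq W_n$ be the set of those $w$ that have no reduced expression containing three consecutive factors $s_i\,s_{j}\,s_i$ with $i\ge 1$ and $j\in\{i-1,i+1\}$ (with $0\le i,j\le n-1$; so $s_0s_1s_0$ is allowed, but $s_1s_0s_1$ is not). A domino consists of two horizontally or vertically adjacent cells. A standard domino tableau with $n$ dominoes is a Young diagram of size $2n$, partitioned into $n$ dominoes that are labeled bijectively by $1,\dots,n$, such that the labels weakly increase from cell to cell from left to right along rows and from top to bottom along columns. Its shape is the underlying Young diagram. Domino insertion (with empty core) assigns to $w\in W_n$ a pair $(P(w),Q(w))$ of standard domino tableaux with $n$ dominoes of the same shape as follows. Start with the empty tableau and, for $k=1,\dots,n$, insert the letter $w(k)$. To insert the letter $x$ with $a=|x|$ into a tableau $T$ (in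 which the label $a$ is not used), leave all dominoes with labels $<a$ in place, and put a domino with label $a$, if $x>0$, horizontally at the end of the first row, or, if $x<0$, vertically at the end of the first column, of the diagram formed by them. Then treat the dominoes $d$ of $T$ with labels $>a$ in increasing order of their labels; let $S$ be the diagram covered so far by the new tableau. If $d\cap S=\emptyset$, then $d$ stays where it is. If $d\subseteq S$, then $d$ is moved to the end of the next row of $S$ if it is horizontal, and to the end of the next column of $S$ if it is vertical. If $d\cap S$ is a single cell $(r,c)$ (row $r$, column $c$), then $d$ is replaced by the domino $(d\setminus\{(r,c)\})\cup\{(r+1,c+1)\}$. The final tableau is $P(w)$, and $Q(w)$ is the tableau of the same shape in which the label $k$ occupies the two cells that are added to the diagram at the $k$-th insertion. Let $Sh(w)$ be the shape of $P(w)$. **Theorem.** For every $w\in W_n$, one has $w\in W_b$ if and only if $Sh(w)$ has at most two rows. Moreover, $w\mapsto (P(w),Q(w))$ restricts to a bijection from $W_b$ onto the set of the pairs $(S,T)$ of standard domino tableaux with $n$ dominoes that have the same shape, where this shape has at most two rows. -/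

import Mathlib

/-- A domino: the two cells `(row, col), (row + 1, col)` if `vertical`, and
`(row, col), (row, col + 1)` otherwise. Rows are numbered downwards and columns to the right,
from `0`, as in `YoungDiagram`. -/
structure Domino where
  row : ℕ
  col : ℕ
  vertical : Bool

namespace Domino

/-- The set of the two cells of a domino. -/
def cells (d : Domino) : Finset (ℕ × ℕ) :=
  if d.vertical then {(d.row, d.col), (d.row + 1, d.col)}
  else {(d.row, d.col), (d.row, d.col + 1)}

/-- The horizontal domino placed directly after the last cell of row `r` of `s`. -/
def rowEnd (s : Finset (ℕ × ℕ)) (r : ℕ) : Domino :=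
  ⟨r, (s.filter fun x => x.1 = r).card, false⟩

/-- The vertical domino placed directly below the last cell of column `c` of `s`. -/
def colEnd (s : Finset (ℕ × ℕ)) (c : ℕ) : Domino :=
  ⟨(s.filter fun x => x.2 = c).card, c, true⟩

/-- The new position of the domino `d` when the smaller labels have come to occupy the
diagram `s`: if `d` does not meet `s`, it stays; if `d` lies inside `s`, it is moved to the end of
the next row (if horizontal) or of the next column (if vertical); if exactly one cell `(r, c)` of
`d` lies in `s`, this cell is exchanged for `(r + 1, c + 1)`, and the domino is turned. -/
def bump (s : Finset (ℕ × ℕ)) (d : Domino) : Domino :=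
  if Disjoint d.cells s then d
  else if d.cells ⊆ s then
    if d.vertical then colEnd s (d.col + 1) else rowEnd s (d.row + 1)
  else if d.vertical then ⟨d.row + 1, d.col, false⟩
  else ⟨d.row, d.col + 1, true⟩

end Domino

/-- An assignment of dominoes to labels (the label `k` is not used where the value is `none`). -/
abbrev DominoFilling := ℕ → Option Domino

namespace DominoFilling

/-- The cells of the domino with label `k` (no cells if the label is not used). -/
def cellsAt (T : DominoFilling) (k : ℕ) : Finset (ℕ × ℕ) :=
  (T k).elim ∅ Domino.cells

/-- The cells that are covered by the dominoes with labels `< m`. -/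
def below (T : DominoFilling) (m : ℕ) : Finset (ℕ × ℕ) :=
  (Finset.range m).biUnion T.cellsAt

/-- Insertion of the label `a` into `T`, horizontally in the first row (`v = false`) or vertically
in the first column (`v = true`): the domino with label `m` of the new filling, when its dominoes
with labels `< m` cover `s`. -/
def insertStep (T : DominoFilling) (a : ℕ) (v : Bool) (m : ℕ) (s : Finset (ℕ × ℕ)) :
    Option Domino :=
  if m < a then T m
  else if m = a then some (if v then Domino.colEnd s 0 else Domino.rowEnd s 0)
  else (T m).map (Domino.bump s)

/-- The cells that are covered by the dominoes with labels `< m` after the insertion. -/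
def insertBelow (T : DominoFilling) (a : ℕ) (v : Bool) : ℕ → Finset (ℕ × ℕ)
  | 0 => ∅
  | m + 1 => insertBelow T a v m ∪
      (insertStep T a v m (insertBelow T a v m)).elim ∅ Domino.cells

/-- The filling obtained by inserting the label `a` into `T`. -/
def insertLabel (T : DominoFilling) (a : ℕ) (v : Bool) : DominoFilling :=
  fun m => insertStep T a v m (insertBelow T a v m)

/-- The filling after the insertion of the first `k` letters of the word `w 1, w 2, …`, where the
letter `x` inserts the label `|x|`, vertically if `x < 0`. -/
def ofWord (w : ℕ → ℤ) : ℕ → DominoFilling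
  | 0 => fun _ => none
  | k + 1 => insertLabel (ofWord w k) (w (k + 1)).natAbs (decide (w (k + 1) < 0))

/-- The fillings of Young diagrams by pairwise disjoint dominoes with increasing labels, which
need not be consecutive. -/
structure IsStandard (T : DominoFilling) : Prop where
  disjoint : ∀ k, Disjoint (T.cellsAt k) (T.below k)
  lower : ∀ m, IsLowerSet (T.below m : Set (ℕ × ℕ))

theorem below_succ (T : DominoFilling) (m : ℕ) :
    T.below (m + 1) = T.below m ∪ T.cellsAt m := by
  unfold below
  rw [Finset.range_add_one, Finset.biUnion_insert, Finset.union_comm]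

theorem below_none (m : ℕ) : below (fun _ => none) m = ∅ := by
  ext x
  simp [below, cellsAt]

theorem below_insertLabel (T : DominoFilling) (a : ℕ) (v : Bool) (m : ℕ) :
    (T.insertLabel a v).below m = insertBelow T a v m := by
  induction m with
  | zero => rfl
  | succ m ih => rw [below_succ, ih]; rfl

end DominoFilling

namespace Domino

theorem mem_cells (d : Domino) (x : ℕ × ℕ) : x ∈ d.cells ↔
    (x.1 = d.row ∧ x.2 = d.col) ∨ (d.vertical = true ∧ x.1 = d.row + 1 ∧ x.2 = d.col) ∨
      (d.vertical = false ∧ x.1 = d.row ∧ x.2 = d.col + 1) := by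
  obtain ⟨r, c, v⟩ := d
  obtain ⟨a, b⟩ := x
  cases v <;> simp [cells]

theorem lower_iff (s : Finset (ℕ × ℕ)) : IsLowerSet (s : Set (ℕ × ℕ)) ↔
    ∀ r c, ((r + 1, c) ∈ s → (r, c) ∈ s) ∧ ((r, c + 1) ∈ s → (r, c) ∈ s) := by
  constructor
  · intro h r c
    exact ⟨fun h1 => h (Prod.mk_le_mk.2 ⟨Nat.le_succ r, le_rfl⟩) h1,
      fun h1 => h (Prod.mk_le_mk.2 ⟨le_rfl, Nat.le_succ c⟩) h1⟩
  · rintro h ⟨a, b⟩ ⟨a', b'⟩ hle hm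
    obtain ⟨h1, h2⟩ := Prod.mk_le_mk.1 hle
    obtain ⟨k, rfl⟩ := Nat.exists_eq_add_of_le h1
    obtain ⟨l, rfl⟩ := Nat.exists_eq_add_of_le h2
    have hm' : (a' + k, b' + l) ∈ s := hm
    have hm2 : (a', b' + l) ∈ s := by
      clear hm h1 h2 hle
      induction k with
      | zero => exact hm'
      | succ k ih => exact ih ((h _ _).1 hm')
    change (a', b') ∈ s
    clear hm hm' h1 h2 hle
    induction l with
    | zero => exact hm2
    | succ l ih => exact ih ((h _ _).2 hm2)

theorem mem_row_iff {s : Finset (ℕ × ℕ)} (hs : IsLowerSet (s : Set (ℕ × ℕ))) (r c : ℕ) :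
    (r, c) ∈ s ↔ c < (s.filter fun x => x.1 = r).card := by
  have h := (YoungDiagram.mem_iff_lt_rowLen (μ := ⟨s, hs⟩) (i := r) (j := c))
  rw [YoungDiagram.rowLen_eq_card] at h
  exact h

theorem mem_col_iff {s : Finset (ℕ × ℕ)} (hs : IsLowerSet (s : Set (ℕ × ℕ))) (r c : ℕ) :
    (r, c) ∈ s ↔ r < (s.filter fun x => x.2 = c).card := by
  have h := (YoungDiagram.mem_iff_lt_colLen (μ := ⟨s, hs⟩) (i := r) (j := c))
  rw [YoungDiagram.colLen_eq_card] at h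
  exact h

theorem disjoint_iff (d : Domino) (s : Finset (ℕ × ℕ)) :
    Disjoint d.cells s ↔ (d.row, d.col) ∉ s ∧ (d.vertical = true → (d.row + 1, d.col) ∉ s) ∧
      (d.vertical = false → (d.row, d.col + 1) ∉ s) := by
  obtain ⟨r, c, v⟩ := d
  cases v <;> simp [cells]

/-- The domino `d` can be added to the Young diagram `s`. -/
def Addable (s : Finset (ℕ × ℕ)) (d : Domino) : Prop :=
  Disjoint d.cells s ∧ IsLowerSet (↑(s ∪ d.cells) : Set (ℕ × ℕ))

theorem addable_rowEnd_zero {s : Finset (ℕ × ℕ)} (hs : IsLowerSet (s : Set (ℕ × ℕ))) :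
    Addable s (rowEnd s 0) := by
  have hm := mem_row_iff hs 0
  have hl := (lower_iff s).1 hs
  constructor
  · rw [disjoint_iff]; simp [rowEnd, hm]
  · rw [lower_iff]
    intro r c
    have := hl r c
    have h1 := hm c
    simp only [Finset.mem_union, mem_cells, rowEnd]
    grind

theorem addable_colEnd_zero {s : Finset (ℕ × ℕ)} (hs : IsLowerSet (s : Set (ℕ × ℕ))) :
    Addable s (colEnd s 0) := by
  have hm := fun r => mem_col_iff hs r 0
  have hl := (lower_iff s).1 hs
  constructor
  · rw [disjoint_iff]; simp [colEnd, hm]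
  · rw [lower_iff]
    intro r c
    have := hl r c
    have h1 := hm r
    simp only [Finset.mem_union, mem_cells, colEnd]
    grind

theorem addable_rowEnd_succ {s : Finset (ℕ × ℕ)} (hs : IsLowerSet (s : Set (ℕ × ℕ))) {r c : ℕ}
    (h1 : (r, c + 1) ∈ s) (h2 : (r + 1, c) ∉ s) : Addable s (rowEnd s (r + 1)) := by
  have hm := mem_row_iff hs (r + 1)
  have hm' := mem_row_iff hs r
  have hl := (lower_iff s).1 hs
  constructor
  · rw [disjoint_iff]; simp [rowEnd, hm]
  · rw [lower_iff]
    rw [hm'] at h1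
    rw [hm] at h2
    intro r' c'
    have := hl r' c'
    have h3 := hm c'
    have h4 := hm' c'
    simp only [Finset.mem_union, mem_cells, rowEnd]
    grind

theorem addable_colEnd_succ {s : Finset (ℕ × ℕ)} (hs : IsLowerSet (s : Set (ℕ × ℕ))) {r c : ℕ}
    (h1 : (r + 1, c) ∈ s) (h2 : (r, c + 1) ∉ s) : Addable s (colEnd s (c + 1)) := by
  have hm := fun r => mem_col_iff hs r (c + 1)
  have hm' := fun r => mem_col_iff hs r c
  have hl := (lower_iff s).1 hs
  constructor
  · rw [disjoint_iff]; simp [colEnd, hm]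
  · rw [lower_iff]
    rw [hm'] at h1
    rw [hm] at h2
    intro r' c'
    have := hl r' c'
    have h3 := hm r'
    have h4 := hm' r'
    simp only [Finset.mem_union, mem_cells, colEnd]
    grind

/-- The local rule of domino insertion: if `δ` and `γ` can be added to `s`, then `bump (s ∪ δ) γ`
can be added to `s ∪ δ`, and the result is also obtained by adding a domino to `s ∪ γ`. -/
theorem addable_bump {s : Finset (ℕ × ℕ)} (hs : IsLowerSet (s : Set (ℕ × ℕ))) {δ γ : Domino}
    (hδ : Addable s δ) (hγ : Addable s γ) :
    Addable (s ∪ δ.cells) (bump (s ∪ δ.cells) γ) ∧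
      ∃ ε : Domino, Disjoint ε.cells (s ∪ γ.cells) ∧
        s ∪ δ.cells ∪ (bump (s ∪ δ.cells) γ).cells = s ∪ γ.cells ∪ ε.cells := by
  obtain ⟨hδ1, hδ2⟩ := hδ
  obtain ⟨hγ1, hγ2⟩ := hγ
  have hl := (lower_iff _).1 hs
  have hlδ := (lower_iff _).1 hδ2
  have hlγ := (lower_iff _).1 hγ2
  by_cases h1 : Disjoint γ.cells (s ∪ δ.cells)
  · have hb : bump (s ∪ δ.cells) γ = γ := by simp [bump, h1]
    rw [hb]
    refine ⟨⟨h1, ?_⟩, δ, ?_, ?_⟩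
    · have : s ∪ δ.cells ∪ γ.cells = (s ∪ δ.cells) ∪ (s ∪ γ.cells) := by
        ext x; simp only [Finset.mem_union]; tauto
      rw [this, Finset.coe_union]
      exact hδ2.union hγ2
    · rw [Finset.disjoint_union_right] at h1 ⊢
      exact ⟨hδ1, h1.2.symm⟩
    · ext x; simp only [Finset.mem_union]; tauto
  by_cases h2 : γ.cells ⊆ s ∪ δ.cells
  · have h3 : γ.cells ⊆ δ.cells := by
      intro x hx
      rcases Finset.mem_union.1 (h2 hx) with h | h
      · exact absurd h (Finset.disjoint_left.1 hγ1 hx)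
      · exact h
    have h4 : γ = δ := by
      obtain ⟨r, c, v⟩ := γ
      obtain ⟨r', c', v'⟩ := δ
      have e1 := fun x => @h3 x
      simp only [mem_cells] at e1
      have e2 := e1 (r, c)
      have e3 := e1 (r + 1, c)
      have e4 := e1 (r, c + 1)
      cases v <;> cases v' <;> simp at e2 e3 e4 ⊢ <;> omega
    subst h4
    obtain ⟨r, c, v⟩ := γ
    have key : Addable (s ∪ cells ⟨r, c, v⟩)
        (bump (s ∪ cells ⟨r, c, v⟩) ⟨r, c, v⟩) := by
      cases v
      · have hb : bump (s ∪ cells ⟨r, c, false⟩) ⟨r, c, false⟩ =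
            rowEnd (s ∪ cells ⟨r, c, false⟩) (r + 1) := by
          simp only [bump, if_neg h1, if_pos h2]; simp
        rw [hb]
        refine addable_rowEnd_succ (c := c) hδ2 (by simp [mem_cells]) ?_
        intro h
        rw [disjoint_iff] at hδ1
        simp [mem_cells] at h hδ1
        exact hδ1.1 ((hl _ _).1 h)
      · have hb : bump (s ∪ cells ⟨r, c, true⟩) ⟨r, c, true⟩ =
            colEnd (s ∪ cells ⟨r, c, true⟩) (c + 1) := by
          simp only [bump, if_neg h1, if_pos h2]; simp
        rw [hb]
        refine addable_colEnd_succ (r := r) hδ2 (by simp [mem_cells]) ?_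
        intro h
        rw [disjoint_iff] at hδ1
        simp [mem_cells] at h hδ1
        exact hδ1.1 ((hl _ _).2 h)
    exact ⟨key, _, key.1, rfl⟩
  · have hb : bump (s ∪ δ.cells) γ = if γ.vertical then ⟨γ.row + 1, γ.col, false⟩
        else ⟨γ.row, γ.col + 1, true⟩ := by
      simp only [bump, if_neg h1, if_neg h2]
    obtain ⟨r, c, v⟩ := γ
    obtain ⟨r', c', v'⟩ := δ
    have hv : v' = !v ∧ r' = r ∧ c' = c := by
      have a1 := hlδ r c
      have a2 := hlγ r c
      have a3 := hlδ r' c'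
      have a4 := hlγ r' c'
      rw [disjoint_iff] at hδ1 hγ1 h1
      have h2' : ¬ ((r, c) ∈ s ∪ (cells ⟨r', c', v'⟩) ∧
          (v = true → (r + 1, c) ∈ s ∪ (cells ⟨r', c', v'⟩)) ∧
          (v = false → (r, c + 1) ∈ s ∪ (cells ⟨r', c', v'⟩))) := by
        rintro ⟨b1, b2, b3⟩
        apply h2
        intro x hx
        obtain ⟨x1, x2⟩ := x
        rw [mem_cells] at hx
        simp only at hx
        rcases hx with ⟨rfl, rfl⟩ | ⟨hv, rfl, rfl⟩ | ⟨hv, rfl, rfl⟩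
        · exact b1
        · exact b2 hv
        · exact b3 hv
      clear h2 hb hs hδ2 hγ2 hl hlδ hlγ
      simp only [Finset.mem_union, mem_cells] at *
      cases v <;> cases v' <;> simp at * <;> grind
    obtain ⟨rfl, rfl, rfl⟩ := hv
    rw [hb]
    refine ⟨⟨?_, ?_⟩, if v then ⟨r', c' + 1, true⟩ else ⟨r' + 1, c', false⟩, ?_, ?_⟩
    · rw [disjoint_iff] at hδ1 hγ1 ⊢
      have a1 := hl r' c'
      have a2 := hl r' (c' + 1)
      have a3 := hl (r' + 1) c'
      cases v <;> simp [mem_cells] at * <;> grind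
    · rw [lower_iff]
      intro a b
      have a1 := hlδ a b
      have a2 := hlγ a b
      cases v <;> simp [mem_cells] at * <;> grind
    · rw [disjoint_iff] at hδ1 hγ1
      have a1 := hl r' c'
      have a2 := hl r' (c' + 1)
      have a3 := hl (r' + 1) c'
      cases v <;> simp [mem_cells, disjoint_iff] at * <;> grind
    · ext ⟨a, b⟩
      cases v <;> simp [mem_cells] <;> grind

end Domino

namespace DominoFilling

theorem insertLabel_cellsAt (T : DominoFilling) (a : ℕ) (v : Bool) (m : ℕ) :
    (T.insertLabel a v).cellsAt m =
      (insertStep T a v m ((T.insertLabel a v).below m)).elim ∅ Domino.cells := by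
  rw [below_insertLabel]; rfl

theorem insertLabel_aux {T : DominoFilling} (hT : T.IsStandard) {a : ℕ} (ha : T a = none)
    (v : Bool) (m : ℕ)
    (h1 : m ≤ a → (T.insertLabel a v).below m = T.below m)
    (h2 : a < m → ∃ δ : Domino, Domino.Addable (T.below m) δ ∧
      (T.insertLabel a v).below m = T.below m ∪ δ.cells) :
    (m < a → (T.insertLabel a v).below (m + 1) = T.below (m + 1)) ∧
    (a ≤ m → ∃ δ : Domino, Domino.Addable (T.below (m + 1)) δ ∧
      (T.insertLabel a v).below (m + 1) = T.below (m + 1) ∪ δ.cells) ∧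
    Disjoint ((T.insertLabel a v).cellsAt m) ((T.insertLabel a v).below m) := by
  have hc := insertLabel_cellsAt T a v m
  have hlow := hT.lower m
  rw [below_succ, below_succ]
  rcases lt_trichotomy m a with h | h | h
  · have hc' : (T.insertLabel a v).cellsAt m = T.cellsAt m := by
      rw [hc, insertStep, if_pos h]; rfl
    rw [hc', h1 h.le]
    exact ⟨fun _ => rfl, fun h' => absurd h' (not_le.2 h), hT.disjoint m⟩
  · subst h
    have h0 : T.cellsAt m = ∅ := by simp [cellsAt, ha]
    rw [hc, h0, h1 le_rfl, Finset.union_empty, insertStep, if_neg (lt_irrefl m), if_pos rfl]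
    have hadd : Domino.Addable (T.below m)
        (if v then Domino.colEnd (T.below m) 0 else Domino.rowEnd (T.below m) 0) := by
      split_ifs
      · exact Domino.addable_colEnd_zero hlow
      · exact Domino.addable_rowEnd_zero hlow
    exact ⟨fun h' => absurd h' (lt_irrefl m), fun _ => ⟨_, hadd, rfl⟩, hadd.1⟩
  · obtain ⟨δ, hδ, hb⟩ := h2 h
    rw [insertStep, if_neg (by omega), if_neg (by omega)] at hc
    refine ⟨fun h' => absurd h' (by omega), ?_⟩
    cases hm : T m with
    | none =>
      have h0 : T.cellsAt m = ∅ := by simp [cellsAt, hm]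
      rw [hc, h0, hm, Finset.union_empty]
      exact ⟨fun _ => ⟨δ, hδ, by simpa using hb⟩, by simp⟩
    | some γ =>
      have h0 : T.cellsAt m = γ.cells := by simp [cellsAt, hm]
      have hγ : Domino.Addable (T.below m) γ := by
        refine ⟨h0 ▸ hT.disjoint m, ?_⟩
        have := hT.lower (m + 1)
        rwa [below_succ, h0] at this
      obtain ⟨k1, ε, k2, k3⟩ := Domino.addable_bump hlow hδ hγ
      rw [hm, hb] at hc
      have hc' : (T.insertLabel a v).cellsAt m =
        (Domino.bump (T.below m ∪ δ.cells) γ).cells := hc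
      rw [hc', h0, hb]
      refine ⟨fun _ => ⟨ε, ⟨k2, ?_⟩, k3⟩, k1.1⟩
      rw [← k3]
      exact k1.2

theorem insertLabel_below {T : DominoFilling} (hT : T.IsStandard) {a : ℕ} (ha : T a = none)
    (v : Bool) (m : ℕ) :
    (m ≤ a → (T.insertLabel a v).below m = T.below m) ∧
    (a < m → ∃ δ : Domino, Domino.Addable (T.below m) δ ∧
      (T.insertLabel a v).below m = T.below m ∪ δ.cells) := by
  induction m with
  | zero => exact ⟨fun _ => rfl, fun h => absurd h (Nat.not_lt_zero _)⟩
  | succ m ih =>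
    have h := insertLabel_aux hT ha v m ih.1 ih.2
    exact ⟨fun h' => h.1 h', fun h' => h.2.1 (Nat.le_of_lt_succ h')⟩

theorem insertLabel_isStandard {T : DominoFilling} (hT : T.IsStandard) {a : ℕ} (ha : T a = none)
    (v : Bool) : (T.insertLabel a v).IsStandard := by
  have h := insertLabel_below hT ha v
  refine ⟨fun m => (insertLabel_aux hT ha v m (h m).1 (h m).2).2.2, fun m => ?_⟩
  rcases le_or_gt m a with h' | h'
  · rw [(h m).1 h']
    exact hT.lower m
  · obtain ⟨δ, h1, h2⟩ := (h m).2 h'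
    rw [h2]
    exact h1.2

theorem insertLabel_isSome (T : DominoFilling) (a : ℕ) (v : Bool) (m : ℕ) :
    (T.insertLabel a v m).isSome ↔ m = a ∨ (T m).isSome := by
  unfold insertLabel insertStep
  split_ifs with h1 h2 h3
  · simp [h1.ne]
  · simp [h2]
  · simp [h2]
  · cases T m <;> simp [h2]

end DominoFilling

/-- A standard domino tableau with `n` dominoes: a Young diagram that is partitioned into dominoes
with labels `1, …, n`, increasing along the rows and down the columns. -/
@[ext]
structure StandardDominoTableau (n : ℕ) where
  /-- The underlying Young diagram. -/
  shape : YoungDiagram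
  /-- The set of cells with label `k`. -/
  dom : ℕ → Finset (ℕ × ℕ)
  isDomino : ∀ k, 1 ≤ k → k ≤ n → ∃ d : Domino, dom k = d.cells
  eq_empty : ∀ k, ¬ (1 ≤ k ∧ k ≤ n) → dom k = ∅
  disjoint : ∀ k l, k ≠ l → Disjoint (dom k) (dom l)
  cells_eq : shape.cells = (Finset.Icc 1 n).biUnion dom
  row_le : ∀ k l r c c', (r, c) ∈ dom k → (r, c') ∈ dom l → c < c' → k ≤ l
  col_le : ∀ k l r r' c, (r, c) ∈ dom k → (r', c) ∈ dom l → r < r' → k ≤ l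

/-- The standard domino tableau that is given by a growing chain of Young diagrams. -/
def StandardDominoTableau.ofChain (n : ℕ) (D : ℕ → Finset (ℕ × ℕ))
    (h1 : ∀ k, 1 ≤ k → k ≤ n → ∃ d : Domino, D k = d.cells)
    (h2 : ∀ k, ¬ (1 ≤ k ∧ k ≤ n) → D k = ∅)
    (h3 : ∀ k, Disjoint (D k) ((Finset.range k).biUnion D))
    (h4 : ∀ m, IsLowerSet (((Finset.range m).biUnion D : Finset (ℕ × ℕ)) : Set (ℕ × ℕ))) :
    StandardDominoTableau n :=
  have key : ∀ k l x y, x ∈ D k → y ∈ D l → x ≤ y → k ≤ l := by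
    intro k l x y hx hy hxy
    by_contra hlt
    have hy' : y ∈ (Finset.range (l + 1)).biUnion D :=
      Finset.mem_biUnion.2 ⟨l, by simp, hy⟩
    obtain ⟨j, hj, hxj⟩ := Finset.mem_biUnion.1 (h4 (l + 1) hxy hy')
    rw [Finset.mem_range] at hj
    exact Finset.disjoint_left.1 (h3 k) hx
      (Finset.mem_biUnion.2 ⟨j, Finset.mem_range.2 (by omega), hxj⟩)
  { shape := ⟨(Finset.Icc 1 n).biUnion D, by
      have : (Finset.Icc 1 n).biUnion D = (Finset.range (n + 1)).biUnion D := by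
        ext x
        simp only [Finset.mem_biUnion, Finset.mem_Icc, Finset.mem_range]
        constructor
        · rintro ⟨k, hk, hx⟩
          exact ⟨k, by omega, hx⟩
        · rintro ⟨k, hk, hx⟩
          refine ⟨k, ?_, hx⟩
          by_contra hc
          rw [h2 k hc] at hx
          simp at hx
      rw [this]
      exact h4 (n + 1)⟩
    dom := D
    isDomino := h1
    eq_empty := h2
    disjoint := by
      have aux : ∀ k l, k < l → Disjoint (D l) (D k) := fun k l hkl =>
        (h3 l).mono_right (Finset.subset_biUnion_of_mem D (Finset.mem_range.2 hkl))
      intro k l hkl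
      rcases lt_or_gt_of_ne hkl with h | h
      · exact (aux _ _ h).symm
      · exact aux _ _ h
    cells_eq := rfl
    row_le := fun k l r c c' hx hy hc =>
      key k l _ _ hx hy (Prod.mk_le_mk.2 ⟨le_rfl, hc.le⟩)
    col_le := fun k l r r' c hx hy hc =>
      key k l _ _ hx hy (Prod.mk_le_mk.2 ⟨hc.le, le_rfl⟩) }

namespace WeylB

/-- The Coxeter generators of the Weyl group of type `B`, as permutations of `ℤ` (which move only
finitely many integers): `s 0 = (-1, 1)` and `s i = (i, i + 1) (-i, -i - 1)` for `i ≥ 1`. -/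
def s (i : ℕ) : Equiv.Perm ℤ :=
  if i = 0 then Equiv.swap (-1) 1
  else Equiv.swap (i : ℤ) (i + 1) * Equiv.swap (-i : ℤ) (-i - 1)

/-- The Weyl group of type `B_n`, generated by `s 0, …, s (n - 1)`. Its elements permute
`{±1, …, ±n}` and fix all other integers. -/
def W (n : ℕ) : Subgroup (Equiv.Perm ℤ) :=
  Subgroup.closure {g | ∃ i < n, g = s i}

/-- The list `l` of indices is an expression `w = s i₁ ⋯ s i_N` in the Coxeter generators. -/
def IsExpression {n : ℕ} (w : W n) (l : List ℕ) : Prop :=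
  (∀ i ∈ l, i < n) ∧ (l.map s).prod = (w : Equiv.Perm ℤ)

/-- A reduced expression is an expression of minimal length. -/
def IsReducedExpression {n : ℕ} (w : W n) (l : List ℕ) : Prop :=
  IsExpression w l ∧ ∀ l', IsExpression w l' → l.length ≤ l'.length

/-- The set `W_b` of the elements without a reduced expression that contains three consecutive
factors `s i, s (i ± 1), s i` with `i ≥ 1`. -/
def Wb (n : ℕ) : Set (W n) :=
  {w | ¬ ∃ l, IsReducedExpression w l ∧
    ∃ i j, 1 ≤ i ∧ (j = i + 1 ∨ j + 1 = i) ∧ [i, j, i] <:+: l}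

/-- The word `w 1, w 2, …` of a signed permutation. -/
def word {n : ℕ} (w : W n) (k : ℕ) : ℤ := (w : Equiv.Perm ℤ) k

theorem s_neg (i : ℕ) (k : ℤ) : s i (-k) = -s i k := by
  unfold s
  split_ifs with h
  · simp only [Equiv.swap_apply_def]
    split_ifs <;> omega
  · simp only [Equiv.Perm.mul_apply, Equiv.swap_apply_def]
    split_ifs <;> omega

theorem s_fix {i n : ℕ} (hi : i < n) (k : ℤ) (hk : n < k.natAbs) : s i k = k := by
  unfold s
  split_ifs with h
  · simp only [Equiv.swap_apply_def]
    split_ifs <;> omega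
  · simp only [Equiv.Perm.mul_apply, Equiv.swap_apply_def]
    split_ifs <;> omega

theorem mem_W {n : ℕ} {w : Equiv.Perm ℤ} (hw : w ∈ W n) :
    (∀ k, w (-k) = -w k) ∧ ∀ k : ℤ, n < k.natAbs → w k = k := by
  unfold W at hw
  induction hw using Subgroup.closure_induction with
  | mem x hx =>
    obtain ⟨i, hi, rfl⟩ := hx
    exact ⟨s_neg i, s_fix hi⟩
  | one => exact ⟨fun k => rfl, fun k _ => rfl⟩
  | mul x y hx hy h1 h2 =>
    refine ⟨fun k => ?_, fun k hk => ?_⟩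
    · rw [Equiv.Perm.mul_apply, h2.1, h1.1]; rfl
    · rw [Equiv.Perm.mul_apply, h2.2 k hk, h1.2 k hk]
  | inv x hx h =>
    refine ⟨fun k => ?_, fun k hk => ?_⟩
    · rw [Equiv.Perm.inv_eq_iff_eq, h.1]; simp
    · rw [Equiv.Perm.inv_eq_iff_eq, h.2 k hk]

theorem word_inj {n : ℕ} (w : W n) {j k : ℕ} (h : (word w j).natAbs = (word w k).natAbs) :
    j = k := by
  have hw := (mem_W w.2).1
  unfold word at h
  rcases Int.natAbs_eq_natAbs_iff.1 h with h | h
  · have := (w : Equiv.Perm ℤ).injective h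
    omega
  · rw [← hw] at h
    have := (w : Equiv.Perm ℤ).injective h
    omega

theorem word_mem {n : ℕ} (w : W n) {k : ℕ} (h1 : 1 ≤ k) (h2 : k ≤ n) :
    1 ≤ (word w k).natAbs ∧ (word w k).natAbs ≤ n := by
  have hw := mem_W w.2
  have h0 : (w : Equiv.Perm ℤ) 0 = 0 := by
    have := hw.1 0
    rw [neg_zero] at this
    omega
  constructor
  · by_contra hc
    have : word w k = 0 := by omega
    have := (w : Equiv.Perm ℤ).injective (this.trans h0.symm)
    omega
  · by_contra hc
    have h3 := hw.2 _ (not_le.1 hc)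
    have := (w : Equiv.Perm ℤ).injective h3
    unfold word at hc this
    omega

/-- The filling after the insertion of the first `k` letters of the word of `w`. -/
def filling {n : ℕ} (w : W n) (k : ℕ) : DominoFilling := DominoFilling.ofWord (word w) k

theorem filling_spec {n : ℕ} (w : W n) (k : ℕ) : (filling w k).IsStandard ∧
    ∀ m, (filling w k m).isSome ↔ ∃ j, 1 ≤ j ∧ j ≤ k ∧ (word w j).natAbs = m := by
  induction k with
  | zero =>
    refine ⟨⟨fun k => ?_, fun m => ?_⟩, fun m => ?_⟩
    · exact Finset.disjoint_empty_left _
    · have : (filling w 0).below m = ∅ := DominoFilling.below_none _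
      rw [this]
      simp [isLowerSet_empty]
    · simp only [filling, DominoFilling.ofWord, Option.isSome_none]
      constructor
      · intro h
        simp at h
      · rintro ⟨j, h1, h2, -⟩
        omega
  | succ k ih =>
    have hn : filling w k (word w (k + 1)).natAbs = none := by
      by_contra hc
      obtain ⟨j, h1, h2, h3⟩ := (ih.2 _).1 (Option.isSome_iff_ne_none.2 hc)
      have := word_inj w h3
      omega
    refine ⟨DominoFilling.insertLabel_isStandard ih.1 hn _, fun m => ?_⟩
    refine (DominoFilling.insertLabel_isSome (filling w k) _ _ m).trans ?_
    rw [ih.2]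
    constructor
    · rintro (rfl | ⟨j, h1, h2, h3⟩)
      · exact ⟨k + 1, by omega, le_rfl, rfl⟩
      · exact ⟨j, h1, by omega, h3⟩
    · rintro ⟨j, h1, h2, h3⟩
      rcases Nat.lt_or_ge k j with h | h
      · obtain rfl : j = k + 1 := by omega
        exact Or.inl h3.symm
      · exact Or.inr ⟨j, h1, h, h3⟩

theorem filling_unused {n : ℕ} (w : W n) (k : ℕ) :
    filling w k (word w (k + 1)).natAbs = none := by
  by_contra hc
  obtain ⟨j, h1, h2, h3⟩ := ((filling_spec w k).2 _).1 (Option.isSome_iff_ne_none.2 hc)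
  have := word_inj w h3
  omega

theorem filling_growth {n : ℕ} (w : W n) {k : ℕ} (hk : k < n) :
    ∃ δ : Domino, Domino.Addable ((filling w k).below (n + 1)) δ ∧
      (filling w (k + 1)).below (n + 1) = (filling w k).below (n + 1) ∪ δ.cells :=
  (DominoFilling.insertLabel_below (filling_spec w k).1 (filling_unused w k) _ (n + 1)).2
    (by have := word_mem w (k := k + 1) (by omega) hk; omega)

theorem filling_isSome {n : ℕ} (w : W n) (m : ℕ) :
    (filling w n m).isSome ↔ 1 ≤ m ∧ m ≤ n := by
  rw [(filling_spec w n).2]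
  constructor
  · rintro ⟨j, h1, h2, rfl⟩
    exact word_mem w h1 h2
  · intro hm
    have hinj : Set.InjOn (fun j => (word w j).natAbs) (Finset.Icc 1 n : Finset ℕ) :=
      fun j _ k _ h => word_inj w h
    have hmaps : Set.MapsTo (fun j => (word w j).natAbs) (Finset.Icc 1 n : Finset ℕ)
        (Finset.Icc 1 n : Finset ℕ) := by
      intro j hj
      rw [Finset.mem_coe, Finset.mem_Icc] at hj ⊢
      exact word_mem w hj.1 hj.2
    obtain ⟨j, hj, hjm⟩ :=
      Finset.surjOn_of_injOn_of_card_le _ hmaps hinj le_rfl (Finset.mem_coe.2 (Finset.mem_Icc.2 hm))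
    rw [Finset.mem_coe, Finset.mem_Icc] at hj
    exact ⟨j, hj.1, hj.2, hjm⟩

/-- The insertion tableau `P(w)`, obtained by inserting `w 1, …, w n` successively. -/
def P {n : ℕ} (w : W n) : StandardDominoTableau n :=
  StandardDominoTableau.ofChain n (filling w n).cellsAt
    (fun k h1 h2 => by
      obtain ⟨d, hd⟩ := Option.isSome_iff_exists.1 ((filling_isSome w k).2 ⟨h1, h2⟩)
      exact ⟨d, by simp [DominoFilling.cellsAt, hd]⟩)
    (fun k h => by
      have : filling w n k = none := by
        by_contra hc
        exact h ((filling_isSome w k).1 (Option.isSome_iff_ne_none.2 hc))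
      simp [DominoFilling.cellsAt, this])
    (filling_spec w n).1.disjoint (filling_spec w n).1.lower

/-- The cells that are added to the diagram when the `k`-th letter of `w` is inserted. -/
def newCells {n : ℕ} (w : W n) (k : ℕ) : Finset (ℕ × ℕ) :=
  if 1 ≤ k ∧ k ≤ n then (filling w k).below (n + 1) \ (filling w (k - 1)).below (n + 1) else ∅

theorem newCells_succ {n : ℕ} (w : W n) {k : ℕ} (hk : k < n) :
    (∃ d : Domino, newCells w (k + 1) = d.cells) ∧
    Disjoint (newCells w (k + 1)) ((filling w k).below (n + 1)) ∧
    (filling w (k + 1)).below (n + 1) =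
      (filling w k).below (n + 1) ∪ newCells w (k + 1) := by
  obtain ⟨δ, h1, h2⟩ := filling_growth w hk
  have h3 : newCells w (k + 1) = δ.cells := by
    unfold newCells
    rw [if_pos ⟨by omega, by omega⟩, Nat.add_sub_cancel, h2, Finset.union_sdiff_left]
    exact Finset.sdiff_eq_self_of_disjoint h1.1
  rw [h3]
  exact ⟨⟨δ, rfl⟩, h1.1, h2⟩

theorem newCells_biUnion {n : ℕ} (w : W n) {k : ℕ} (hk : k ≤ n) :
    (Finset.range (k + 1)).biUnion (newCells w) = (filling w k).below (n + 1) := by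
  induction k with
  | zero =>
    have : (filling w 0).below (n + 1) = ∅ := DominoFilling.below_none _
    rw [this]
    simp [newCells]
  | succ k ih =>
    rw [Finset.range_add_one, Finset.biUnion_insert, ih (by omega),
      (newCells_succ w (by omega)).2.2, Finset.union_comm]

/-- The recording tableau `Q(w)`: the label `k` is on the domino that is added to the shape when
the `k`-th letter of `w` is inserted. -/
def Q {n : ℕ} (w : W n) : StandardDominoTableau n :=
  StandardDominoTableau.ofChain n (newCells w)
    (fun k h1 h2 => by
      obtain ⟨k, rfl⟩ := Nat.exists_eq_add_of_le' h1
      exact (newCells_succ w (by omega)).1)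
    (fun k h => if_neg h)
    (fun k => by
      by_cases h : 1 ≤ k ∧ k ≤ n
      · obtain ⟨k, rfl⟩ := Nat.exists_eq_add_of_le' h.1
        rw [newCells_biUnion w (by omega)]
        exact (newCells_succ w (by omega)).2.1
      · rw [newCells, if_neg h]
        exact Finset.disjoint_empty_left _)
    (fun m => by
      have h0 : ∀ k, k ≤ n → IsLowerSet
          (((Finset.range (k + 1)).biUnion (newCells w) : Finset (ℕ × ℕ)) : Set (ℕ × ℕ)) := by
        intro k hk
        rw [newCells_biUnion w hk]
        exact (filling_spec w k).1.lower _
      rcases m with _ | m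
      · simp [isLowerSet_empty]
      · rcases le_total m n with h | h
        · exact h0 m h
        · have : (Finset.range (m + 1)).biUnion (newCells w) =
              (Finset.range (n + 1)).biUnion (newCells w) := by
            ext x
            simp only [Finset.mem_biUnion, Finset.mem_range]
            constructor
            · rintro ⟨k, hk, hx⟩
              refine ⟨k, ?_, hx⟩
              by_contra hc
              rw [newCells, if_neg (by omega)] at hx
              simp at hx
            · rintro ⟨k, hk, hx⟩
              exact ⟨k, by omega, hx⟩
          rw [this]
          exact h0 n le_rfl)

/-- The shape `Sh(w)` of the insertion tableau of `w`. -/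
def Sh {n : ℕ} (w : W n) : YoungDiagram := (P w).shape

end WeylB

/-- The set of the pairs of standard domino tableaux with `n` dominoes that have the same shape,
which has at most two rows. -/
def twoRowPairs (n : ℕ) : Set (StandardDominoTableau n × StandardDominoTableau n) :=
  {x | x.1.shape = x.2.shape ∧ x.1.shape.colLen 0 ≤ 2}

/-!
The elements of `W_b` and the elements with at most two rows in `Sh(w)` are both characterized by
the same condition: the sequence `w(-n), …, w(-1), w(1), …, w(n)` has no decreasing subsequence of
length three (`Has321`).

*Reduced expressions* (`mem_Wb_iff`). The Coxeter length is the number of inversions up to the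
symmetry `(a, b) ↦ (-b, -a)`, and `s i * w` is shorter than `w` exactly if `i` is a left descent.
Inversions persist along a reduced expression, and a factor `s i * s j * s i` with `i ≥ 1` creates
a decreasing subsequence of length three. Conversely, let `w` have such a subsequence, and assume
by induction on the length that every left descent of `w` destroys all of them. Looking for left
descents between the three values of the subsequence shows that these are consecutive integers of
the same sign, or that `w` begins with `s 1 * s 0 * s 1`.

*Insertion* (`mem_Wb_iff_Sh`). The diagrams covered by the labels `< m` after `k` insertions form a
growth diagram, with the local rule `Domino.addable_bump`. Inside of two rows this rule is
simple: a domino that can be added to the rows `(a, b)` leads to `(a + 2, b)`, `(a, b + 2)`, or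
(if `a = b`) `(a + 1, b + 1)`, and two such dominoes combine to `(a + 2, b + 2)`, except that two
dominoes in the second row create a third row. By induction, the first row of a diagram with two
rows is the maximal length `lis` of an increasing subsequence of `w` at the positions
`±1, …, ±k` with values between `-m` and `m`, and a third row occurs exactly if there is a
decreasing subsequence of length three (`matches_filling`). The two facts on subsequences behind
this are `Enlarges.has321On_iff`, which says that the new decreasing subsequences of length three
appear exactly if neither of two enlargements increases `lis`, and the bound
`card_le_two_mul_lis`, which settles the case of two vertical dominoes.

*Bijectivity*. Inside of two rows the local rule can be inverted, so that an insertion is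
determined by its result and the previous shape (`DominoFilling.insertLabel_unique`), and every
removal of a border domino from the shape comes from an insertion
(`DominoFilling.exists_insertLabel_eq`). Recovering the letters from the last one to the first one
gives injectivity and surjectivity.
-/

/-! ### Length and left descents in the Weyl group of type B -/

namespace WeylB

/-- The smaller of the two values that are exchanged by `s i`, the larger one being `i + 1`. -/
def lo (i : ℕ) : ℤ := if i = 0 then -1 else i

theorem s_apply (i : ℕ) (x : ℤ) : s i x =
    if x = lo i then (i : ℤ) + 1 else if x = i + 1 then lo i
    else if x = -lo i then -i - 1 else if x = -i - 1 then -lo i else x := by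
  unfold s lo
  split_ifs <;> simp only [Equiv.Perm.mul_apply, Equiv.swap_apply_def] <;> split_ifs <;> omega

theorem s_hi (i : ℕ) : s i (i + 1) = lo i := by
  rw [s_apply]; unfold lo; split_ifs <;> omega

theorem s_lo (i : ℕ) : s i (lo i) = i + 1 := by
  rw [s_apply]; unfold lo; split_ifs <;> omega

theorem s_mul_s (i : ℕ) : s i * s i = 1 := by
  ext x
  rw [Equiv.Perm.mul_apply, s_apply i x]
  split_ifs <;> rw [s_apply] <;> unfold lo at * <;> simp only [Equiv.Perm.one_apply] <;>
    split_ifs at * <;> omega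

theorem s_mul_s_mul (i : ℕ) (w : Equiv.Perm ℤ) : s i * (s i * w) = w := by
  rw [← mul_assoc, s_mul_s, one_mul]

theorem s_inv (i : ℕ) : (s i)⁻¹ = s i := inv_eq_of_mul_eq_one_right (s_mul_s i)

theorem inv_s_mul_apply (i : ℕ) (w : Equiv.Perm ℤ) (x : ℤ) : (s i * w)⁻¹ x = w⁻¹ (s i x) := by
  rw [mul_inv_rev, s_inv]; rfl

/-- `s i` preserves the order of two nonzero integers, unless it exchanges them or their
negatives. -/
theorem s_lt_s {i : ℕ} {x y : ℤ} (hx : x ≠ 0) (hy : y ≠ 0) (h : x < y)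
    (h1 : ¬ (x = lo i ∧ y = i + 1)) (h2 : ¬ (x = -i - 1 ∧ y = -lo i)) : s i x < s i y := by
  rw [s_apply, s_apply]
  unfold lo at *
  split_ifs at * <;> omega

theorem s_ne_zero {i : ℕ} {x : ℤ} (hx : x ≠ 0) : s i x ≠ 0 := by
  rw [s_apply]
  unfold lo
  split_ifs <;> omega

/-- The signed permutations of `{±1, …, ±n}`, extended by the identity. -/
def IsSigned (n : ℕ) (w : Equiv.Perm ℤ) : Prop :=
  (∀ k, w (-k) = -w k) ∧ ∀ k : ℤ, n < k.natAbs → w k = k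

namespace IsSigned

variable {n : ℕ} {w : Equiv.Perm ℤ}

theorem zero (h : IsSigned n w) : w 0 = 0 := by
  have := h.1 0
  rw [neg_zero] at this
  omega

theorem ne_zero (h : IsSigned n w) {x : ℤ} (hx : x ≠ 0) : w x ≠ 0 := fun h0 =>
  hx (w.injective (h0.trans h.zero.symm))

theorem natAbs_le (h : IsSigned n w) {x : ℤ} (hx : x.natAbs ≤ n) : (w x).natAbs ≤ n := by
  by_contra hc
  have := w.injective (h.2 _ (not_le.1 hc))
  rw [this] at hc
  exact hc hx

theorem inv (h : IsSigned n w) : IsSigned n w⁻¹ := by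
  refine ⟨fun k => ?_, fun k hk => ?_⟩
  · rw [Equiv.Perm.inv_eq_iff_eq, h.1]; simp
  · rw [Equiv.Perm.inv_eq_iff_eq, h.2 k hk]

theorem s_mul (h : IsSigned n w) {i : ℕ} (hi : i < n) : IsSigned n (s i * w) := by
  refine ⟨fun k => ?_, fun k hk => ?_⟩
  · rw [Equiv.Perm.mul_apply, h.1, s_neg]; rfl
  · rw [Equiv.Perm.mul_apply, h.2 k hk, s_fix hi k hk]

end IsSigned

/-- `i` is a left descent of `w`: the value `i + 1` stands to the left of the smaller value that
`s i` exchanges with it. -/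
def Desc (i : ℕ) (w : Equiv.Perm ℤ) : Prop := w⁻¹ (i + 1) < w⁻¹ (lo i)

theorem desc_s_mul {i : ℕ} {w : Equiv.Perm ℤ} : Desc i (s i * w) ↔ ¬ Desc i w := by
  unfold Desc
  rw [inv_s_mul_apply, inv_s_mul_apply, s_hi, s_lo]
  have : w⁻¹ (i + 1) ≠ w⁻¹ (lo i) := fun h => by
    have := w⁻¹.injective h
    unfold lo at this
    split_ifs at this <;> omega
  omega

theorem IsSigned.lt_of_desc {n i : ℕ} {w : Equiv.Perm ℤ} (h : IsSigned n w) (hd : Desc i w) :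
    i < n := by
  by_contra hc
  unfold Desc at hd
  have h1 := h.inv.2 (i + 1) (by omega)
  by_cases h2 : n < (lo i).natAbs
  · rw [h1, h.inv.2 _ h2] at hd
    unfold lo at hd
    split_ifs at hd <;> omega
  · have := h.inv.natAbs_le (not_lt.1 h2)
    omega

/-- The inversions `(a, b)` of the signed permutation `w`, one for each pair
`{(a, b), (-b, -a)}`: those with `|a| ≤ b`. -/
noncomputable def invs (n : ℕ) (w : Equiv.Perm ℤ) : Finset (ℤ × ℤ) :=
  (Finset.Icc (-n : ℤ) n ×ˢ Finset.Icc (-n : ℤ) n).filter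
    fun x => x.1 ≠ 0 ∧ -x.2 ≤ x.1 ∧ x.1 < x.2 ∧ w x.2 < w x.1

/-- The number of inversions of `w`, which is its Coxeter length. -/
noncomputable def len (n : ℕ) (w : Equiv.Perm ℤ) : ℕ := (invs n w).card

theorem mem_invs {n : ℕ} {w : Equiv.Perm ℤ} {a b : ℤ} : (a, b) ∈ invs n w ↔
    b ≤ n ∧ a ≠ 0 ∧ -b ≤ a ∧ a < b ∧ w b < w a := by
  simp only [invs, Finset.mem_filter, Finset.mem_product, Finset.mem_Icc]
  constructor
  · tauto
  · rintro ⟨h1, h2, h3, h4, h5⟩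
    exact ⟨⟨⟨by omega, by omega⟩, by omega, by omega⟩, h2, h3, h4, h5⟩

/-- Removing a left descent `i` from `w` removes the inversion formed by the values `i + 1` and
`lo i` and the inversion formed by their negatives (which is the same one if `i = 0`), and
changes no other inversion. -/
theorem lt_iff_of_desc {n i : ℕ} {w : Equiv.Perm ℤ} (h : IsSigned n w) (hd : Desc i w) {a b : ℤ}
    (ha : a ≠ 0) (hb : b ≠ 0) (hab : a < b) : w b < w a ↔ (s i * w) b < (s i * w) a ∨
      (a = w⁻¹ (i + 1) ∧ b = w⁻¹ (lo i)) ∨ (a = -w⁻¹ (lo i) ∧ b = -w⁻¹ (i + 1)) := by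
  have e1 : ∀ x y, x = w⁻¹ y ↔ w x = y := fun x y => by
    rw [eq_comm, Equiv.Perm.inv_eq_iff_eq, eq_comm]
  have e2 : ∀ x y, x = -w⁻¹ y ↔ w x = -y := fun x y => by rw [← h.inv.1, e1]
  rw [e1, e1, e2, e2]
  have hne : w a ≠ w b := fun h => hab.ne (w.injective h)
  have ha' := h.ne_zero ha
  have hb' := h.ne_zero hb
  simp only [Equiv.Perm.mul_apply]
  constructor
  · intro hlt
    by_cases h1 : w b = lo i ∧ w a = i + 1
    · tauto
    by_cases h2 : w b = -i - 1 ∧ w a = -lo i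
    · right; right; exact ⟨h2.2, by omega⟩
    exact Or.inl (s_lt_s hb' ha' hlt h1 h2)
  · rintro (hlt | ⟨h1, h2⟩ | ⟨h1, h2⟩)
    · by_contra hc
      have hlt' : w a < w b := by omega
      unfold Desc at hd
      refine (s_lt_s ha' hb' hlt' ?_ ?_).not_gt hlt
      · rintro ⟨h1, h2⟩
        rw [← e1] at h1 h2
        omega
      · rintro ⟨h1, h2⟩
        rw [show -(i : ℤ) - 1 = -(i + 1) by ring] at h1
        rw [← e2] at h1 h2
        omega
    · rw [h1, h2]; unfold lo; split_ifs <;> omega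
    · rw [h1, h2]; unfold lo; split_ifs <;> omega

theorem len_of_desc {n i : ℕ} {w : Equiv.Perm ℤ} (h : IsSigned n w) (hd : Desc i w) :
    len n w = len n (s i * w) + 1 := by
  have hi := h.lt_of_desc hd
  have hp0 : w⁻¹ (lo i) ≠ 0 := h.inv.ne_zero (by unfold lo; split_ifs <;> omega)
  have hq0 : w⁻¹ (i + 1) ≠ 0 := h.inv.ne_zero (by omega)
  have hp := h.inv.natAbs_le (x := lo i) (by unfold lo; split_ifs <;> omega)
  have hq := h.inv.natAbs_le (x := i + 1) (by omega)
  have key := fun a b ha hb hab => @lt_iff_of_desc n i w h hd a b ha hb hab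
  have hd' := desc_s_mul.not.2 (not_not.2 hd)
  unfold Desc at hd hd'
  rw [inv_s_mul_apply, inv_s_mul_apply, s_hi, s_lo] at hd'
  have hs1 : (s i * w) (w⁻¹ (i + 1)) = lo i := by simp [s_hi]
  have hs2 : (s i * w) (w⁻¹ (lo i)) = i + 1 := by simp [s_lo]
  have hodd := (h.s_mul hi).1
  generalize w⁻¹ (lo i) = p at *
  generalize w⁻¹ (i + 1) = q at *
  have hlo : lo i < i + 1 := by unfold lo; split_ifs <;> omega
  unfold len
  have : invs n w = insert (if -p ≤ q then (q, p) else (-p, -q)) (invs n (s i * w)) := by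
    ext ⟨a, b⟩
    rw [Finset.mem_insert, mem_invs, mem_invs]
    constructor
    · rintro ⟨h1, h2, h3, h4, h5⟩
      rcases (key a b h2 (by omega) h4).1 h5 with h6 | ⟨rfl, rfl⟩ | ⟨rfl, rfl⟩
      · exact Or.inr ⟨h1, h2, h3, h4, h6⟩
      · left; rw [if_pos h3]
      · left
        split_ifs with h7
        · have : q = -p := by omega
          subst this; simp
        · rfl
    · rintro (h1 | ⟨h1, h2, h3, h4, h5⟩)
      · split_ifs at h1 with h2
        · obtain ⟨rfl, rfl⟩ := Prod.mk.inj h1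
          exact ⟨by omega, hq0, h2, hd, (key _ _ hq0 hp0 hd).2 (by simp)⟩
        · obtain ⟨rfl, rfl⟩ := Prod.mk.inj h1
          exact ⟨by omega, by omega, by omega, by omega,
            (key _ _ (by omega) (by omega) (by omega)).2 (by simp)⟩
      · exact ⟨h1, h2, h3, h4, (key a b h2 (by omega) h4).2 (Or.inl h5)⟩
  rw [this, Finset.card_insert_of_notMem]
  split_ifs with h2
  · rw [mem_invs, hs1, hs2]; omega
  · rw [mem_invs, hodd, hodd, hs1, hs2]; omega

theorem len_of_not_desc {n i : ℕ} {w : Equiv.Perm ℤ} (h : IsSigned n w) (hi : i < n)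
    (hd : ¬ Desc i w) : len n (s i * w) = len n w + 1 := by
  rw [len_of_desc (h.s_mul hi) (desc_s_mul.2 hd), s_mul_s_mul]

theorem IsSigned.one (n : ℕ) : IsSigned n 1 := ⟨fun _ => rfl, fun _ _ => rfl⟩

theorem len_one (n : ℕ) : len n 1 = 0 := by
  unfold len
  rw [Finset.card_eq_zero, Finset.eq_empty_iff_forall_notMem]
  rintro ⟨a, b⟩ h
  rw [mem_invs] at h
  simp at h
  omega

/-- Without left descents, `0 < w⁻¹ 1 < ⋯ < w⁻¹ n ≤ n`. -/
theorem eq_one_of_not_desc {n : ℕ} {w : Equiv.Perm ℤ} (h : IsSigned n w)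
    (hd : ∀ i < n, ¬ Desc i w) : w = 1 := by
  have hinv := h.inv
  have step : ∀ j : ℕ, 1 ≤ j → j < n → w⁻¹ j < w⁻¹ (j + 1) := by
    intro j h1 h2
    have h3 := hd j h2
    have h4 : w⁻¹ (j : ℤ) ≠ w⁻¹ (j + 1) := fun h => by
      have := w⁻¹.injective h
      omega
    unfold Desc lo at h3
    rw [if_neg (by omega)] at h3
    omega
  have h1 : ∀ j : ℕ, 1 ≤ j → j ≤ n → (j : ℤ) ≤ w⁻¹ j := by
    intro j hj1
    induction j, hj1 using Nat.le_induction with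
    | base =>
      intro hn
      have h3 := hd 0 (by omega)
      have h4 := hinv.ne_zero (x := 1) (by norm_num)
      unfold Desc lo at h3
      rw [if_pos rfl, hinv.1] at h3
      simp only [Nat.cast_zero, zero_add, Nat.cast_one] at *
      omega
    | succ j hj ih =>
      intro hn
      have := step j hj (by omega)
      have := ih (by omega)
      push_cast
      omega
  have h2 : ∀ d j : ℕ, j + d = n → 1 ≤ j → w⁻¹ (j : ℤ) ≤ j := by
    intro d
    induction d with
    | zero =>
      rintro j rfl hj
      have := hinv.natAbs_le (x := j) (by omega)
      omega
    | succ d ih =>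
      intro j hj hj1
      have := ih (j + 1) (by omega) (by omega)
      have := step j hj1 (by omega)
      push_cast at *
      omega
  have h3 : ∀ j : ℕ, w⁻¹ (j : ℤ) = j := by
    intro j
    rcases Nat.eq_zero_or_pos j with rfl | hj
    · exact hinv.zero
    rcases le_or_gt j n with hjn | hjn
    · exact le_antisymm (h2 (n - j) j (by omega) hj) (h1 j hj hjn)
    · exact hinv.2 _ (by simpa using hjn)
  have h4 : w⁻¹ = 1 := by
    ext x
    rcases Int.natAbs_eq x with hx | hx
    · rw [hx, h3]; rfl
    · rw [hx, hinv.1, h3]; rfl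
  rw [← inv_inv w, h4, inv_one]

/-- Every signed permutation has an expression whose length is the number of inversions. -/
theorem exists_expression {n : ℕ} (N : ℕ) (w : Equiv.Perm ℤ) (h : IsSigned n w)
    (hN : len n w = N) : ∃ l : List ℕ, (∀ i ∈ l, i < n) ∧ (l.map s).prod = w ∧ l.length = N := by
  induction N generalizing w with
  | zero =>
    refine ⟨[], by simp, ?_, rfl⟩
    rw [eq_one_of_not_desc h]
    · rfl
    · intro i hi hd
      have := len_of_desc h hd
      omega
  | succ N ih =>
    by_cases hd : ∃ i < n, Desc i w
    · obtain ⟨i, hi, hd⟩ := hd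
      obtain ⟨l, h1, h2, h3⟩ := ih _ (h.s_mul hi) (by have := len_of_desc h hd; omega)
      exact ⟨i :: l, by simpa [hi] using h1, by simp [h2, s_mul_s_mul], by simp [h3]⟩
    · rw [eq_one_of_not_desc h (fun i hi hd' => hd ⟨i, hi, hd'⟩), len_one] at hN
      omega

theorem mem_W_of_isSigned {n : ℕ} {w : Equiv.Perm ℤ} (h : IsSigned n w) : w ∈ W n := by
  obtain ⟨l, h1, rfl, -⟩ := exists_expression _ w h rfl
  refine Subgroup.list_prod_mem _ fun x hx => ?_
  obtain ⟨i, hi, rfl⟩ := List.mem_map.1 hx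
  exact Subgroup.subset_closure ⟨i, h1 i hi, rfl⟩

theorem isSigned_prod {n : ℕ} {l : List ℕ} (hl : ∀ i ∈ l, i < n) :
    IsSigned n (l.map s).prod := by
  induction l with
  | nil => exact IsSigned.one n
  | cons i l ih =>
    rw [List.map_cons, List.prod_cons]
    exact (ih fun j hj => hl j (List.mem_cons_of_mem _ hj)).s_mul (hl i List.mem_cons_self)

theorem len_prod_le {n : ℕ} {l : List ℕ} (hl : ∀ i ∈ l, i < n) :
    len n (l.map s).prod ≤ l.length := by
  induction l with
  | nil => simp [len_one]
  | cons i l ih =>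
    have hl' : ∀ j ∈ l, j < n := fun j hj => hl j (List.mem_cons_of_mem _ hj)
    have := ih hl'
    rw [List.map_cons, List.prod_cons, List.length_cons]
    by_cases hd : Desc i (l.map s).prod
    · have := len_of_desc (isSigned_prod hl') hd
      omega
    · have := len_of_not_desc (isSigned_prod hl') (hl i List.mem_cons_self) hd
      omega

theorem isReducedExpression_iff {n : ℕ} {w : W n} {l : List ℕ} :
    IsReducedExpression w l ↔ IsExpression w l ∧ l.length = len n w := by
  unfold IsReducedExpression IsExpression
  constructor
  · rintro ⟨⟨h1, h2⟩, h3⟩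
    refine ⟨⟨h1, h2⟩, le_antisymm ?_ (h2 ▸ len_prod_le h1)⟩
    obtain ⟨l', h4, h5, h6⟩ := exists_expression _ _ (mem_W w.2) rfl
    exact h6 ▸ h3 l' ⟨h4, h5⟩
  · rintro ⟨h1, h2⟩
    exact ⟨h1, fun l' h => h2 ▸ h.2 ▸ len_prod_le h.1⟩

/-- Words of minimal length are built from the right without meeting a left descent. -/
theorem not_desc_of_reduced {n i : ℕ} {l : List ℕ} (hl : ∀ j ∈ i :: l, j < n)
    (h : (i :: l).length = len n ((i :: l).map s).prod) :
    l.length = len n (l.map s).prod ∧ ¬ Desc i (l.map s).prod := by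
  have hl' : ∀ j ∈ l, j < n := fun j hj => hl j (List.mem_cons_of_mem _ hj)
  have h1 := len_prod_le hl'
  rw [List.map_cons, List.prod_cons, List.length_cons] at h
  by_cases hd : Desc i (l.map s).prod
  · have := len_of_desc (isSigned_prod hl') hd
    omega
  · have := len_of_not_desc (isSigned_prod hl') (hl i List.mem_cons_self) hd
    exact ⟨by omega, hd⟩

/-- The sequence `w (-n), …, w (-1), w 1, …, w n` has a decreasing subsequence of length three. -/
def Has321 (w : ℤ → ℤ) : Prop :=
  ∃ p q r : ℤ, p ≠ 0 ∧ q ≠ 0 ∧ r ≠ 0 ∧ p < q ∧ q < r ∧ w q < w p ∧ w r < w q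

theorem Has321.s_mul {n i : ℕ} {w : Equiv.Perm ℤ} (h : IsSigned n w) (hi : i < n)
    (hd : ¬ Desc i w) (h3 : Has321 w) : Has321 (s i * w : Equiv.Perm ℤ) := by
  have h' := h.s_mul hi
  have hd' := desc_s_mul.2 hd
  obtain ⟨p, q, r, hp, hq, hr, h1, h2, h3, h4⟩ := h3
  refine ⟨p, q, r, hp, hq, hr, h1, h2, ?_, ?_⟩
  · rw [lt_iff_of_desc h' hd' hp hq h1, s_mul_s_mul]; exact Or.inl h3
  · rw [lt_iff_of_desc h' hd' hq hr h2, s_mul_s_mul]; exact Or.inl h4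

/-- Suffixes of words of minimal length have minimal length, and their decreasing subsequences of
length three persist. -/
theorem Has321.of_suffix {n : ℕ} {l₁ l₂ : List ℕ} (hl : ∀ i ∈ l₁ ++ l₂, i < n)
    (h : (l₁ ++ l₂).length = len n ((l₁ ++ l₂).map s).prod) :
    l₂.length = len n (l₂.map s).prod ∧
      (Has321 (l₂.map s).prod → Has321 ((l₁ ++ l₂).map s).prod) := by
  induction l₁ with
  | nil => exact ⟨h, id⟩
  | cons i l ih =>
    have h1 := not_desc_of_reduced hl h
    have hl' : ∀ j ∈ l ++ l₂, j < n := fun j hj => hl j (List.mem_cons_of_mem _ hj)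
    have h2 := ih hl' h1.1
    refine ⟨h2.1, fun h3 => ?_⟩
    rw [List.cons_append, List.map_cons, List.prod_cons]
    exact (h2.2 h3).s_mul (isSigned_prod hl') (hl i (by simp)) h1.2

theorem s_apply_pos {i : ℕ} (hi : 1 ≤ i) (x : ℤ) : s i x =
    if x = i then (i : ℤ) + 1 else if x = i + 1 then (i : ℤ)
    else if x = -i then -i - 1 else if x = -i - 1 then -(i : ℤ) else x := by
  rw [s_apply, show lo i = i from if_neg (by omega)]

theorem lo_pos {i : ℕ} (hi : 1 ≤ i) : lo i = i := if_neg (by omega)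

/-- The factor `s i * s (i + 1) * s i` reverses the values `i`, `i + 1`, `i + 2`. -/
theorem has321_braid_up {n : ℕ} {y : Equiv.Perm ℤ} (hy : IsSigned n y) {i : ℕ} (hi : 1 ≤ i)
    (d1 : ¬ Desc i (s (i + 1) * (s i * y))) (d3 : ¬ Desc i y) :
    Has321 (s i * (s (i + 1) * (s i * y)) : Equiv.Perm ℤ) := by
  have hyy : ∀ x, y (y⁻¹ x) = x := fun x => by simp
  have hinj : ∀ a b, a ≠ b → y⁻¹ a ≠ y⁻¹ b := fun a b hab h => hab (y⁻¹.injective h)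
  have e1 : s (i + 1) i = i := by
    rw [s_apply_pos (by omega)]; push_cast; split_ifs <;> omega
  have e2 : s (i + 1) (i + 1) = i + 2 := by
    rw [s_apply_pos (by omega)]; push_cast; split_ifs <;> omega
  have e3 : s i (i + 2) = i + 2 := by rw [s_apply_pos hi]; split_ifs <;> omega
  have e4 : s i i = i + 1 := by rw [s_apply_pos hi]; split_ifs <;> omega
  have e5 : s i (i + 1) = i := by rw [s_apply_pos hi]; split_ifs <;> omega
  have e6 : s (i + 1) (i + 2) = i + 1 := by
    rw [s_apply_pos (by omega)]; push_cast; split_ifs <;> omega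
  unfold Desc at d1 d3
  rw [lo_pos hi] at d1 d3
  rw [inv_s_mul_apply, inv_s_mul_apply, inv_s_mul_apply, inv_s_mul_apply, e1, e2, e3, e4] at d1
  have n1 := hinj i (i + 1) (by omega)
  have n2 := hinj (i + 1) (i + 2) (by omega)
  have n3 := hinj i (i + 2) (by omega)
  refine ⟨y⁻¹ i, y⁻¹ (i + 1), y⁻¹ (i + 2), hy.inv.ne_zero (by omega), hy.inv.ne_zero (by omega),
    hy.inv.ne_zero (by omega), by omega, by omega, ?_, ?_⟩ <;>
  simp only [Equiv.Perm.mul_apply, hyy, e1, e2, e3, e4, e5, e6] <;> omega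

/-- The factor `s (i + 1) * s i * s (i + 1)` reverses the values `i`, `i + 1`, `i + 2`. -/
theorem has321_braid_down {n : ℕ} {y : Equiv.Perm ℤ} (hy : IsSigned n y) {i : ℕ} (hi : 1 ≤ i)
    (d1 : ¬ Desc (i + 1) (s i * (s (i + 1) * y)))
    (d2 : ¬ Desc i (s (i + 1) * y)) (d3 : ¬ Desc (i + 1) y) :
    Has321 (s (i + 1) * (s i * (s (i + 1) * y)) : Equiv.Perm ℤ) := by
  have hyy : ∀ x, y (y⁻¹ x) = x := fun x => by simp
  have hinj : ∀ a b, a ≠ b → y⁻¹ a ≠ y⁻¹ b := fun a b hab h => hab (y⁻¹.injective h)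
  have e1 : s (i + 1) i = i := by
    rw [s_apply_pos (by omega)]; push_cast; split_ifs <;> omega
  have e2 : s (i + 1) (i + 1) = i + 2 := by
    rw [s_apply_pos (by omega)]; push_cast; split_ifs <;> omega
  have e3 : s i (i + 2) = i + 2 := by rw [s_apply_pos hi]; split_ifs <;> omega
  have e4 : s i i = i + 1 := by rw [s_apply_pos hi]; split_ifs <;> omega
  have e5 : s i (i + 1) = i := by rw [s_apply_pos hi]; split_ifs <;> omega
  have e6 : s (i + 1) (i + 2) = i + 1 := by
    rw [s_apply_pos (by omega)]; push_cast; split_ifs <;> omega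
  have e7 : ((i + 1 : ℕ) : ℤ) + 1 = i + 2 := by push_cast; ring
  have e8 : lo (i + 1) = i + 1 := by rw [lo_pos (by omega)]; push_cast; rfl
  unfold Desc at d1 d2 d3
  rw [e7, e8] at d1 d3
  rw [inv_s_mul_apply, inv_s_mul_apply, inv_s_mul_apply, inv_s_mul_apply, e3, e6, e5, e1] at d1
  rw [inv_s_mul_apply, inv_s_mul_apply, lo_pos hi, e2, e1] at d2
  have n1 := hinj i (i + 1) (by omega)
  have n2 := hinj (i + 1) (i + 2) (by omega)
  have n3 := hinj i (i + 2) (by omega)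
  refine ⟨y⁻¹ i, y⁻¹ (i + 1), y⁻¹ (i + 2), hy.inv.ne_zero (by omega), hy.inv.ne_zero (by omega),
    hy.inv.ne_zero (by omega), by omega, by omega, ?_, ?_⟩ <;>
  simp only [Equiv.Perm.mul_apply, hyy, e1, e2, e3, e4, e5, e6] <;> omega

/-- The factor `s 1 * s 0 * s 1` maps the values `-2`, `1`, `2` to `2`, `1`, `-2`. -/
theorem has321_braid_zero {n : ℕ} {y : Equiv.Perm ℤ} (hy : IsSigned n y)
    (d1 : ¬ Desc 1 (s 0 * (s 1 * y))) (d3 : ¬ Desc 1 y) :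
    Has321 (s 1 * (s 0 * (s 1 * y)) : Equiv.Perm ℤ) := by
  have hyy : ∀ x, y (y⁻¹ x) = x := fun x => by simp
  have hinj : ∀ a b, a ≠ b → y⁻¹ a ≠ y⁻¹ b := fun a b hab h => hab (y⁻¹.injective h)
  have f1 : s 0 1 = -1 := by simp [s]
  have f2 : s 0 2 = 2 := by rw [s_apply]; unfold lo; norm_num
  have f4 : s 1 2 = 1 := by rw [s_apply]; unfold lo; norm_num
  have f5 : s 1 1 = 2 := by rw [s_apply]; unfold lo; norm_num
  have f6' : lo 1 = 1 := rfl
  have f8 : s 1 (-2) = -1 := by rw [s_neg, f4]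
  have f9 : s 0 (-1) = 1 := by rw [s_neg, f1]; rfl
  have f3 : s 1 (-1) = -2 := by rw [s_neg, f5]
  have f10 : ((1 : ℕ) : ℤ) + 1 = 2 := rfl
  unfold Desc at d1 d3
  rw [f10, f6'] at d1 d3
  rw [inv_s_mul_apply, inv_s_mul_apply, inv_s_mul_apply, inv_s_mul_apply, f2, f4, f1, f3] at d1
  have n1 := hinj 1 2 (by norm_num)
  have n2 := hinj 1 (-2) (by norm_num)
  have o2 : y⁻¹ (-2) = -y⁻¹ 2 := hy.inv.1 2
  refine ⟨y⁻¹ (-2), y⁻¹ 1, y⁻¹ 2, hy.inv.ne_zero (by omega), hy.inv.ne_zero (by omega),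
    hy.inv.ne_zero (by omega), by omega, by omega, ?_, ?_⟩ <;>
  simp only [Equiv.Perm.mul_apply, hyy, f1, f2, f3, f4, f5, f8, f9] <;>
  omega

/-- A reduced word that starts with `i, i ± 1, i`, where `i ≥ 1`, has a decreasing subsequence of
length three. -/
theorem has321_of_braid {n i j : ℕ} {l : List ℕ} (hi : 1 ≤ i) (hij : j = i + 1 ∨ j + 1 = i)
    (hl : ∀ k ∈ i :: j :: i :: l, k < n)
    (h : (i :: j :: i :: l).length = len n ((i :: j :: i :: l).map s).prod) :
    Has321 ((i :: j :: i :: l).map s).prod := by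
  obtain ⟨h1, d1⟩ := not_desc_of_reduced hl h
  have hl1 : ∀ k ∈ j :: i :: l, k < n := fun k hk => hl k (List.mem_cons_of_mem _ hk)
  obtain ⟨h2, d2⟩ := not_desc_of_reduced hl1 h1
  have hl2 : ∀ k ∈ i :: l, k < n := fun k hk => hl1 k (List.mem_cons_of_mem _ hk)
  obtain ⟨h3, d3⟩ := not_desc_of_reduced hl2 h2
  have hy := isSigned_prod fun k hk => hl2 k (List.mem_cons_of_mem _ hk)
  simp only [List.map_cons, List.prod_cons] at *
  rcases hij with rfl | rfl
  · exact has321_braid_up hy hi d1 d3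
  · rcases Nat.eq_zero_or_pos j with rfl | hj
    · exact has321_braid_zero hy d1 d3
    · exact has321_braid_down hy hj d1 d2 d3

end WeylB

/-! ### Reduced expressions and decreasing subsequences -/

namespace WeylB

theorem s_s (i : ℕ) (x : ℤ) : s i (s i x) = x := by
  rw [← Equiv.Perm.mul_apply, s_mul_s]; rfl

/-- The values of a decreasing subsequence of length three, in terms of the positions `v = w⁻¹`. -/
def Triple (v : ℤ → ℤ) (A B C : ℤ) : Prop :=
  A ≠ 0 ∧ B ≠ 0 ∧ C ≠ 0 ∧ C < B ∧ B < A ∧ v A < v B ∧ v B < v C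

theorem has321_iff_triple {n : ℕ} {w : Equiv.Perm ℤ} (h : IsSigned n w) :
    Has321 w ↔ ∃ A B C, Triple (w⁻¹ : Equiv.Perm ℤ) A B C := by
  constructor
  · rintro ⟨p, q, r, hp, hq, hr, h1, h2, h3, h4⟩
    exact ⟨w p, w q, w r, h.ne_zero hp, h.ne_zero hq, h.ne_zero hr, h4, h3,
      by simpa using h1, by simpa using h2⟩
  · rintro ⟨A, B, C, hA, hB, hC, h1, h2, h3, h4⟩
    exact ⟨_, _, _, h.inv.ne_zero hA, h.inv.ne_zero hB, h.inv.ne_zero hC, h3, h4,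
      by simpa using h2, by simpa using h1⟩

/-- The pair `{x, y}`, `x < y`, is exchanged by `s i`. -/
def Swaps (i : ℕ) (x y : ℤ) : Prop := (x = lo i ∧ y = i + 1) ∨ (x = -i - 1 ∧ y = -lo i)

/-- A left descent that destroys a decreasing subsequence of length three exchanges two neighbours
of it. -/
theorem Triple.swaps_of_not_has321 {n i : ℕ} {w : Equiv.Perm ℤ} (h : IsSigned n w)
    (hi : i < n) (h3 : ¬ Has321 (s i * w : Equiv.Perm ℤ)) {A B C : ℤ}
    (ht : Triple (w⁻¹ : Equiv.Perm ℤ) A B C) : Swaps i B A ∨ Swaps i C B := by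
  obtain ⟨hA, hB, hC, h1, h2, h4, h5⟩ := ht
  by_contra hc
  unfold Swaps at hc
  refine h3 ((has321_iff_triple (h.s_mul hi)).2 ⟨s i A, s i B, s i C, s_ne_zero hA,
    s_ne_zero hB, s_ne_zero hC, s_lt_s hC hB h1 (by tauto) (by tauto),
    s_lt_s hB hA h2 (by tauto) (by tauto), ?_, ?_⟩) <;>
  · rw [inv_s_mul_apply, inv_s_mul_apply, s_s, s_s]
    assumption

theorem Triple.neg {n : ℕ} {v : Equiv.Perm ℤ} (h : IsSigned n v) {A B C : ℤ}
    (ht : Triple v A B C) : Triple v (-C) (-B) (-A) := by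
  obtain ⟨hA, hB, hC, h1, h2, h4, h5⟩ := ht
  refine ⟨by omega, by omega, by omega, by omega, by omega, ?_, ?_⟩ <;> simp only [h.1] <;> omega

/-- Between two values `X < Y` with `Y` to the left of `X` there are two neighbouring values with
the same property. -/
theorem exists_desc_between {n : ℕ} {w : Equiv.Perm ℤ} (h : IsSigned n w) (d : ℕ) {X Y : ℤ}
    (hX : X ≠ 0) (hY : Y ≠ 0) (hd : Y - X ≤ d) (hXY : X < Y) (hv : w⁻¹ Y < w⁻¹ X) :
    ∃ i, Desc i w ∧ ∃ x y, Swaps i x y ∧ X ≤ x ∧ y ≤ Y := by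
  induction d generalizing Y with
  | zero => omega
  | succ d ih =>
    -- the predecessor of `Y` among the nonzero integers
    obtain ⟨Z, hZ0, hZY, hXZ, i, hs⟩ : ∃ Z, Z ≠ 0 ∧ Z < Y ∧ X ≤ Z ∧ ∃ i, Swaps i Z Y := by
      unfold Swaps lo
      rcases lt_trichotomy Y 1 with h1 | rfl | h1
      · refine ⟨Y - 1, by omega, by omega, by omega, Y.natAbs, ?_⟩
        split_ifs <;> omega
      · exact ⟨-1, by omega, by omega, by omega, 0, by simp⟩
      · refine ⟨Y - 1, by omega, by omega, by omega, (Y - 1).natAbs, ?_⟩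
        split_ifs <;> omega
    by_cases hvZ : w⁻¹ Y < w⁻¹ Z
    · refine ⟨i, ?_, Z, Y, hs, hXZ, le_rfl⟩
      unfold Desc
      rcases hs with ⟨rfl, rfl⟩ | ⟨rfl, rfl⟩
      · exact hvZ
      · rw [show -(i : ℤ) - 1 = -(i + 1) by ring, h.inv.1, h.inv.1] at hvZ
        omega
    · have hXZ' : X < Z := by
        refine lt_of_le_of_ne hXZ ?_
        rintro rfl
        exact hvZ hv
      obtain ⟨j, h1, x, y, h2, h3, h4⟩ := ih hZ0 (by omega) hXZ' (by omega)
      exact ⟨j, h1, x, y, h2, h3, by omega⟩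

/-- The word `s i, s j, s i` splits off on the left from a reduced expression. -/
theorem exists_braid_of_desc {n i j : ℕ} {w : Equiv.Perm ℤ} (h : IsSigned n w) (d1 : Desc i w)
    (d2 : Desc j (s i * w)) (d3 : Desc i (s j * (s i * w))) :
    ∃ l : List ℕ, (∀ k ∈ l, k < n) ∧ (l.map s).prod = w ∧ l.length = len n w ∧
      [i, j, i] <:+: l := by
  have h1 := h.s_mul (h.lt_of_desc d1)
  have h2 := h1.s_mul (h1.lt_of_desc d2)
  have h3 := h2.s_mul (h2.lt_of_desc d3)
  obtain ⟨l, l1, l2, l3⟩ := exists_expression _ _ h3 rfl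
  refine ⟨i :: j :: i :: l, ?_, ?_, ?_, ⟨[], l, rfl⟩⟩
  · simpa [h.lt_of_desc d1, h1.lt_of_desc d2] using l1
  · simp only [List.map_cons, List.prod_cons, l2, s_mul_s_mul]
  · simp only [List.length_cons, l3]
    rw [len_of_desc h d1, len_of_desc h1 d2, len_of_desc h2 d3]

/-- A word for `w` of minimal length that contains `i, i ± 1, i` with `i ≥ 1`. -/
def HasBraid (n : ℕ) (w : Equiv.Perm ℤ) : Prop :=
  ∃ l : List ℕ, (∀ k ∈ l, k < n) ∧ (l.map s).prod = w ∧ l.length = len n w ∧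
    ∃ i j, 1 ≤ i ∧ (j = i + 1 ∨ j + 1 = i) ∧ [i, j, i] <:+: l

theorem hasBraid_of_consecutive {n : ℕ} {w : Equiv.Perm ℤ} (h : IsSigned n w) {i : ℕ} (hi : 1 ≤ i)
    (ht : Triple (w⁻¹ : Equiv.Perm ℤ) (i + 2) (i + 1) i) : HasBraid n w := by
  obtain ⟨-, -, -, -, -, h1, h2⟩ := ht
  have e1 : s (i + 1) i = i := by
    rw [s_apply_pos (by omega)]; push_cast; split_ifs <;> omega
  have e2 : s (i + 1) (i + 1) = i + 2 := by
    rw [s_apply_pos (by omega)]; push_cast; split_ifs <;> omega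
  have e3 : s i (i + 2) = i + 2 := by rw [s_apply_pos hi]; split_ifs <;> omega
  have e4 : s i i = i + 1 := by rw [s_apply_pos hi]; split_ifs <;> omega
  have e5 : s i (i + 1) = i := by rw [s_apply_pos hi]; split_ifs <;> omega
  have e7 : ((i + 1 : ℕ) : ℤ) + 1 = i + 2 := by push_cast; ring
  have e8 : lo (i + 1) = i + 1 := by rw [lo_pos (by omega)]; push_cast; rfl
  obtain ⟨l, l1, l2, l3, l4⟩ := exists_braid_of_desc (i := i) (j := i + 1) h
    (by unfold Desc; rw [lo_pos hi]; exact h2)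
    (by
      unfold Desc
      rw [inv_s_mul_apply, inv_s_mul_apply, e7, e8, e3, e5]
      omega)
    (by
      unfold Desc
      rw [lo_pos hi, inv_s_mul_apply, inv_s_mul_apply, inv_s_mul_apply, inv_s_mul_apply,
        e1, e2, e3, e4]
      exact h1)
  exact ⟨l, l1, l2, l3, i, i + 1, hi, Or.inl rfl, l4⟩

theorem hasBraid_of_zero {n : ℕ} {w : Equiv.Perm ℤ} (h : IsSigned n w)
    (h1 : w⁻¹ 2 < 0) (h2 : 0 < w⁻¹ 1) (h3 : w⁻¹ 1 < -w⁻¹ 2) : HasBraid n w := by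
  have f1 : s 0 1 = -1 := by simp [s]
  have f2 : s 0 2 = 2 := by rw [s_apply]; unfold lo; norm_num
  have f4 : s 1 2 = 1 := by rw [s_apply]; unfold lo; norm_num
  have f5 : s 1 1 = 2 := by rw [s_apply]; unfold lo; norm_num
  have f6 : lo 0 = -1 := rfl
  have f6' : lo 1 = 1 := rfl
  have f3 : s 1 (-1) = -2 := by rw [s_neg, f5]
  have f10 : ((1 : ℕ) : ℤ) + 1 = 2 := rfl
  have f11 : ((0 : ℕ) : ℤ) + 1 = 1 := rfl
  have o2 : w⁻¹ (-2) = -w⁻¹ 2 := h.inv.1 2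
  obtain ⟨l, l1, l2, l3, l4⟩ := exists_braid_of_desc (i := 1) (j := 0) h
    (by unfold Desc; rw [f10, f6']; omega)
    (by
      unfold Desc
      rw [inv_s_mul_apply, inv_s_mul_apply, f6, f11, f5, f3]
      omega)
    (by
      unfold Desc
      rw [f10, f6', inv_s_mul_apply, inv_s_mul_apply, inv_s_mul_apply, inv_s_mul_apply,
        f2, f4, f1, f3]
      omega)
  exact ⟨l, l1, l2, l3, 1, 0, le_rfl, Or.inr rfl, l4⟩

/-- Every left descent of `w` destroys all decreasing subsequences of length three. -/
def Minimal321 (w : Equiv.Perm ℤ) : Prop :=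
  ∀ i, Desc i w → ∀ A B C, Triple (w⁻¹ : Equiv.Perm ℤ) A B C → Swaps i B A ∨ Swaps i C B

/-- The case where a left descent between `C` and `B` exchanges `-A` and `-B`. Since all other
neighbouring values between `C` and `B` stand in increasing order, the values `A`, `1`, `-A` form
a decreasing subsequence, which forces `A = 2`; then `w` begins with `s 1 * s 0 * s 1`. -/
theorem hasBraid_of_symmetric {n : ℕ} {w : Equiv.Perm ℤ} (h : IsSigned n w) (hk : Minimal321 w)
    {A B C : ℤ} (ht : Triple (w⁻¹ : Equiv.Perm ℤ) A B C) (hB : 0 < B) (hAB : A = B + 1)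
    (hC : C ≤ -A) : HasBraid n w := by
  have hinj : ∀ a b, a ≠ b → w⁻¹ a ≠ w⁻¹ b := fun a b hab h => hab (w⁻¹.injective h)
  have hodd := h.inv.1
  obtain ⟨-, hB0, hC0, h1, h2, h3, h4⟩ := id ht
  -- between `C` and `B`, only `-A` and `-B` form a left descent
  have key : ∀ X Y, X ≠ 0 → Y ≠ 0 → C ≤ X → X < Y → Y ≤ B → (-A < X ∨ Y < -B) →
      w⁻¹ X < w⁻¹ Y := by
    intro X Y hX hY hCX hXY hYB hor
    by_contra hc
    have hlt : w⁻¹ Y < w⁻¹ X := lt_of_le_of_ne (not_lt.1 hc) (hinj _ _ hXY.ne')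
    obtain ⟨i, hd, x, y, hs, hx, hy⟩ :=
      exists_desc_between h (Y - X).toNat hX hY (by omega) hXY hlt
    have := hk i hd A B C ht
    unfold Swaps lo at *
    split_ifs at * <;> omega
  have k1 : w⁻¹ C ≤ -w⁻¹ A := by
    rw [← hodd]
    rcases eq_or_lt_of_le hC with rfl | hlt
    · rfl
    · exact (key C (-A) hC0 (by omega) le_rfl hlt (by omega) (by omega)).le
  have k2 : 0 < w⁻¹ B := by
    have := key (-B) B (by omega) hB0 (by omega) (by omega) le_rfl (by omega)
    rw [hodd] at this
    omega
  rcases eq_or_lt_of_le (show 1 ≤ B from hB) with rfl | hB1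
  · subst hAB
    exact hasBraid_of_zero h (by norm_num at *; omega) k2 (by norm_num at *; omega)
  · have k3 := key 1 B (by omega) hB0 (by omega) hB1 le_rfl (by omega)
    have k4 := key (-1) 1 (by omega) (by omega) (by omega) (by omega) (by omega) (by omega)
    rw [hodd] at k4
    have ht' : Triple (w⁻¹ : Equiv.Perm ℤ) A 1 (-A) :=
      ⟨by omega, by omega, by omega, by omega, by omega, by omega, by rw [hodd]; omega⟩
    have hd : Desc B.toNat w := by
      unfold Desc
      rw [lo_pos (by omega), Int.toNat_of_nonneg hB.le, ← hAB]
      exact h3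
    have := hk _ hd _ _ _ ht'
    unfold Swaps lo at this
    split_ifs at this <;> omega

/-- If the values `2, 1, -1` form a decreasing subsequence, then so do `2, 1, -2`, which
survives the removal of the left descent `0`. -/
theorem Minimal321.not_triple {n : ℕ} {w : Equiv.Perm ℤ} (h : IsSigned n w) (hk : Minimal321 w) :
    ¬ Triple (w⁻¹ : Equiv.Perm ℤ) 2 1 (-1) := by
  rintro ⟨-, -, -, -, -, h1, h2⟩
  have hodd := h.inv.1
  have hd : Desc 0 w := h2
  rw [hodd] at h2
  have := hk 0 hd 2 1 (-2) ⟨by omega, by omega, by omega, by omega, by omega, h1, by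
    rw [hodd]; omega⟩
  unfold Swaps lo at this
  norm_num at this

/-- Left descents are taken between the values `C` and `B` and between the values `B` and `A`. -/
theorem hasBraid_of_minimal {n : ℕ} {w : Equiv.Perm ℤ} (h : IsSigned n w) (hk : Minimal321 w)
    {A B C : ℤ} (ht : Triple (w⁻¹ : Equiv.Perm ℤ) A B C) : HasBraid n w := by
  obtain ⟨hA0, hB0, hC0, h1, h2, h3, h4⟩ := id ht
  have ht' := ht.neg h.inv
  have c1 : (B = C + 1 ∨ (C = -1 ∧ B = 1)) ∨ (0 < B ∧ A = B + 1 ∧ C ≤ -A) := by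
    obtain ⟨i, hd, x, y, hs, hx, hy⟩ :=
      exists_desc_between h (B - C).toNat hC0 hB0 (by omega) h1 h4
    have := hk i hd A B C ht
    unfold Swaps lo at *
    split_ifs at * <;> omega
  have c2 : (A = B + 1 ∨ (B = -1 ∧ A = 1)) ∨ (0 < -B ∧ -C = -B + 1 ∧ -A ≤ C) := by
    obtain ⟨i, hd, x, y, hs, hx, hy⟩ :=
      exists_desc_between h (A - B).toNat hB0 hA0 (by omega) h2 h3
    have := hk i hd A B C ht
    unfold Swaps lo at *
    split_ifs at * <;> omega
  rcases c1 with c1 | ⟨c1, c3, c4⟩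
  swap
  · exact hasBraid_of_symmetric h hk ht c1 c3 c4
  rcases c2 with c2 | ⟨c2, c3, c4⟩
  swap
  · exact hasBraid_of_symmetric h hk ht' c2 c3 (by omega)
  have c : (∃ i : ℕ, 1 ≤ i ∧ C = i ∧ B = i + 1 ∧ A = i + 2) ∨
      (∃ i : ℕ, 1 ≤ i ∧ -A = i ∧ -B = i + 1 ∧ -C = i + 2) ∨
      (A = 2 ∧ B = 1 ∧ C = -1) ∨ (-C = 2 ∧ -B = 1 ∧ -A = -1) := by
    by_cases hC : 0 < C
    · exact Or.inl ⟨C.toNat, by omega, by omega, by omega, by omega⟩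
    by_cases hA : A < 0
    · exact Or.inr (Or.inl ⟨(-A).toNat, by omega, by omega, by omega, by omega⟩)
    omega
  rcases c with ⟨i, hi, rfl, rfl, rfl⟩ | ⟨i, hi, e1, e2, e3⟩ | ⟨rfl, rfl, rfl⟩ | ⟨e1, e2, e3⟩
  · exact hasBraid_of_consecutive h hi ht
  · rw [e1, e2, e3] at ht'
    exact hasBraid_of_consecutive h hi ht'
  · exact absurd ht (hk.not_triple h)
  · rw [e1, e2, e3] at ht'
    exact absurd ht' (hk.not_triple h)

theorem hasBraid_of_has321 {n : ℕ} (N : ℕ) {w : Equiv.Perm ℤ} (h : IsSigned n w)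
    (hN : len n w = N) (h3 : Has321 w) : HasBraid n w := by
  induction N generalizing w with
  | zero =>
    obtain ⟨l, -, rfl, hl⟩ := exists_expression _ w h hN
    obtain rfl := List.length_eq_zero_iff.1 hl
    obtain ⟨p, q, r, -, -, -, h1, -, h2, -⟩ := h3
    exact absurd h2 h1.not_gt
  | succ N ih =>
    by_cases hd : ∃ i, Desc i w ∧ Has321 (s i * w : Equiv.Perm ℤ)
    · obtain ⟨i, hd, h3'⟩ := hd
      have hi := h.lt_of_desc hd
      have hlen := len_of_desc h hd
      obtain ⟨l, l1, l2, l3, j, k, l4, l5, l6⟩ := ih (h.s_mul hi) (by omega) h3'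
      refine ⟨i :: l, ?_, ?_, ?_, j, k, l4, l5, l6.trans (List.suffix_cons i l).isInfix⟩
      · simpa [hi] using l1
      · simp only [List.map_cons, List.prod_cons, l2, s_mul_s_mul]
      · rw [List.length_cons, l3, hlen]
    · obtain ⟨A, B, C, ht⟩ := (has321_iff_triple h).1 h3
      exact hasBraid_of_minimal h (fun i hi A B C ht =>
        ht.swaps_of_not_has321 h (h.lt_of_desc hi) fun h' => hd ⟨i, hi, h'⟩) ht

/-- The elements of `W_b` are those whose sequence `w (-n), …, w (-1), w 1, …, w n` has no
decreasing subsequence of length three. -/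
theorem mem_Wb_iff {n : ℕ} (w : W n) : w ∈ Wb n ↔ ¬ Has321 (w : Equiv.Perm ℤ) := by
  refine not_congr ⟨?_, fun h => ?_⟩
  · rintro ⟨l, hl, i, j, hi, hij, l₁, l₂, rfl⟩
    rw [isReducedExpression_iff] at hl
    obtain ⟨⟨h1, h2⟩, h3⟩ := hl
    rw [← h2] at h3 ⊢
    rw [List.append_assoc] at *
    have h4 := Has321.of_suffix h1 h3
    exact h4.2 (has321_of_braid hi hij (fun k hk => h1 k (List.mem_append_right _ hk)) h4.1)
  · obtain ⟨l, h1, h2, h3, i, j, h4, h5, h6⟩ := hasBraid_of_has321 _ (mem_W w.2) rfl h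
    exact ⟨l, isReducedExpression_iff.2 ⟨⟨h1, h2⟩, h3⟩, i, j, h4, h5, h6⟩

end WeylB

/-! ### Increasing subsequences of signed sequences -/

open Classical in
/-- The maximal length of an increasing subsequence of `w` at positions in `A`. -/
noncomputable def lis (w : ℤ → ℤ) (A : Finset ℤ) : ℕ :=
  (A.powerset.filter fun C : Finset ℤ => StrictMonoOn w (C : Set ℤ)).sup Finset.card

/-- `w` has a decreasing subsequence of length three at positions in `A`. -/
def Has321On (w : ℤ → ℤ) (A : Finset ℤ) : Prop :=
  ∃ p ∈ A, ∃ q ∈ A, ∃ r ∈ A, p < q ∧ q < r ∧ w q < w p ∧ w r < w q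

theorem Has321On.mono {w : ℤ → ℤ} {A B : Finset ℤ} (hAB : A ⊆ B) (h : Has321On w A) :
    Has321On w B := by
  obtain ⟨p, hp, q, hq, r, hr, h⟩ := h
  exact ⟨p, hAB hp, q, hAB hq, r, hAB hr, h⟩

theorem card_le_lis {w : ℤ → ℤ} {A C : Finset ℤ} (hC : C ⊆ A) (h : StrictMonoOn w C) :
    C.card ≤ lis w A := by
  classical
  exact Finset.le_sup (f := Finset.card) (Finset.mem_filter.2 ⟨Finset.mem_powerset.2 hC, h⟩)

theorem exists_card_eq_lis (w : ℤ → ℤ) (A : Finset ℤ) :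
    ∃ C ⊆ A, StrictMonoOn w C ∧ C.card = lis w A := by
  classical
  obtain ⟨C, hC, h⟩ := Finset.exists_mem_eq_sup
    (A.powerset.filter fun C : Finset ℤ => StrictMonoOn w (C : Set ℤ))
    ⟨∅, by simp [StrictMonoOn]⟩ Finset.card
  rw [Finset.mem_filter, Finset.mem_powerset] at hC
  refine ⟨C, hC.1, hC.2, ?_⟩
  rw [← h, lis]

theorem lis_mono {w : ℤ → ℤ} {A B : Finset ℤ} (hAB : A ⊆ B) : lis w A ≤ lis w B := by
  obtain ⟨C, h1, h2, h3⟩ := exists_card_eq_lis w A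
  exact h3 ▸ card_le_lis (h1.trans hAB) h2

/-- A sequence without decreasing subsequence of length three is the union of two increasing
ones: the entries with and without a larger entry to their left. -/
theorem card_le_two_mul_lis {w : ℤ → ℤ} (hw : Function.Injective w) {A : Finset ℤ}
    (h : ¬ Has321On w A) : A.card ≤ 2 * lis w A := by
  classical
  rw [← Finset.card_filter_add_card_filter_not (fun p => ∃ q ∈ A, q < p ∧ w p < w q), two_mul]
  refine add_le_add (card_le_lis (Finset.filter_subset _ _) ?_)
    (card_le_lis (Finset.filter_subset _ _) ?_)
  · intro p hp r hr hpr
    simp only [Finset.coe_filter, Set.mem_ofPred_eq] at hp hr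
    obtain ⟨hp, q, hq, h1, h2⟩ := hp
    by_contra hc
    have : w r ≠ w p := fun h => hpr.ne' (hw h)
    exact h ⟨q, hq, p, hp, r, hr.1, h1, hpr, h2, by omega⟩
  · intro p hp r hr hpr
    simp only [Finset.coe_filter, Set.mem_ofPred_eq] at hp hr
    by_contra hc
    have : w r ≠ w p := fun h => hpr.ne' (hw h)
    exact hr.2 ⟨p, hp.1, hpr, by omega⟩

/-- Adjoining the positions `±u` to `A`. -/
def adjoin (A : Finset ℤ) (u : ℤ) : Finset ℤ := insert u (insert (-u) A)

theorem mem_adjoin {A : Finset ℤ} {u p : ℤ} : p ∈ adjoin A u ↔ p = u ∨ p = -u ∨ p ∈ A := by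
  simp [adjoin]

theorem subset_adjoin (A : Finset ℤ) (u : ℤ) : A ⊆ adjoin A u := fun _ h =>
  mem_adjoin.2 (Or.inr (Or.inr h))

theorem adjoin_mono {A B : Finset ℤ} (h : A ⊆ B) (u : ℤ) : adjoin A u ⊆ adjoin B u := by
  intro p hp
  rw [mem_adjoin] at *
  exact hp.imp_right fun h' => h'.imp_right fun h'' => h h''

/-- The symmetric set `A` of positions is enlarged in two directions: the values `±w u` are the
extreme values, and the positions `±k` are the extreme positions. -/
structure Enlarges (w : ℤ → ℤ) (A : Finset ℤ) (u k : ℤ) : Prop where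
  odd : ∀ p, w (-p) = -w p
  inj : Function.Injective w
  symm : ∀ p ∈ A, -p ∈ A
  top : ∀ p ∈ A, (w p).natAbs < w u
  right : ∀ p ∈ A, (p.natAbs : ℤ) < k
  top_k : (w k).natAbs < w u
  right_u : (u.natAbs : ℤ) < k

/-- Replacing `±v` by `±z`, where `±z ∈ A`, gives increasing subsequences of the same length. -/
theorem lis_adjoin_eq {w : ℤ → ℤ} {A : Finset ℤ} {v z : ℤ} (hodd : ∀ p, w (-p) = -w p)
    (hsymm : ∀ p ∈ A, -p ∈ A) (hz : z ∈ A) (d1 : ∀ e ∈ A, e < v → w e < w v → e < z ∧ w e < w z)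
    (d2 : -v < v → w (-v) < w v → -z < z ∧ w (-z) < w z)
    (d3 : ∀ e ∈ A, ¬ (v < e ∧ w v < w e)) (d4 : v ∉ A) (d5 : ¬ (v < -v ∧ w v < w (-v))) :
    lis w (adjoin A v) = lis w A := by
  have hoz := hodd z
  have hov := hodd v
  have d4' : -v ∉ A := fun h' => d4 (by simpa using hsymm _ h')
  have d1' : ∀ e ∈ A, -v < e → -w v < w e → -z < e ∧ -w z < w e := by
    intro e he h1 h2
    have := d1 (-e) (hsymm e he) (by omega) (by rw [hodd]; omega)
    rw [hodd] at this
    omega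
  have d3' : ∀ e ∈ A, ¬ (e < -v ∧ w e < -w v) := by
    rintro e he ⟨h1, h2⟩
    exact d3 (-e) (hsymm e he) ⟨by omega, by rw [hodd]; omega⟩
  refine le_antisymm ?_ (lis_mono (subset_adjoin _ _))
  obtain ⟨C, h1, h2, h3⟩ := exists_card_eq_lis w (adjoin A v)
  let φ : ℤ → ℤ := fun e => if e = v then z else if e = -v then -z else e
  have hφ : ∀ e ∈ C, ∀ f ∈ C, e < f → φ e < φ f ∧ w (φ e) < w (φ f) := by
    intro e he f hf hef
    have hwef := h2 he hf hef
    have he' := mem_adjoin.1 (h1 he)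
    have hf' := mem_adjoin.1 (h1 hf)
    have n1 : ∀ x ∈ A, φ x = x := by
      intro x hx
      have x1 : x ≠ v := fun h' => d4 (h' ▸ hx)
      have x2 : x ≠ -v := fun h' => d4' (h' ▸ hx)
      simp [φ, x1, x2]
    have n2 : φ v = z := if_pos rfl
    have n3 : -v ≠ v → φ (-v) = -z := fun hne => by simp only [φ, if_neg hne, if_true]
    rcases he' with rfl | rfl | he'
    · rcases hf' with rfl | rfl | hf'
      · omega
      · exact absurd ⟨hef, hwef⟩ d5
      · exact absurd ⟨hef, hwef⟩ (d3 _ hf')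
    · rcases hf' with rfl | rfl | hf'
      · rw [n2, n3 hef.ne]
        exact d2 hef hwef
      · omega
      · by_cases hv : -v = v
        · rw [hv] at hef hwef
          exact absurd ⟨hef, hwef⟩ (d3 _ hf')
        · rw [n3 hv, n1 _ hf', hoz]
          exact d1' f hf' hef (by omega)
    · rcases hf' with rfl | rfl | hf'
      · rw [n2, n1 _ he']
        exact d1 e he' hef hwef
      · exact absurd ⟨hef, by omega⟩ (d3' _ he')
      · rw [n1 _ he', n1 _ hf']
        exact ⟨hef, hwef⟩
  have hinj : Set.InjOn φ C := by
    intro e he f hf hef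
    rcases lt_trichotomy e f with h' | h' | h'
    · have := (hφ e he f hf h').1; omega
    · exact h'
    · have := (hφ f hf e he h').1; omega
  rw [← h3, ← Finset.card_image_of_injOn hinj]
  refine card_le_lis ?_ ?_
  · intro x hx
    obtain ⟨e, he, rfl⟩ := Finset.mem_image.1 hx
    have he' := mem_adjoin.1 (h1 he)
    simp only [φ]
    split_ifs with h4 h5
    · exact hz
    · exact hsymm z hz
    · tauto
  · intro x hx y hy hxy
    rw [Finset.mem_coe] at hx hy
    obtain ⟨e, he, rfl⟩ := Finset.mem_image.1 hx
    obtain ⟨f, hf, rfl⟩ := Finset.mem_image.1 hy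
    rcases lt_trichotomy e f with h' | h' | h'
    · exact (hφ e he f hf h').2
    · rw [h'] at hxy; omega
    · have := (hφ f hf e he h').1; omega

namespace Enlarges

variable {w : ℤ → ℤ} {A : Finset ℤ} {u k : ℤ}

theorem lis_le (h : Enlarges w A u k) : lis w (adjoin (adjoin A u) k) ≤ lis w A + 2 := by
  obtain ⟨C, h1, h2, h3⟩ := exists_card_eq_lis w (adjoin (adjoin A u) k)
  -- an increasing subsequence has at most one of the positions `u`, `k` and one of `-u`, `-k`
  have hsub : C ⊆ (C.filter (· ∈ A)) ∪ (C.filter (fun p => p = u ∨ p = k)) ∪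
      (C.filter (fun p => p = -u ∨ p = -k)) := by
    intro p hp
    have := h1 hp
    simp only [mem_adjoin, Finset.mem_union, Finset.mem_filter] at *
    tauto
  have c1 : (C.filter (· ∈ A)).card ≤ lis w A := by
    refine card_le_lis (fun p hp => (Finset.mem_filter.1 hp).2) (h2.mono ?_)
    exact fun p hp => (Finset.mem_filter.1 hp).1
  have hk := h.top_k
  have hu := h.right_u
  have hou := h.odd u
  have hok := h.odd k
  have c2 : (C.filter (fun p => p = u ∨ p = k)).card ≤ 1 := by
    rw [Finset.card_le_one]
    intro a ha b hb
    rw [Finset.mem_filter] at ha hb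
    obtain ⟨ha, rfl | rfl⟩ := ha <;> obtain ⟨hb, rfl | rfl⟩ := hb
    · rfl
    · have := h2 ha hb (by omega); omega
    · have := h2 hb ha (by omega); omega
    · rfl
  have c3 : (C.filter (fun p => p = -u ∨ p = -k)).card ≤ 1 := by
    rw [Finset.card_le_one]
    intro a ha b hb
    rw [Finset.mem_filter] at ha hb
    obtain ⟨ha, rfl | rfl⟩ := ha <;> obtain ⟨hb, rfl | rfl⟩ := hb
    · rfl
    · have := h2 hb ha (by omega); omega
    · have := h2 ha hb (by omega); omega
    · rfl
  have := Finset.card_le_card hsub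
  have c4 := Finset.card_union_le (C.filter (· ∈ A) ∪ C.filter (fun p => p = u ∨ p = k))
    (C.filter (fun p => p = -u ∨ p = -k))
  have c5 := Finset.card_union_le (C.filter (· ∈ A)) (C.filter (fun p => p = u ∨ p = k))
  omega

/-- A longest increasing subsequence of `A` could otherwise be extended by `u` at its end, or, if it
reaches beyond the position `u`, by `k`. -/
theorem has321On_of_lis_eq (h : Enlarges w A u k) (hu : lis w (adjoin A u) = lis w A)
    (hk : lis w (adjoin A k) = lis w A) : Has321On w (adjoin (adjoin A u) k) := by
  by_contra hno
  obtain ⟨C, h1, h2, h3⟩ := exists_card_eq_lis w A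
  -- adjoining an upper bound to `C`
  have key : ∀ v, v ∉ A → (∀ p ∈ C, p < v ∧ w p < w v) → lis w A < lis w (adjoin A v) := by
    intro v hv hC
    have : (insert v C).card ≤ lis w (adjoin A v) := by
      refine card_le_lis ?_ ?_
      · intro p hp
        rw [mem_adjoin]
        rcases Finset.mem_insert.1 hp with rfl | hp
        · exact Or.inl rfl
        · exact Or.inr (Or.inr (h1 hp))
      · intro p hp q hq hpq
        rw [Finset.mem_coe, Finset.mem_insert] at hp hq
        rcases hp with rfl | hp <;> rcases hq with rfl | hq
        · exact absurd hpq (lt_irrefl _)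
        · have := (hC q hq).1; omega
        · exact (hC p hp).2
        · exact h2 hp hq hpq
    rw [Finset.card_insert_of_notMem (fun h => hv (h1 h))] at this
    omega
  have huA : u ∉ A := fun hu => by have := h.top u hu; omega
  have hkA : k ∉ A := fun hk => by have := h.right k hk; omega
  obtain ⟨x, hx, hux⟩ : ∃ x ∈ C, u < x := by
    by_contra hc
    push Not at hc
    refine (key u huA fun p hp => ⟨lt_of_le_of_ne (hc p hp) ?_, ?_⟩).ne' hu
    · rintro rfl
      exact huA (h1 hp)
    · have := h.top p (h1 hp); omega
  refine (key k hkA fun p hp => ?_).ne' hk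
  have hp' := h.right p (h1 hp)
  refine ⟨by omega, ?_⟩
  have haux : ∀ y ∈ C, u < y → w y < w k := by
    intro y hy huy
    by_contra hc
    have hne : w y ≠ w k := fun he => hkA (h.inj he ▸ h1 hy)
    refine hno ⟨u, ?_, y, ?_, k, ?_, huy, ?_, ?_, by omega⟩
    · simp [mem_adjoin]
    · simp [mem_adjoin, h1 hy]
    · simp [mem_adjoin]
    · have := h.right y (h1 hy); omega
    · have := h.top y (h1 hy); omega
  by_cases hpu : u < p
  · exact haux p hp hpu
  · exact (h2 hp hx (by omega)).trans (haux x hx hux)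

/-- A new decreasing subsequence of length three is `u, z, k` for some `z ∈ A`, up to symmetry. -/
theorem exists_middle (h : Enlarges w A u k) (hu : ¬ Has321On w (adjoin A u))
    (hk : ¬ Has321On w (adjoin A k)) (h3 : Has321On w (adjoin (adjoin A u) k)) :
    ∃ z ∈ A, u < z ∧ w k < w z := by
  have htk := h.top_k
  have hru := h.right_u
  have hou := h.odd u
  have hok := h.odd k
  obtain ⟨p, hp, q, hq, r, hr, h1, h2, h4, h5⟩ := h3
  have bd : ∀ x ∈ adjoin (adjoin A u) k, (x.natAbs : ℤ) ≤ k ∧ (w x).natAbs ≤ w u := by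
    intro x hx
    rw [mem_adjoin, mem_adjoin] at hx
    rcases hx with rfl | rfl | rfl | rfl | hx
    · omega
    · omega
    · omega
    · omega
    · have := h.right x hx
      have := h.top x hx
      omega
  have b1 := bd p hp
  have b2 := bd r hr
  rw [mem_adjoin, mem_adjoin] at hp hq hr
  have e3 : q ∈ A := by
    rcases hq with rfl | rfl | rfl | rfl | hq
    · omega
    · omega
    · omega
    · omega
    · exact hq
  have b3 := h.right q e3
  have b4 := h.top q e3
  have e1 : p = u ∨ p = -k ∨ p ∈ A := by
    rcases hp with rfl | rfl | rfl | rfl | hp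
    · omega
    · simp
    · simp
    · omega
    · simp [hp]
  have e2 : r = -u ∨ r = k ∨ r ∈ A := by
    rcases hr with rfl | rfl | rfl | rfl | hr
    · simp
    · omega
    · omega
    · simp
    · simp [hr]
  have e4 : ¬ (p ∈ adjoin A u ∧ r ∈ adjoin A u) := fun ⟨a, b⟩ =>
    hu ⟨p, a, q, subset_adjoin _ _ e3, r, b, h1, h2, h4, h5⟩
  have e5 : ¬ (p ∈ adjoin A k ∧ r ∈ adjoin A k) := fun ⟨a, b⟩ =>
    hk ⟨p, a, q, subset_adjoin _ _ e3, r, b, h1, h2, h4, h5⟩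
  simp only [mem_adjoin] at e4 e5
  have e6 : (p = u ∧ r = k) ∨ (p = -k ∧ r = -u) := by
    rcases e1 with e1 | e1 | e1 <;> rcases e2 with e2 | e2 | e2 <;>
    solve
    | exact Or.inl ⟨e1, e2⟩
    | exact Or.inr ⟨e1, e2⟩
    | (refine absurd ⟨?_, ?_⟩ e4 <;> simp [e1, e2])
    | (refine absurd ⟨?_, ?_⟩ e5 <;> simp [e1, e2])
  rcases e6 with ⟨rfl, rfl⟩ | ⟨rfl, rfl⟩
  · exact ⟨q, e3, h1, h5⟩
  · exact ⟨-q, h.symm q e3, by omega, by rw [h.odd]; omega⟩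

/-- The entry `z` between `u` and `k` is comparable to all entries in `A`, and can therefore replace
`u` or `k` in an increasing subsequence. -/
theorem lis_eq_of_has321On (h : Enlarges w A u k) (hu : ¬ Has321On w (adjoin A u))
    (hk : ¬ Has321On w (adjoin A k)) (h3 : Has321On w (adjoin (adjoin A u) k)) :
    lis w (adjoin A u) = lis w A ∧ lis w (adjoin A k) = lis w A := by
  have htk := h.top_k
  have hru := h.right_u
  have hou := h.odd u
  have hok := h.odd k
  obtain ⟨z, hz, huz, hzk⟩ := h.exists_middle hu hk h3
  have hk_mem : k ∈ adjoin A k := by simp [mem_adjoin]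
  have hu_mem : u ∈ adjoin A u := by simp [mem_adjoin]
  -- `z` and `-z` are comparable to all entries
  have c1 : ∀ e ∈ A, z < e → w z < w e := by
    intro e he hze
    by_contra hc
    have hne : w e ≠ w z := fun h' => hze.ne' (h.inj h')
    have := h.top z hz
    exact hu ⟨u, hu_mem, z, subset_adjoin _ _ hz, e, subset_adjoin _ _ he, huz, hze, by omega,
      by omega⟩
  have c2 : ∀ e ∈ A, e < z → w e < w z := by
    intro e he hze
    by_contra hc
    have hne : w e ≠ w z := fun h' => hze.ne (h.inj h')
    have := h.right z hz
    exact hk ⟨e, subset_adjoin _ _ he, z, subset_adjoin _ _ hz, k, hk_mem, hze, by omega,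
      by omega, by omega⟩
  have hoz := h.odd z
  constructor
  · refine lis_adjoin_eq h.odd h.symm hz ?_ ?_ ?_ ?_ ?_
    · intro e he h1 h2
      exact ⟨by omega, c2 e he (by omega)⟩
    · intro h1 h2
      exact ⟨by omega, c2 _ (h.symm z hz) (by omega)⟩
    · rintro e he ⟨h1, h2⟩
      have := h.top e he
      omega
    · intro he
      have := h.top u he
      omega
    · omega
  · refine lis_adjoin_eq h.odd h.symm hz ?_ ?_ ?_ ?_ ?_
    · intro e he h1 h2
      refine ⟨?_, by omega⟩
      by_contra hc
      rcases eq_or_lt_of_le (not_lt.1 hc) with rfl | h'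
      · omega
      · have := c1 e he h'
        omega
    · intro h1 h2
      refine ⟨?_, by omega⟩
      by_contra hc
      rcases eq_or_lt_of_le (not_lt.1 hc) with h' | h'
      · rw [← h'] at hoz; omega
      · have := c1 _ (h.symm z hz) h'
        omega
    · rintro e he ⟨h1, h2⟩
      have := h.right e he
      omega
    · intro he
      have := h.right k he
      omega
    · omega

/-- The rule that governs whether a decreasing subsequence of length three arises. -/
theorem has321On_iff (h : Enlarges w A u k) : Has321On w (adjoin (adjoin A u) k) ↔
    Has321On w (adjoin A u) ∨ Has321On w (adjoin A k) ∨
      (lis w (adjoin A u) = lis w A ∧ lis w (adjoin A k) = lis w A) := by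
  constructor
  · intro h3
    by_cases h1 : Has321On w (adjoin A u)
    · exact Or.inl h1
    by_cases h2 : Has321On w (adjoin A k)
    · exact Or.inr (Or.inl h2)
    exact Or.inr (Or.inr (h.lis_eq_of_has321On h1 h2 h3))
  · rintro (h1 | h1 | ⟨h1, h2⟩)
    · exact h1.mono (subset_adjoin _ _)
    · exact h1.mono (adjoin_mono (subset_adjoin _ _) _)
    · exact h.has321On_of_lis_eq h1 h2

end Enlarges

/-! ### Domino insertion inside of two rows -/

/-- The Young diagram with rows of lengths `a` and `b`. -/
def twoRow (a b : ℕ) : Finset (ℕ × ℕ) := ({0} ×ˢ Finset.range a) ∪ ({1} ×ˢ Finset.range b)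

/-- The diagram `s` is contained in the first two rows. -/
def InTwoRows (s : Finset (ℕ × ℕ)) : Prop := ∀ x ∈ s, x.1 < 2

/-- The length of the first row of `s`. -/
def firstRow (s : Finset (ℕ × ℕ)) : ℕ := (s.filter fun x => x.1 = 0).card

theorem mem_twoRow {a b r c : ℕ} : (r, c) ∈ twoRow a b ↔ (r = 0 ∧ c < a) ∨ (r = 1 ∧ c < b) := by
  simp [twoRow, and_comm, eq_comm]

theorem inTwoRows_twoRow (a b : ℕ) : InTwoRows (twoRow a b) := by
  rintro ⟨r, c⟩ h
  rw [mem_twoRow] at h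
  simp only
  omega

theorem InTwoRows.mono {s t : Finset (ℕ × ℕ)} (hst : s ⊆ t) (h : InTwoRows t) : InTwoRows s :=
  fun x hx => h x (hst hx)

theorem isLowerSet_twoRow {a b : ℕ} (hab : b ≤ a) :
    IsLowerSet (twoRow a b : Set (ℕ × ℕ)) := by
  rw [Domino.lower_iff]
  intro r c
  simp only [mem_twoRow]
  omega

theorem card_row_twoRow {a b : ℕ} (hab : b ≤ a) (r : ℕ) :
    ((twoRow a b).filter fun x => x.1 = r).card = if r = 0 then a else if r = 1 then b else 0 := by
  have h := fun c => (Domino.mem_row_iff (isLowerSet_twoRow hab) r c).symm.trans mem_twoRow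
  generalize ((twoRow a b).filter fun x => x.1 = r).card = m at h
  have h1 := h m
  have h2 := h (m - 1)
  have h3 := h a
  have h4 := h b
  have h5 := h (a - 1)
  have h6 := h (b - 1)
  split_ifs <;> omega

theorem card_col_twoRow {a b : ℕ} (hab : b ≤ a) (c : ℕ) :
    ((twoRow a b).filter fun x => x.2 = c).card = if c < b then 2 else if c < a then 1 else 0 := by
  have h := fun r => (Domino.mem_col_iff (isLowerSet_twoRow hab) r c).symm.trans mem_twoRow
  generalize ((twoRow a b).filter fun x => x.2 = c).card = m at h
  have h1 := h 0
  have h2 := h 1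
  have h3 := h 2
  split_ifs <;> omega

theorem firstRow_twoRow {a b : ℕ} (hab : b ≤ a) : firstRow (twoRow a b) = a :=
  card_row_twoRow hab 0

theorem card_twoRow (a b : ℕ) : (twoRow a b).card = a + b := by
  rw [twoRow, Finset.card_union_of_disjoint]
  · simp
  · rw [Finset.disjoint_left]
    rintro ⟨r, c⟩ h1 h2
    simp at h1 h2
    omega

theorem twoRow_inj {a b a' b' : ℕ} (h : twoRow a b = twoRow a' b') : a = a' ∧ b = b' := by
  have key := fun r c => (mem_twoRow (a := a) (b := b) (r := r) (c := c)).symm.trans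
    ((Finset.ext_iff.1 h _).trans mem_twoRow)
  have h1 := key 0 a
  have h2 := key 0 a'
  have h3 := key 1 b
  have h4 := key 1 b'
  omega

theorem exists_eq_twoRow {s : Finset (ℕ × ℕ)} (hs : IsLowerSet (s : Set (ℕ × ℕ)))
    (h : InTwoRows s) : ∃ a b, b ≤ a ∧ s = twoRow a b := by
  have h0 := Domino.mem_row_iff hs 0
  have h1 := Domino.mem_row_iff hs 1
  have hl := (Domino.lower_iff s).1 hs
  refine ⟨(s.filter fun x => x.1 = 0).card, (s.filter fun x => x.1 = 1).card, ?_, ?_⟩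
  · by_contra hc
    exact lt_irrefl _ ((h0 _).1 ((hl 0 _).1 ((h1 _).2 (not_le.1 hc))))
  · ext ⟨r, c⟩
    rw [mem_twoRow, ← h0, ← h1]
    constructor
    · intro hx
      have := h _ hx
      simp only at this
      obtain rfl | rfl : r = 0 ∨ r = 1 := by omega
      · exact Or.inl ⟨rfl, hx⟩
      · exact Or.inr ⟨rfl, hx⟩
    · rintro (⟨rfl, hx⟩ | ⟨rfl, hx⟩) <;> exact hx

namespace Domino

/-- The possible positions of a domino that is added to a diagram with two rows: horizontally in
the first row (`H0`) or in the second row (`H1`), or vertically (`V`). -/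
theorem Addable.cases_twoRow {a b : ℕ} {δ : Domino} (hδ : Addable (twoRow a b) δ)
    (h2 : InTwoRows (twoRow a b ∪ δ.cells)) :
    δ = ⟨0, a, false⟩ ∨ (δ = ⟨1, b, false⟩ ∧ b + 2 ≤ a) ∨ (δ = ⟨0, a, true⟩ ∧ a = b) := by
  obtain ⟨r, c, v⟩ := δ
  obtain ⟨h3, h4⟩ := hδ
  rw [disjoint_iff] at h3
  have hl := (lower_iff _).1 h4
  have e1 := h2 (r, c)
  have e2 := h2 (r + 1, c)
  have l1 := hl 0 c
  have l2 := hl 0 (c - 1)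
  have l3 := hl 1 (c - 1)
  have l4 := hl 0 (c + 1)
  have e3 : c - 1 + 1 = c ∨ c = 0 := by omega
  have e4 : c ≠ c + 1 := by omega
  simp only [Finset.mem_union, mem_twoRow, mem_cells] at *
  cases v
  · simp at *
    have : r = 0 ∨ r = 1 := by omega
    rcases this with rfl | rfl
    · simp at *
      grind
    · simp at *
      grind
  · simp at *
    have : r = 0 := by omega
    subst this
    simp at *
    grind

theorem union_H0 (a b : ℕ) : twoRow a b ∪ cells ⟨0, a, false⟩ = twoRow (a + 2) b := by
  ext ⟨r, c⟩
  simp only [Finset.mem_union, mem_twoRow, mem_cells]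
  grind

theorem union_H1 (a b : ℕ) : twoRow a b ∪ cells ⟨1, b, false⟩ = twoRow a (b + 2) := by
  ext ⟨r, c⟩
  simp only [Finset.mem_union, mem_twoRow, mem_cells]
  grind

theorem union_V (a : ℕ) : twoRow a a ∪ cells ⟨0, a, true⟩ = twoRow (a + 1) (a + 1) := by
  ext ⟨r, c⟩
  simp only [Finset.mem_union, mem_twoRow, mem_cells]
  grind

theorem addable_H0 {a b : ℕ} (hab : b ≤ a) : Addable (twoRow a b) ⟨0, a, false⟩ :=
  ⟨by simp [disjoint_iff, mem_twoRow], by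
    rw [union_H0]; exact isLowerSet_twoRow (by omega)⟩

theorem addable_H1 {a b : ℕ} (hab : b + 2 ≤ a) : Addable (twoRow a b) ⟨1, b, false⟩ :=
  ⟨by simp [disjoint_iff, mem_twoRow], by
    rw [union_H1]; exact isLowerSet_twoRow (by omega)⟩

theorem addable_V (a : ℕ) : Addable (twoRow a a) ⟨0, a, true⟩ :=
  ⟨by simp [disjoint_iff, mem_twoRow], by
    rw [union_V]; exact isLowerSet_twoRow le_rfl⟩

theorem rowEnd_zero_twoRow {a b : ℕ} (hab : b ≤ a) : rowEnd (twoRow a b) 0 = ⟨0, a, false⟩ := by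
  simp [rowEnd, card_row_twoRow hab]

theorem colEnd_zero_empty : colEnd (twoRow 0 0) 0 = ⟨0, 0, true⟩ := by
  simp [colEnd, card_col_twoRow]

theorem cells_subset_iff (d : Domino) (s : Finset (ℕ × ℕ)) :
    d.cells ⊆ s ↔ (d.row, d.col) ∈ s ∧ (d.vertical = true → (d.row + 1, d.col) ∈ s) ∧
      (d.vertical = false → (d.row, d.col + 1) ∈ s) := by
  obtain ⟨r, c, v⟩ := d
  cases v <;> simp [cells, Finset.insert_subset_iff]

theorem bump_eq_self {s : Finset (ℕ × ℕ)} {d : Domino} (h : Disjoint d.cells s) :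
    bump s d = d := if_pos h

theorem bump_of_subset {s : Finset (ℕ × ℕ)} {d : Domino} (h : d.cells ⊆ s) :
    bump s d = if d.vertical then colEnd s (d.col + 1) else rowEnd s (d.row + 1) := by
  have : ¬ Disjoint d.cells s := by
    rw [disjoint_iff]
    rw [cells_subset_iff] at h
    exact fun h' => h'.1 h.1
  rw [bump, if_neg this, if_pos h]

theorem bump_of_overlap {s : Finset (ℕ × ℕ)} {d : Domino} (h1 : ¬ Disjoint d.cells s)
    (h2 : ¬ d.cells ⊆ s) :
    bump s d = if d.vertical then ⟨d.row + 1, d.col, false⟩ else ⟨d.row, d.col + 1, true⟩ := by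
  rw [bump, if_neg h1, if_neg h2]

/-- The local rule of domino insertion inside of two rows: in all cases but one, each row grows by
two cells. -/
theorem bump_twoRow {a b : ℕ} (hab : b ≤ a) {δ γ : Domino}
    (hδ : Addable (twoRow a b) δ) (hδ2 : InTwoRows (twoRow a b ∪ δ.cells))
    (hγ : Addable (twoRow a b) γ) (hγ2 : InTwoRows (twoRow a b ∪ γ.cells))
    (h : ¬ (δ = ⟨1, b, false⟩ ∧ γ = ⟨1, b, false⟩)) :
    twoRow a b ∪ δ.cells ∪ (bump (twoRow a b ∪ δ.cells) γ).cells = twoRow (a + 2) (b + 2) := by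
  rcases hδ.cases_twoRow hδ2 with rfl | ⟨rfl, hb⟩ | ⟨rfl, rfl⟩ <;>
  rcases hγ.cases_twoRow hγ2 with rfl | ⟨rfl, hb'⟩ | ⟨rfl, hb'⟩
  · rw [union_H0, bump_of_subset (by simp [cells_subset_iff, mem_twoRow])]
    simp only [Bool.false_eq_true, if_false, rowEnd, card_row_twoRow (show b ≤ a + 2 by omega)]
    exact union_H1 _ _
  · rw [union_H0, bump_eq_self (by simp [disjoint_iff, mem_twoRow]), union_H1]
  · subst hb'
    rw [union_H0, bump_of_overlap (by simp [disjoint_iff, mem_twoRow])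
      (by simp [cells_subset_iff, mem_twoRow])]
    exact union_H1 _ _
  · rw [union_H1, bump_eq_self (by simp [disjoint_iff, mem_twoRow]), union_H0]
  · exact absurd ⟨rfl, rfl⟩ h
  · omega
  · rw [union_V, bump_of_overlap (by simp [disjoint_iff, mem_twoRow])
      (by simp [cells_subset_iff, mem_twoRow])]
    exact union_V _
  · omega
  · rw [union_V, bump_of_subset (by simp [cells_subset_iff, mem_twoRow])]
    simp only [if_true, colEnd, card_col_twoRow le_rfl]
    simpa using union_V (a + 1)

/-- Two dominoes in the second row lead to a domino in the third row. -/
theorem bump_H1_H1 {a b : ℕ} (hab : b + 2 ≤ a) :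
    bump (twoRow a b ∪ cells ⟨1, b, false⟩) ⟨1, b, false⟩ = ⟨2, 0, false⟩ := by
  rw [union_H1, bump_of_subset (by simp [cells_subset_iff, mem_twoRow])]
  simp [rowEnd, card_row_twoRow hab]

theorem not_inTwoRows_bump_H1 {a b : ℕ} (hab : b + 2 ≤ a) :
    ¬ InTwoRows (twoRow a b ∪ cells ⟨1, b, false⟩ ∪
      (bump (twoRow a b ∪ cells ⟨1, b, false⟩) ⟨1, b, false⟩).cells) := by
  rw [bump_H1_H1 hab]
  intro h
  have := h (2, 0) (by simp [cells])
  simp at this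

theorem not_inTwoRows_colEnd_zero {s : Finset (ℕ × ℕ)} (hs : IsLowerSet (s : Set (ℕ × ℕ)))
    (hne : s.Nonempty) : ¬ InTwoRows (s ∪ (colEnd s 0).cells) := by
  obtain ⟨x, hx⟩ := hne
  have h0 : (0, 0) ∈ s := hs (Prod.mk_le_mk.2 ⟨Nat.zero_le _, Nat.zero_le _⟩ : (0, 0) ≤ x) hx
  rw [mem_col_iff hs] at h0
  intro h
  have := h ((s.filter fun x => x.2 = 0).card + 1, 0) (by simp [colEnd, cells])
  simp only at this
  omega

end Domino

/-- The diagram `s` reflects the increasing and decreasing subsequences of `w` at the positions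
in `A`: it is contained in two rows if there are no decreasing subsequences of length three, and
then its first row gives the maximal length of an increasing subsequence. -/
structure Matches (w : ℤ → ℤ) (s : Finset (ℕ × ℕ)) (A : Finset ℤ) : Prop where
  inTwoRows_iff : InTwoRows s ↔ ¬ Has321On w A
  firstRow_eq : InTwoRows s → firstRow s = lis w A
  card_eq : InTwoRows s → s.card = A.card

theorem card_adjoin {A : Finset ℤ} {u : ℤ} (hu : u ∉ A) (hu' : -u ∉ A) (h0 : u ≠ 0) :
    (adjoin A u).card = A.card + 2 := by
  rw [adjoin, Finset.card_insert_of_notMem, Finset.card_insert_of_notMem hu']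
  rw [Finset.mem_insert]
  rintro (h | h)
  · omega
  · exact hu h

open Domino in
/-- The local rule of domino insertion corresponds to the enlargement of the set of positions by
`±k` (for the domino `δ`) and by `±u` (for the domino `γ`). -/
theorem Matches.bump {w : ℤ → ℤ} {A : Finset ℤ} {u k : ℤ} (hE : Enlarges w A u k)
    {s : Finset (ℕ × ℕ)} (hs : IsLowerSet (s : Set (ℕ × ℕ))) {δ γ : Domino} (hδ : Addable s δ)
    (hγ : Addable s γ) (h : Matches w s A) (hk : Matches w (s ∪ δ.cells) (adjoin A k))
    (hu : Matches w (s ∪ γ.cells) (adjoin A u)) :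
    Matches w (s ∪ δ.cells ∪ (bump (s ∪ δ.cells) γ).cells) (adjoin (adjoin A u) k) := by
  obtain ⟨-, ε, -, hε⟩ := addable_bump hs hδ hγ
  by_cases h1 : InTwoRows (s ∪ δ.cells)
  swap
  · have hno : ¬ InTwoRows (s ∪ δ.cells ∪ (Domino.bump (s ∪ δ.cells) γ).cells) := fun h' =>
      h1 (h'.mono Finset.subset_union_left)
    refine ⟨iff_of_false hno (not_not.2 ?_), fun h => absurd h hno, fun h => absurd h hno⟩
    exact (not_not.1 (mt hk.inTwoRows_iff.2 h1)).mono (adjoin_mono (subset_adjoin _ _) _)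
  by_cases h2 : InTwoRows (s ∪ γ.cells)
  swap
  · have hno : ¬ InTwoRows (s ∪ δ.cells ∪ (Domino.bump (s ∪ δ.cells) γ).cells) := fun h' =>
      h2 (h'.mono (hε ▸ Finset.subset_union_left))
    refine ⟨iff_of_false hno (not_not.2 ?_), fun h => absurd h hno, fun h => absurd h hno⟩
    exact (not_not.1 (mt hu.inTwoRows_iff.2 h2)).mono (subset_adjoin _ _)
  have h0 : InTwoRows s := h1.mono Finset.subset_union_left
  obtain ⟨a, b, hab, rfl⟩ := exists_eq_twoRow hs h0
  have f0 := h.firstRow_eq h0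
  have f1 := hk.firstRow_eq h1
  have f2 := hu.firstRow_eq h2
  have h321 := hE.has321On_iff
  have n1 := hk.inTwoRows_iff.1 h1
  have n2 := hu.inTwoRows_iff.1 h2
  rw [firstRow_twoRow hab] at f0
  have g : ∀ d, Addable (twoRow a b) d → InTwoRows (twoRow a b ∪ d.cells) →
      (d = ⟨1, b, false⟩ ∧ b + 2 ≤ a ∧ firstRow (twoRow a b ∪ d.cells) = a) ∨
      (d ≠ ⟨1, b, false⟩ ∧ firstRow (twoRow a b ∪ d.cells) = a + 2) ∨
      (d ≠ ⟨1, b, false⟩ ∧ firstRow (twoRow a b ∪ d.cells) = a + 1 ∧ a = b) := by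
    intro d hd hd2
    rcases hd.cases_twoRow hd2 with rfl | ⟨rfl, hb⟩ | ⟨rfl, rfl⟩
    · rw [union_H0, firstRow_twoRow (by omega)]; simp
    · rw [union_H1, firstRow_twoRow (by omega)]; simp [hb]
    · rw [union_V, firstRow_twoRow (by omega)]; simp
  have gδ := g δ hδ h1
  have gγ := g γ hγ h2
  -- the exceptional case is that of two dominoes in the second row
  by_cases hH : δ = ⟨1, b, false⟩ ∧ γ = ⟨1, b, false⟩
  · obtain ⟨rfl, rfl⟩ := hH
    simp only [ne_eq, not_true, false_and, or_false, true_and] at gδ gγ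
    have hno := not_inTwoRows_bump_H1 gδ.1
    refine ⟨iff_of_false hno (not_not.2 ?_), fun h => absurd h hno, fun h => absurd h hno⟩
    exact h321.2 (Or.inr (Or.inr ⟨by omega, by omega⟩))
  · have hB := bump_twoRow hab hδ h1 hγ h2 hH
    rw [hB]
    have n3 : ¬ Has321On w (adjoin (adjoin A u) k) := by
      rw [h321]
      rintro (n | n | ⟨e1, e2⟩)
      · exact n2 n
      · exact n1 n
      · refine hH ⟨?_, ?_⟩
        · rcases gδ with ⟨e, -⟩ | ⟨-, e⟩ | ⟨-, e, -⟩ <;> first | exact e | omega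
        · rcases gγ with ⟨e, -⟩ | ⟨-, e⟩ | ⟨-, e, -⟩ <;> first | exact e | omega
    have hru := hE.right_u
    have htk := hE.top_k
    have hu0 : u ≠ 0 := by
      rintro rfl
      have := hE.odd 0
      rw [neg_zero] at this
      omega
    have hAu : ∀ p ∈ adjoin A u, (p.natAbs : ℤ) < k := by
      intro p hp
      rcases mem_adjoin.1 hp with rfl | rfl | hp
      · exact hru
      · omega
      · exact hE.right p hp
    have c1 : (adjoin A u).card = A.card + 2 := by
      refine card_adjoin (fun hu => ?_) (fun hu => ?_) hu0
      · have := hE.top _ hu; omega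
      · have := hE.top _ hu; rw [hE.odd] at this; omega
    have c2 : (adjoin (adjoin A u) k).card = A.card + 4 := by
      rw [card_adjoin, c1]
      · intro hk; have := hAu _ hk; omega
      · intro hk; have := hAu _ hk; omega
      · omega
    have c0 := h.card_eq h0
    rw [card_twoRow] at c0
    have l1 := hE.lis_le
    have l2 : lis w (adjoin A u) ≤ _ := lis_mono (subset_adjoin (adjoin A u) k)
    have l3 : lis w (adjoin A k) ≤ _ := lis_mono (adjoin_mono (subset_adjoin A u) k)
    have l4 := card_le_two_mul_lis hE.inj n3
    refine ⟨iff_of_true (inTwoRows_twoRow _ _) n3, fun _ => ?_, fun _ => ?_⟩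
    · rw [firstRow_twoRow (by omega)]
      rcases gδ with ⟨e, e', -⟩ | ⟨-, e⟩ | ⟨-, e, e'⟩
      · rcases gγ with ⟨e2, -⟩ | ⟨-, e2⟩ | ⟨-, e2, e3⟩
        · exact absurd ⟨e, e2⟩ hH
        · omega
        · omega
      · omega
      · rcases gγ with ⟨-, e2, e3⟩ | ⟨-, e2⟩ | ⟨-, e2, e3⟩ <;> omega
    · rw [card_twoRow]; omega

/-! ### The shape of the insertion tableau -/

theorem card_le_card_filter_add_two {A C : Finset ℤ} {k : ℤ} (hC : C ⊆ adjoin A k) :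
    C.card ≤ (C.filter (· ∈ A)).card + 2 := by
  have : C ⊆ C.filter (· ∈ A) ∪ {k, -k} := by
    intro p hp
    have := hC hp
    simp only [mem_adjoin, Finset.mem_union, Finset.mem_filter, Finset.mem_insert,
      Finset.mem_singleton] at *
    tauto
  have h1 := Finset.card_le_card this
  have h2 := Finset.card_union_le (C.filter (· ∈ A)) {k, -k}
  have h3 := Finset.card_le_two (a := k) (b := -k)
  omega

namespace Matches

variable {w : ℤ → ℤ} {A : Finset ℤ} {k : ℤ} {s : Finset (ℕ × ℕ)}

/-- A new extreme position `k` that carries the new largest value. -/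
theorem corner_pos (hodd : w (-k) = -w k) (hpos : 0 < w k) (hk0 : 0 < k)
    (hk : ∀ p ∈ A, (p.natAbs : ℤ) < k) (hw : ∀ p ∈ A, ((w p).natAbs : ℤ) < w k)
    (hs : IsLowerSet (s : Set (ℕ × ℕ))) (h : Matches w s A) :
    Matches w (s ∪ (Domino.rowEnd s 0).cells) (adjoin A k) := by
  have h321 : Has321On w (adjoin A k) ↔ Has321On w A := by
    refine ⟨?_, Has321On.mono (subset_adjoin A k)⟩
    rintro ⟨p, hp, q, hq, r, hr, h1, h2, h3, h4⟩
    have bd : ∀ x ∈ adjoin A k, (x.natAbs : ℤ) ≤ k ∧ ((w x).natAbs : ℤ) ≤ w k := by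
      intro x hx
      rcases mem_adjoin.1 hx with rfl | rfl | hx
      · omega
      · omega
      · have := hk x hx
        have := hw x hx
        omega
    have b1 := bd p hp
    have b2 := bd q hq
    have b3 := bd r hr
    have : ∀ x ∈ adjoin A k, x ≠ k → x ≠ -k → x ∈ A := fun x hx x1 x2 => by
      have := mem_adjoin.1 hx
      tauto
    refine ⟨p, this p hp ?_ ?_, q, this q hq ?_ ?_, r, this r hr ?_ ?_, h1, h2, h3, h4⟩ <;>
    · rintro rfl
      omega
  have hlis : lis w (adjoin A k) = lis w A + 2 := by
    apply le_antisymm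
    · obtain ⟨C, h1, h2, h3⟩ := exists_card_eq_lis w (adjoin A k)
      have h4 := card_le_card_filter_add_two h1
      have h5 : (C.filter (· ∈ A)).card ≤ lis w A :=
        card_le_lis (fun p hp => (Finset.mem_filter.1 hp).2)
          (h2.mono fun p hp => (Finset.mem_filter.1 hp).1)
      omega
    · obtain ⟨C, h1, h2, h3⟩ := exists_card_eq_lis w A
      rw [← h3, ← card_adjoin (u := k) (A := C)]
      · refine card_le_lis (adjoin_mono h1 k) ?_
        intro p hp q hq hpq
        rcases mem_adjoin.1 hp with rfl | rfl | hp' <;>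
          rcases mem_adjoin.1 hq with rfl | rfl | hq'
        · omega
        · omega
        · have := hk q (h1 hq'); omega
        · omega
        · omega
        · have := hw q (h1 hq'); omega
        · have := hw p (h1 hp'); omega
        · have := hk p (h1 hp'); omega
        · exact h2 hp' hq' hpq
      · intro hkC
        have := hk _ (h1 hkC); omega
      · intro hkC
        have := hk _ (h1 hkC); omega
      · omega
  have hcard : (adjoin A k).card = A.card + 2 := by
    refine card_adjoin (fun hA => ?_) (fun hA => ?_) (by omega)
    · have := hk _ hA; omega
    · have := hk _ hA; omega
  by_cases h2 : InTwoRows s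
  · obtain ⟨a, b, hab, rfl⟩ := exists_eq_twoRow hs h2
    rw [Domino.rowEnd_zero_twoRow hab, Domino.union_H0]
    refine ⟨?_, fun _ => ?_, fun _ => ?_⟩
    · rw [h321, ← h.inTwoRows_iff]
      exact iff_of_true (inTwoRows_twoRow _ _) h2
    · rw [hlis, ← h.firstRow_eq h2, firstRow_twoRow hab, firstRow_twoRow (by omega)]
    · rw [hcard, ← h.card_eq h2, card_twoRow, card_twoRow]; omega
  · have h3 : ¬ InTwoRows (s ∪ (Domino.rowEnd s 0).cells) := fun h' =>
      h2 (h'.mono Finset.subset_union_left)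
    refine ⟨?_, fun h' => absurd h' h3, fun h' => absurd h' h3⟩
    rw [h321, ← h.inTwoRows_iff]
    exact iff_of_false h3 h2

/-- A new extreme position `k` that carries the new smallest value. -/
theorem corner_neg (hodd : w (-k) = -w k) (hneg : w k < 0) (hk0 : 0 < k)
    (hk : ∀ p ∈ A, (p.natAbs : ℤ) < k) (hw : ∀ p ∈ A, ((w p).natAbs : ℤ) < -w k)
    (hs : IsLowerSet (s : Set (ℕ × ℕ))) (h : Matches w s A) :
    Matches w (s ∪ (Domino.colEnd s 0).cells) (adjoin A k) := by
  rcases A.eq_empty_or_nonempty with rfl | ⟨p, hp⟩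
  · have h2 : InTwoRows s := by
      rw [h.inTwoRows_iff]
      rintro ⟨p, hp, -⟩
      simp at hp
    have h3 := h.card_eq h2
    rw [Finset.card_empty, Finset.card_eq_zero] at h3
    have h4 : s = twoRow 0 0 := h3
    have hmem : ∀ x, x ∈ adjoin ∅ k ↔ x = k ∨ x = -k := fun x => by simp [mem_adjoin]
    rw [h4, Domino.colEnd_zero_empty, Domino.union_V]
    refine ⟨iff_of_true (inTwoRows_twoRow _ _) ?_, fun _ => ?_, fun _ => ?_⟩
    · rintro ⟨p, hp, q, hq, r, hr, h1, h2, -⟩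
      rw [hmem] at hp hq hr
      omega
    · rw [firstRow_twoRow le_rfl]
      apply le_antisymm
      · have : ({k} : Finset ℤ).card ≤ lis w (adjoin ∅ k) := by
          refine card_le_lis (fun x hx => ?_) (by simp)
          rw [hmem]
          exact Or.inl (Finset.mem_singleton.1 hx)
        simpa using this
      · obtain ⟨C, h1, h2, h3⟩ := exists_card_eq_lis w (adjoin ∅ k)
        rw [← h3]
        refine Finset.card_le_one.2 fun a ha b hb => ?_
        rcases (hmem _).1 (h1 ha) with rfl | rfl <;> rcases (hmem _).1 (h1 hb) with rfl | rfl
        · rfl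
        · have := h2 hb ha (by omega); omega
        · have := h2 ha hb (by omega); omega
        · rfl
    · rw [card_adjoin (by simp) (by simp) (by omega), card_twoRow]; rfl
  · have h1 : Has321On w (adjoin A k) := by
      have h2 := hk p hp
      have h3 := hw p hp
      exact ⟨-k, by simp [mem_adjoin], p, subset_adjoin _ _ hp, k, by simp [mem_adjoin],
        by omega, by omega, by omega, by omega⟩
    have hne : s.Nonempty := by
      rw [Finset.nonempty_iff_ne_empty]
      rintro rfl
      have := h.card_eq (by simp [InTwoRows])
      rw [Finset.card_empty, eq_comm, Finset.card_eq_zero] at this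
      simp [this] at hp
    have h2 := Domino.not_inTwoRows_colEnd_zero hs hne
    exact ⟨iff_of_false h2 (not_not.2 h1), fun h' => absurd h' h2, fun h' => absurd h' h2⟩

end Matches

namespace WeylB

/-- The positions in `{±1, …, ±k}` that carry values in `{±1, …, ±(m - 1)}`. -/
noncomputable def box (w : ℤ → ℤ) (m k : ℕ) : Finset ℤ :=
  (Finset.Icc (-k : ℤ) k).filter fun p => p ≠ 0 ∧ (w p).natAbs < m

theorem mem_box {w : ℤ → ℤ} {m k : ℕ} {p : ℤ} :
    p ∈ box w m k ↔ p ≠ 0 ∧ p.natAbs ≤ k ∧ (w p).natAbs < m := by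
  simp only [box, Finset.mem_filter, Finset.mem_Icc]
  omega

/-- The part of the insertion tableau with labels `< m`, after `k` letters, reflects the
subsequences of `w` with entries at the positions `±1, …, ±k` and with values between `-m` and
`m`. -/
theorem matches_filling {n : ℕ} (w : W n) (k m : ℕ) :
    Matches (w : Equiv.Perm ℤ) ((filling w k).below m) (box (w : Equiv.Perm ℤ) m k) := by
  have hempty : Matches (w : Equiv.Perm ℤ) ∅ ∅ := by
    refine ⟨iff_of_true (by simp [InTwoRows]) ?_, fun _ => ?_, fun _ => rfl⟩
    · rintro ⟨p, hp, -⟩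
      simp at hp
    · obtain ⟨C, h1, -, h3⟩ := exists_card_eq_lis (w : Equiv.Perm ℤ) ∅
      rw [← h3, Finset.subset_empty.1 h1]
      rfl
  have hodd := (mem_W w.2).1
  have hinj := (w : Equiv.Perm ℤ).injective
  induction k generalizing m with
  | zero =>
    have h1 : (filling w 0).below m = ∅ := DominoFilling.below_none m
    have h2 : box (w : Equiv.Perm ℤ) m 0 = ∅ := by
      rw [Finset.eq_empty_iff_forall_notMem]
      intro p hp
      rw [mem_box] at hp
      omega
    rw [h1, h2]
    exact hempty
  | succ k ihk =>
    have hstd := (filling_spec w k).1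
    have hnone := filling_unused w k
    have hword : word w (k + 1) = (w : Equiv.Perm ℤ) (k + 1) := rfl
    have hT : filling w (k + 1) = (filling w k).insertLabel (word w (k + 1)).natAbs
      (decide (word w (k + 1) < 0)) := rfl
    rw [hT]
    generalize hv : decide (word w (k + 1) < 0) = v
    have hbelow := DominoFilling.insertLabel_below hstd hnone v
    have hodd' := hodd (k + 1)
    have hsome := fun m => (filling_spec w k).2 m
    generalize filling w k = T at *
    induction m with
    | zero =>
      have h2 : box (w : Equiv.Perm ℤ) 0 (k + 1) = ∅ := by
        rw [Finset.eq_empty_iff_forall_notMem]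
        intro p hp
        rw [mem_box] at hp
        omega
      rw [h2]
      exact hempty
    | succ m ihm =>
      have hlow := hstd.lower m
      have hp : ∀ p : ℤ, p.natAbs = k + 1 → ((w : Equiv.Perm ℤ) p).natAbs =
          (word w (k + 1)).natAbs := by
        intro p hp
        have : p = k + 1 ∨ p = -(k + 1) := by omega
        rcases this with rfl | rfl
        · rfl
        · rw [hodd', hword, Int.natAbs_neg]
      have hp0 := hp (k + 1) (by omega)
      rcases lt_trichotomy m (word w (k + 1)).natAbs with hm | hm | hm
      · rw [(hbelow (m + 1)).1 hm]
        have : box (w : Equiv.Perm ℤ) (m + 1) (k + 1) = box (w : Equiv.Perm ℤ) (m + 1) k := by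
          ext p
          rw [mem_box, mem_box]
          have := hp p
          omega
        rw [this]
        exact ihk _
      · have hbox : box (w : Equiv.Perm ℤ) (m + 1) (k + 1) =
            adjoin (box (w : Equiv.Perm ℤ) m k) (k + 1) := by
          ext p
          rw [mem_adjoin, mem_box, mem_box]
          have h1 := hp p
          have h2 : ((w : Equiv.Perm ℤ) p).natAbs = m → p = k + 1 ∨ p = -(k + 1) := by
            intro h
            rw [hm, hword] at h
            rcases Int.natAbs_eq_natAbs_iff.1 h with h | h
            · exact Or.inl (hinj h)
            · rw [← hodd'] at h
              exact Or.inr (hinj h)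
          omega
        have hstep : (T.insertLabel (word w (k + 1)).natAbs v).below (m + 1) = T.below m ∪
            (if v then Domino.colEnd (T.below m) 0 else Domino.rowEnd (T.below m) 0).cells := by
          rw [DominoFilling.below_succ, DominoFilling.insertLabel_cellsAt,
            (hbelow m).1 hm.le, DominoFilling.insertStep, if_neg (by omega), if_pos hm]
          rfl
        rw [hbox, hstep]
        have hw0 : (w : Equiv.Perm ℤ) (k + 1) ≠ 0 := by
          have := IsSigned.ne_zero (mem_W w.2) (x := k + 1) (by omega)
          exact this
        have b1 : ∀ p ∈ box (w : Equiv.Perm ℤ) m k, (p.natAbs : ℤ) < k + 1 := by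
          intro p hp
          rw [mem_box] at hp
          omega
        have b2 : ∀ p ∈ box (w : Equiv.Perm ℤ) m k, ((w : Equiv.Perm ℤ) p).natAbs < m := by
          intro p hp
          rw [mem_box] at hp
          exact hp.2.2
        cases v
        · have hpos : 0 < (w : Equiv.Perm ℤ) (k + 1) := by
            have := of_decide_eq_false hv
            omega
          refine (ihk m).corner_pos hodd' hpos (by omega) b1 (fun p hp => ?_) hlow
          have := b2 p hp
          omega
        · have hneg : (w : Equiv.Perm ℤ) (k + 1) < 0 := of_decide_eq_true hv
          refine (ihk m).corner_neg hodd' hneg (by omega) b1 (fun p hp => ?_) hlow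
          have := b2 p hp
          omega
      · have hcells := DominoFilling.insertLabel_cellsAt T (word w (k + 1)).natAbs v m
        rw [DominoFilling.insertStep, if_neg (by omega), if_neg (by omega)] at hcells
        rw [DominoFilling.below_succ, hcells]
        have hsm := hsome m
        cases hTm : T m with
        | none =>
          have hbox : box (w : Equiv.Perm ℤ) (m + 1) (k + 1) =
              box (w : Equiv.Perm ℤ) m (k + 1) := by
            ext p
            rw [mem_box, mem_box]
            have h1 := hp p
            have h2 : p.natAbs ≤ k → p ≠ 0 → ((w : Equiv.Perm ℤ) p).natAbs ≠ m := by
              intro h3 h4 h5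
              rw [hTm] at hsm
              have h6 : ((w : Equiv.Perm ℤ) (p.natAbs : ℤ)).natAbs = m := by
                rcases Int.natAbs_eq p with h | h
                · rw [← h, h5]
                · rw [← h5]
                  conv_rhs => rw [h, hodd, Int.natAbs_neg]
              simpa using hsm.2 ⟨p.natAbs, by omega, h3, h6⟩
            omega
          rw [hbox]
          simpa using ihm
        | some γ =>
          rw [hTm] at hsm
          obtain ⟨j, hj1, hj2, hj3⟩ := hsm.1 rfl
          obtain ⟨u, hu1, hu2⟩ : ∃ u : ℤ, u.natAbs = j ∧ (w : Equiv.Perm ℤ) u = m := by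
            unfold word at hj3
            rcases Int.natAbs_eq ((w : Equiv.Perm ℤ) j) with h | h
            · exact ⟨j, by omega, by omega⟩
            · exact ⟨-j, by omega, by rw [hodd]; omega⟩
          have hu0 := hodd u
          have huniq : ∀ p : ℤ, ((w : Equiv.Perm ℤ) p).natAbs = m → p = u ∨ p = -u := by
            intro p hp
            have : (w : Equiv.Perm ℤ) p = (w : Equiv.Perm ℤ) u ∨
              (w : Equiv.Perm ℤ) p = (w : Equiv.Perm ℤ) (-u) := by omega
            exact this.imp (fun h => hinj h) (fun h => hinj h)
          have hboxu : ∀ k', k ≤ k' → box (w : Equiv.Perm ℤ) (m + 1) k' =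
              adjoin (box (w : Equiv.Perm ℤ) m k') u := by
            intro k' hk'
            ext p
            rw [mem_adjoin, mem_box, mem_box]
            have h1 := huniq p
            have h2 : p = u → (w : Equiv.Perm ℤ) p = m := fun h => h ▸ hu2
            have h3 : p = -u → (w : Equiv.Perm ℤ) p = -m := fun h => by rw [h, hu0, hu2]
            omega
          have hboxk : box (w : Equiv.Perm ℤ) m (k + 1) =
              adjoin (box (w : Equiv.Perm ℤ) m k) (k + 1) := by
            ext p
            rw [mem_adjoin, mem_box, mem_box]
            have h1 := hp p
            omega
          have hE : Enlarges (w : Equiv.Perm ℤ) (box (w : Equiv.Perm ℤ) m k) u (k + 1) := by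
            refine ⟨hodd, hinj, fun p hp => ?_, fun p hp => ?_, fun p hp => ?_, ?_, ?_⟩
            · rw [mem_box] at hp ⊢
              have := hodd p
              omega
            · rw [mem_box] at hp
              omega
            · rw [mem_box] at hp
              omega
            · omega
            · omega
          obtain ⟨δ, hδ, hδb⟩ := (hbelow m).2 hm
          have hγc : T.cellsAt m = γ.cells := by simp [DominoFilling.cellsAt, hTm]
          have hγ : Domino.Addable (T.below m) γ := by
            refine ⟨hγc ▸ hstd.disjoint m, ?_⟩
            have := hstd.lower (m + 1)
            rwa [DominoFilling.below_succ, hγc] at this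
          have hM1 := ihm
          rw [hδb, hboxk] at hM1
          have hM2 := ihk (m + 1)
          rw [hboxu k le_rfl, DominoFilling.below_succ, hγc] at hM2
          rw [hboxu (k + 1) (by omega), hboxk, hδb]
          have hres := (ihk m).bump hE hlow hδ hγ hM1 hM2
          have hcomm : adjoin (adjoin (box (w : Equiv.Perm ℤ) m k) (k + 1)) u =
              adjoin (adjoin (box (w : Equiv.Perm ℤ) m k) u) (k + 1) := by
            ext p
            simp only [mem_adjoin]
            tauto
          rw [hcomm]
          exact hres

theorem has321_iff_has321On {n : ℕ} {w : Equiv.Perm ℤ} (h : IsSigned n w) :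
    Has321 w ↔ Has321On w (box w (n + 1) n) := by
  have bd : ∀ p : ℤ, p.natAbs ≤ n → (w p).natAbs ≤ n := fun p => h.natAbs_le
  have fix := h.2
  constructor
  · rintro ⟨p, q, r, hp, hq, hr, h1, h2, h3, h4⟩
    have b1 := bd p
    have b2 := bd q
    have b3 := bd r
    have f1 := fix p
    have f2 := fix q
    have f3 := fix r
    refine ⟨p, mem_box.2 ⟨hp, ?_, ?_⟩, q, mem_box.2 ⟨hq, ?_, ?_⟩, r, mem_box.2 ⟨hr, ?_, ?_⟩,
      h1, h2, h3, h4⟩ <;> omega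
  · rintro ⟨p, hp, q, hq, r, hr, h'⟩
    rw [mem_box] at hp hq hr
    exact ⟨p, q, r, hp.1, hq.1, hr.1, h'⟩

theorem cells_P {n : ℕ} (w : W n) : (P w).shape.cells = (filling w n).below (n + 1) := by
  ext x
  simp only [(P w).cells_eq, DominoFilling.below, Finset.mem_biUnion, Finset.mem_Icc,
    Finset.mem_range]
  constructor
  · rintro ⟨k, hk, hx⟩
    exact ⟨k, by omega, hx⟩
  · rintro ⟨k, hk, hx⟩
    refine ⟨k, ?_, hx⟩
    by_contra hc
    have := (P w).eq_empty k hc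
    have hx' : x ∈ (P w).dom k := hx
    simp [this] at hx'

theorem inTwoRows_iff_colLen (μ : YoungDiagram) : InTwoRows μ.cells ↔ μ.colLen 0 ≤ 2 := by
  constructor
  · intro h
    by_contra hc
    have h1 : (2, 0) ∈ μ := YoungDiagram.mem_iff_lt_colLen.2 (by omega)
    have := h _ ((YoungDiagram.mem_cells _).2 h1)
    simp at this
  · rintro h ⟨r, c⟩ hx
    have h1 : (r, 0) ∈ μ := μ.up_left_mem le_rfl (Nat.zero_le c) ((YoungDiagram.mem_cells _).1 hx)
    rw [YoungDiagram.mem_iff_lt_colLen] at h1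
    simp only
    omega

theorem mem_Wb_iff_Sh {n : ℕ} (w : W n) : w ∈ Wb n ↔ (Sh w).colLen 0 ≤ 2 := by
  rw [mem_Wb_iff, has321_iff_has321On (mem_W w.2), ← (matches_filling w n (n + 1)).inTwoRows_iff,
    ← cells_P, inTwoRows_iff_colLen]
  rfl

end WeylB

/-! ### Reversal of domino insertion -/

namespace Domino

theorem cells_nonempty (d : Domino) : d.cells.Nonempty := by
  obtain ⟨r, c, v⟩ := d
  exact ⟨(r, c), by simp [mem_cells]⟩

theorem cells_injective : Function.Injective cells := by
  rintro ⟨r, c, v⟩ ⟨r', c', v'⟩ h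
  have e := fun x => (mem_cells ⟨r, c, v⟩ x).symm.trans
    ((Finset.ext_iff.1 h x).trans (mem_cells ⟨r', c', v'⟩ x))
  have e1 := e (r, c)
  have e2 := e (r + 1, c)
  have e3 := e (r, c + 1)
  have e4 := e (r', c')
  cases v <;> cases v' <;> simp at e1 e2 e3 e4 ⊢ <;> omega

/-- A domino is determined by what it adds to a diagram. -/
theorem eq_of_union_eq {s : Finset (ℕ × ℕ)} {d e : Domino} (hd : Disjoint d.cells s)
    (he : Disjoint e.cells s) (h : s ∪ d.cells = s ∪ e.cells) : d = e := by
  apply cells_injective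
  rw [← Finset.sdiff_eq_self_of_disjoint hd, ← Finset.sdiff_eq_self_of_disjoint he,
    ← Finset.union_sdiff_left, h, Finset.union_sdiff_left]

/-- If domino insertion stays in two rows, the local rule adds one domino to each row. -/
theorem exists_twoRow_of_bump {s : Finset (ℕ × ℕ)} (hs : IsLowerSet (s : Set (ℕ × ℕ)))
    {δ γ : Domino} (hδ : Addable s δ) (hγ : Addable s γ)
    (h : InTwoRows (s ∪ δ.cells ∪ (bump (s ∪ δ.cells) γ).cells)) :
    ∃ a b, b ≤ a ∧ s = twoRow a b ∧
      s ∪ δ.cells ∪ (bump (s ∪ δ.cells) γ).cells = twoRow (a + 2) (b + 2) := by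
  obtain ⟨-, ε, -, hε⟩ := addable_bump hs hδ hγ
  have h1 : InTwoRows (s ∪ δ.cells) := h.mono Finset.subset_union_left
  have h2 : InTwoRows (s ∪ γ.cells) := h.mono (hε ▸ Finset.subset_union_left)
  obtain ⟨a, b, hab, rfl⟩ := exists_eq_twoRow hs (h1.mono Finset.subset_union_left)
  refine ⟨a, b, hab, rfl, bump_twoRow hab hδ h1 hγ h2 ?_⟩
  rintro ⟨rfl, rfl⟩
  rcases hδ.cases_twoRow h1 with h3 | ⟨-, h3⟩ | ⟨h3, -⟩
  · simp at h3
  · exact not_inTwoRows_bump_H1 h3 h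
  · simp at h3

/-- The domino of the inserted label, in the first row (`v = false`) or column (`v = true`). -/
def corner (s : Finset (ℕ × ℕ)) (v : Bool) : Domino := if v then colEnd s 0 else rowEnd s 0

theorem corner_injective (s : Finset (ℕ × ℕ)) : Function.Injective (corner s) := by
  intro v v' h
  cases v <;> cases v' <;> simp [corner, colEnd, rowEnd] at h ⊢

/-- If the diagrams `s ∪ δ` and `s ∪ γ` before and after the insertion agree, then the domino `γ` is
not moved to the position at which a label can be inserted into this diagram. -/
theorem bump_ne_corner {s : Finset (ℕ × ℕ)} (hs : IsLowerSet (s : Set (ℕ × ℕ)))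
    {δ γ : Domino} (hδ : Addable s δ) (hγ : Addable s γ) (he : s ∪ δ.cells = s ∪ γ.cells)
    (h : InTwoRows (s ∪ δ.cells ∪ (bump (s ∪ δ.cells) γ).cells)) (v : Bool) :
    bump (s ∪ δ.cells) γ ≠ corner (s ∪ δ.cells) v := by
  intro hc
  obtain ⟨a, b, hab, rfl, ht⟩ := exists_twoRow_of_bump hs hδ hγ h
  rw [hc] at ht h
  cases v
  · simp only [corner, Bool.false_eq_true, if_false] at ht
    have h1 : InTwoRows (twoRow a b ∪ δ.cells) := h.mono Finset.subset_union_left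
    rcases hδ.cases_twoRow h1 with rfl | ⟨rfl, hb⟩ | ⟨rfl, rfl⟩
    · rw [union_H0, rowEnd_zero_twoRow (by omega), union_H0] at ht
      have := twoRow_inj ht
      omega
    · obtain rfl := eq_of_union_eq hδ.1 hγ.1 he
      have := bump_H1_H1 hb
      rw [hc] at this
      simp [corner, rowEnd] at this
    · rw [union_V, rowEnd_zero_twoRow (by omega), union_H0] at ht
      have := twoRow_inj ht
      omega
  · exact not_inTwoRows_colEnd_zero hδ.2
      ((cells_nonempty δ).mono Finset.subset_union_right) h

/-- The inverse of the local rule, inside of two rows. -/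
theorem exists_reverse {ρ μ : Finset (ℕ × ℕ)} (hρ : IsLowerSet (ρ : Set (ℕ × ℕ)))
    (hμ : IsLowerSet (μ : Set (ℕ × ℕ))) {d ε : Domino} (hd : Addable ρ d) (hε : Addable μ ε)
    (he : ρ ∪ d.cells = μ ∪ ε.cells) (h2 : InTwoRows (ρ ∪ d.cells)) :
    (ρ = μ ∧ ∃ v, d = corner ρ v) ∨ ∃ (s : Finset (ℕ × ℕ)) (δ γ : Domino),
      IsLowerSet (s : Set (ℕ × ℕ)) ∧ Addable s δ ∧ Addable s γ ∧ s ∪ δ.cells = ρ ∧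
      s ∪ γ.cells = μ ∧ bump ρ γ = d := by
  have h2' := h2
  rw [he] at h2'
  obtain ⟨p, q, hpq, rfl⟩ := exists_eq_twoRow hρ (h2.mono Finset.subset_union_left)
  obtain ⟨p', q', hpq', rfl⟩ := exists_eq_twoRow hμ (h2'.mono Finset.subset_union_left)
  have fin : ∀ a b δ γ, b ≤ a → Addable (twoRow a b) δ → Addable (twoRow a b) γ →
      ¬ (δ = ⟨1, b, false⟩ ∧ γ = ⟨1, b, false⟩) →
      twoRow a b ∪ δ.cells = twoRow p q → twoRow a b ∪ γ.cells = twoRow p' q' →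
      twoRow p q ∪ d.cells = twoRow (a + 2) (b + 2) →
      ∃ (s : Finset (ℕ × ℕ)) (δ γ : Domino), IsLowerSet (s : Set (ℕ × ℕ)) ∧ Addable s δ ∧
      Addable s γ ∧ s ∪ δ.cells = twoRow p q ∧ s ∪ γ.cells = twoRow p' q' ∧
      bump (twoRow p q) γ = d := by
    intro a b δ γ hab hδ hγ hH e1 e2 e3
    refine ⟨twoRow a b, δ, γ, isLowerSet_twoRow hab, hδ, hγ, e1, e2, ?_⟩
    have h3 := (addable_bump (isLowerSet_twoRow hab) hδ hγ).1.1
    have h4 := bump_twoRow hab hδ (e1 ▸ inTwoRows_twoRow _ _) hγ (e2 ▸ inTwoRows_twoRow _ _) hH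
    rw [e1] at h3 h4
    exact eq_of_union_eq h3 hd.1 (h4.trans e3.symm)
  rcases hd.cases_twoRow h2 with rfl | ⟨rfl, hb⟩ | ⟨rfl, rfl⟩ <;>
  rcases hε.cases_twoRow h2' with rfl | ⟨rfl, hb'⟩ | ⟨rfl, rfl⟩ <;>
  simp only [union_H0, union_H1, union_V] at he fin <;>
  obtain ⟨he1, he2⟩ := twoRow_inj he
  · left
    obtain rfl : p = p' := by omega
    subst he2
    exact ⟨rfl, false, by simp [corner, rowEnd_zero_twoRow hpq]⟩
  · right
    subst he1 he2
    exact fin p q' _ _ (by omega) (addable_H1 hpq) (addable_H0 (by omega)) (by simp)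
      (union_H1 _ _) (union_H0 _ _) rfl
  · omega
  · right
    subst he1 he2
    exact fin p' q _ _ (by omega) (addable_H0 (by omega)) (addable_H1 hpq') (by simp)
      (union_H0 _ _) (union_H1 _ _) rfl
  · right
    obtain rfl : q = q' := by omega
    subst he1
    obtain ⟨a, rfl⟩ := Nat.exists_eq_add_of_le' (show 2 ≤ p by omega)
    exact fin a q _ _ (by omega) (addable_H0 (by omega)) (addable_H0 (by omega)) (by simp)
      (union_H0 _ _) (union_H0 _ _) rfl
  · right
    obtain rfl : p = q + 2 := by omega
    obtain rfl : p' = q + 1 := by omega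
    exact fin q q _ _ le_rfl (addable_H0 le_rfl) (addable_V q) (by simp)
      (union_H0 _ _) (union_V _) rfl
  · omega
  · right
    obtain rfl : p = q' + 1 := by omega
    obtain rfl : p' = q' + 2 := by omega
    exact fin q' q' _ _ le_rfl (addable_V q') (addable_H0 le_rfl) (by simp)
      (union_V _) (union_H0 _ _) rfl
  · obtain rfl : p = p' := by omega
    rcases p with _ | p
    · left
      exact ⟨rfl, true, by simp [corner, colEnd_zero_empty]⟩
    · right
      exact fin p p _ _ le_rfl (addable_V p) (addable_V p) (by simp)
        (union_V _) (union_V _) rfl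

end Domino

namespace DominoFilling

theorem below_congr {T U : DominoFilling} {M : ℕ} (h : ∀ m < M, T m = U m) :
    T.below M = U.below M := by
  refine Finset.biUnion_congr rfl fun m hm => ?_
  rw [cellsAt, cellsAt, h m (Finset.mem_range.1 hm)]

theorem below_eq_of_none {T : DominoFilling} {M m : ℕ} (h : ∀ j, M ≤ j → T j = none)
    (hm : M ≤ m) : T.below m = T.below M := by
  induction m, hm using Nat.le_induction with
  | base => rfl
  | succ m hm ih =>
    have : T.cellsAt m = ∅ := by simp [cellsAt, h m hm]
    rw [below_succ, this, ih, Finset.union_empty]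

theorem insertLabel_apply (T : DominoFilling) (a : ℕ) (v : Bool) (m : ℕ) :
    T.insertLabel a v m = insertStep T a v m ((T.insertLabel a v).below m) := by
  rw [below_insertLabel]; rfl

/-- The dominoes with labels `< M` after an insertion depend on those before it only. -/
theorem insertLabel_congr {T U : DominoFilling} {M : ℕ} (h : ∀ m < M, T m = U m) (a : ℕ)
    (v : Bool) {m : ℕ} (hm : m < M) : T.insertLabel a v m = U.insertLabel a v m := by
  induction m using Nat.strong_induction_on with
  | _ m ih =>
    rw [insertLabel_apply, insertLabel_apply,
      below_congr (M := m) fun j hj => ih j hj (hj.trans hm), insertStep, insertStep, h m hm]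

/-- The dominoes of `T` with labels `< M`. -/
def restrict (T : DominoFilling) (M : ℕ) : DominoFilling := fun m => if m < M then T m else none

theorem restrict_of_lt (T : DominoFilling) {M m : ℕ} (h : m < M) : T.restrict M m = T m := if_pos h

theorem restrict_of_le (T : DominoFilling) {M m : ℕ} (h : M ≤ m) : T.restrict M m = none :=
  if_neg (not_lt.2 h)

/-- Standardness of a filling that is obtained from `T` by a new choice of the domino `M` and the
removal of all dominoes with larger labels. -/
theorem isStandard_of_lt {T U : DominoFilling} {M : ℕ} (hT : T.IsStandard)
    (h : ∀ m < M, U m = T m) (hM : Disjoint (U.cellsAt M) (U.below M))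
    (hM' : IsLowerSet (U.below (M + 1) : Set (ℕ × ℕ))) (h' : ∀ m, M < m → U m = none) :
    U.IsStandard := by
  constructor
  · intro k
    rcases lt_trichotomy k M with hk | rfl | hk
    · rw [below_congr (M := k) fun m hm => h m (hm.trans hk), cellsAt, h k hk]
      exact hT.disjoint k
    · exact hM
    · simp [cellsAt, h' k hk]
  · intro m
    rcases le_or_gt m M with hm | hm
    · rw [below_congr (M := m) fun j hj => h j (hj.trans_le hm)]
      exact hT.lower m
    · rw [below_eq_of_none (M := M + 1) h' hm]
      exact hM'

theorem IsStandard.restrict {T : DominoFilling} (hT : T.IsStandard) (M : ℕ) :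
    (T.restrict M).IsStandard := by
  have h0 : (T.restrict M).cellsAt M = ∅ := by simp [cellsAt, restrict_of_le]
  refine isStandard_of_lt hT (fun m => T.restrict_of_lt) (by simp [h0]) ?_
    (fun m hm => T.restrict_of_le hm.le)
  rw [below_succ, h0, Finset.union_empty, below_congr (M := M) fun m => T.restrict_of_lt]
  exact hT.lower M

theorem IsStandard.addable {T : DominoFilling} (hT : T.IsStandard) {m : ℕ} {d : Domino}
    (h : T m = some d) : Domino.Addable (T.below m) d ∧ T.below (m + 1) = T.below m ∪ d.cells := by
  have h0 : T.cellsAt m = d.cells := by simp [cellsAt, h]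
  have h1 := hT.disjoint m
  have h2 := hT.lower (m + 1)
  rw [below_succ, h0] at h2
  rw [h0] at h1
  exact ⟨⟨h1, h2⟩, by rw [below_succ, h0]⟩

theorem below_succ_of_none {T : DominoFilling} {m : ℕ} (h : T m = none) :
    T.below (m + 1) = T.below m := by
  have h0 : T.cellsAt m = ∅ := by simp [cellsAt, h]
  rw [below_succ, h0, Finset.union_empty]

/-- Insertion can be reversed inside of two rows: a domino at the border of the shape is removed
by the reversal of an insertion. -/
theorem exists_insertLabel_eq (M : ℕ) {T' : DominoFilling} {μ : Finset (ℕ × ℕ)} {ε : Domino}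
    (hT' : T'.IsStandard) (hM : ∀ m, M ≤ m → T' m = none) (h2 : InTwoRows (T'.below M))
    (hμ : IsLowerSet (μ : Set (ℕ × ℕ))) (hε : Disjoint ε.cells μ)
    (he : T'.below M = μ ∪ ε.cells) :
    ∃ (T : DominoFilling) (a : ℕ) (v : Bool), T.IsStandard ∧ T a = none ∧ a < M ∧
      (∀ m, M ≤ m → T m = none) ∧ T.insertLabel a v = T' ∧ T.below M = μ := by
  induction M generalizing T' μ ε with
  | zero =>
    have h0 : (∅ : Finset (ℕ × ℕ)) = μ ∪ ε.cells := he
    have := (Domino.cells_nonempty ε).mono (Finset.subset_union_right (s₁ := μ))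
    rw [← h0] at this
    simp at this
  | succ M ih =>
    cases hd : T' M with
    | none =>
      have hM' : ∀ m, M ≤ m → T' m = none := fun m hm => by
        rcases eq_or_lt_of_le hm with rfl | hm
        · exact hd
        · exact hM m hm
      rw [below_succ_of_none hd] at h2 he
      obtain ⟨T, a, v, h3, h4, h5, h6, h7, h8⟩ := ih hT' hM' h2 hμ hε he
      exact ⟨T, a, v, h3, h4, by omega, fun m hm => h6 m (by omega), h7,
        (below_succ_of_none (h6 M le_rfl)).trans h8⟩
    | some d =>
      obtain ⟨hdadd, hb⟩ := hT'.addable hd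
      have hεadd : Domino.Addable μ ε := ⟨hε, he ▸ hT'.lower _⟩
      have hres : (T'.restrict M).below M = T'.below M :=
        below_congr fun m hm => T'.restrict_of_lt hm
      rw [hb] at he h2
      rcases Domino.exists_reverse (hT'.lower M) hμ hdadd hεadd he h2 with
        ⟨hρ, v, hv⟩ | ⟨s, δ, γ, hs, hδ, hγ, hsδ, hsγ, hbump⟩
      -- the domino `M` is the one that was inserted
      · have hnone : T'.restrict M M = none := T'.restrict_of_le le_rfl
        have hins := insertLabel_below (hT'.restrict M) hnone v M
        refine ⟨T'.restrict M, M, v, hT'.restrict M, hnone, by omega,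
          fun m hm => T'.restrict_of_le (by omega), ?_, ?_⟩
        · funext m
          rw [insertLabel_apply, insertStep]
          rcases lt_trichotomy m M with h3 | rfl | h3
          · rw [if_pos h3, T'.restrict_of_lt h3]
          · rw [if_neg (lt_irrefl m), if_pos rfl, hins.1 le_rfl, hres, hd, hv]
            rfl
          · rw [if_neg (by omega), if_neg (by omega), T'.restrict_of_le (by omega), hM m (by omega)]
            rfl
        · rw [below_succ_of_none hnone, hres, hρ]
      -- the domino `M` was moved from `γ` to `d`, and the smaller labels are treated recursively
      · obtain ⟨U, a, v, hU, hUa, ha, hUM, hUins, hUb⟩ := ih (hT'.restrict M)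
          (fun m hm => T'.restrict_of_le hm)
          (hres ▸ h2.mono Finset.subset_union_left) hs hδ.1 (hres.trans hsδ.symm)
        let T : DominoFilling := fun m => if m = M then some γ else U m
        have hTM : T M = some γ := if_pos rfl
        have hTU : ∀ m, m ≠ M → T m = U m := fun m hm => if_neg hm
        have hTb : T.below M = s := by
          rw [← hUb]
          exact below_congr fun m hm => hTU m hm.ne
        have hTc : T.cellsAt M = γ.cells := by simp [cellsAt, hTM]
        have hTb' : T.below (M + 1) = μ := by rw [below_succ, hTb, hTc, hsγ]
        have hlt : ∀ m < M, T.insertLabel a v m = T' m := fun m hm => by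
          rw [insertLabel_congr (M := M) (fun j hj => hTU j hj.ne) a v hm, hUins,
            T'.restrict_of_lt hm]
        refine ⟨T, a, v, ?_, ?_, by omega, ?_, ?_, hTb'⟩
        · refine isStandard_of_lt hU (fun m hm => hTU m hm.ne) ?_ (hTb' ▸ hμ)
            fun m hm => (hTU m hm.ne').trans (hUM m hm.le)
          rw [hTb, hTc]
          exact hγ.1
        · rw [hTU a ha.ne, hUa]
        · intro m hm
          rw [hTU m (by omega), hUM m (by omega)]
        · funext m
          rcases lt_trichotomy m M with hm | rfl | hm
          · exact hlt m hm
          · rw [insertLabel_apply, insertStep, if_neg (by omega), if_neg (by omega),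
              below_congr hlt, hTM, Option.map_some, hbump, hd]
          · rw [insertLabel_apply, insertStep, if_neg (by omega), if_neg (by omega),
              hTU m (by omega), hUM m (by omega), hM m (by omega)]
            rfl

/-- The last insertion is determined by its result and by the shape before it. -/
theorem insertLabel_unique (M : ℕ) {T U : DominoFilling} {a b : ℕ} {v v' : Bool}
    (hT : T.IsStandard) (hU : U.IsStandard) (hTa : T a = none) (hUb : U b = none)
    (ha : a < M) (hb : b < M) (h : ∀ m < M, T.insertLabel a v m = U.insertLabel b v' m)
    (hM : T.below M = U.below M) (h2 : InTwoRows ((T.insertLabel a v).below M)) :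
    a = b ∧ v = v' ∧ ∀ m < M, T m = U m := by
  induction M generalizing T U a b v v' with
  | zero => omega
  | succ M ih =>
    -- the label `M` cannot be inserted in one case and be moved in the other
    have main : ∀ {T U : DominoFilling} {a : ℕ} {v v' : Bool}, T.IsStandard → U.IsStandard →
        T a = none → U M = none → a < M →
        (∀ m < M + 1, T.insertLabel a v m = U.insertLabel M v' m) →
        T.below (M + 1) = U.below (M + 1) →
        InTwoRows ((T.insertLabel a v).below (M + 1)) → False := by
      intro T U a v v' hT hU hTa hUM ha h hM h2
      have hρ := below_congr fun m hm => h m (Nat.lt_succ_of_lt hm)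
      rw [(insertLabel_below hU hUM v' M).1 le_rfl] at hρ
      have hM' := h M (Nat.lt_succ_self M)
      rw [insertLabel_apply, insertLabel_apply U, insertStep, insertStep, if_neg (by omega),
        if_neg (by omega), if_neg (by omega), if_pos rfl,
        (insertLabel_below hU hUM v' M).1 le_rfl, hρ] at hM'
      obtain ⟨δ, hδ, hδb⟩ := (insertLabel_below hT hTa v M).2 ha
      obtain ⟨γ, hγ, hγb⟩ := Option.map_eq_some_iff.1 hM'
      have hγadd := hT.addable hγ
      rw [below_succ_of_none hUM, ← hρ, hγadd.2, hδb] at hM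
      rw [← hρ, hδb] at hγb
      rw [below_succ, insertLabel_cellsAt, insertStep, if_neg (by omega), if_neg (by omega), hγ,
        hδb] at h2
      exact Domino.bump_ne_corner (hT.lower M) hδ hγadd.1 hM.symm h2 v' hγb
    rcases Nat.lt_or_ge a M with ha' | ha' <;> rcases Nat.lt_or_ge b M with hb' | hb'
    · have hρ := below_congr fun m hm => h m (Nat.lt_succ_of_lt hm)
      have hM' := h M (Nat.lt_succ_self M)
      have h2' : InTwoRows ((T.insertLabel a v).below M) := h2.mono (by
        rw [below_succ]; exact Finset.subset_union_left)
      have key : T M = U M ∧ T.below M = U.below M := by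
        rw [insertLabel_apply, insertLabel_apply U, insertStep, insertStep, if_neg (by omega),
          if_neg (by omega), if_neg (by omega), if_neg (by omega), ← hρ] at hM'
        obtain ⟨δ, hδ, hδb⟩ := (insertLabel_below hT hTa v M).2 ha'
        obtain ⟨δ', hδ', hδb'⟩ := (insertLabel_below hU hUb v' M).2 hb'
        cases hγ : T M with
        | none =>
          cases hγ' : U M with
          | none =>
            rw [below_succ_of_none hγ, below_succ_of_none hγ'] at hM
            exact ⟨rfl, hM⟩
          | some γ' => rw [hγ, hγ'] at hM'; simp at hM'
        | some γ =>
          cases hγ' : U M with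
          | none => rw [hγ, hγ'] at hM'; simp at hM'
          | some γ' =>
            rw [hγ, hγ', Option.map_some, Option.map_some, Option.some_inj] at hM'
            have hγadd := hT.addable hγ
            have hγadd' := hU.addable hγ'
            rw [below_succ, insertLabel_cellsAt, insertStep, if_neg (by omega), if_neg (by omega),
              hγ] at h2
            have h3 : InTwoRows ((T.insertLabel a v).below M ∪
              (Domino.bump ((T.insertLabel a v).below M) γ).cells) := h2
            have h4 := h3
            rw [hM', hρ] at h4
            rw [hρ, hδb'] at hM'
            rw [hδb] at h3 hρ
            rw [hδb'] at h4 hρ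
            obtain ⟨p, q, hpq, hs, ht⟩ := Domino.exists_twoRow_of_bump (hT.lower M) hδ hγadd.1 h3
            obtain ⟨p', q', hpq', hs', ht'⟩ :=
              Domino.exists_twoRow_of_bump (hU.lower M) hδ' hγadd'.1 h4
            rw [hρ, hM', ht'] at ht
            have hs2 : T.below M = U.below M := by
              have := twoRow_inj ht
              rw [hs, hs', show p = p' by omega, show q = q' by omega]
            refine ⟨?_, hs2⟩
            rw [hγadd.2, hγadd'.2] at hM
            rw [Domino.eq_of_union_eq hγadd.1.1 (hs2 ▸ hγadd'.1.1) (hM.trans (by rw [hs2]))]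
      obtain ⟨k1, k2, k3⟩ := ih hT hU hTa hUb ha' hb' (fun m hm => h m (by omega)) key.2 h2'
      refine ⟨k1, k2, fun m hm => ?_⟩
      rcases Nat.lt_succ_iff_lt_or_eq.1 hm with hm | rfl
      · exact k3 m hm
      · exact key.1
    · obtain rfl : b = M := by omega
      exact (main hT hU hTa hUb ha' h hM h2).elim
    · obtain rfl : a = M := by omega
      refine (main hU hT hUb hTa hb' (fun m hm => (h m hm).symm) hM.symm ?_).elim
      rwa [← below_congr h]
    · obtain rfl : a = M := by omega
      obtain rfl : b = a := by omega
      have hlt : ∀ m < b, T m = U m := by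
        intro m hm
        have := h m (by omega)
        rwa [insertLabel_apply, insertLabel_apply U, insertStep, insertStep, if_pos hm,
          if_pos hm] at this
      refine ⟨rfl, ?_, fun m hm => ?_⟩
      · have hM' := h b (Nat.lt_succ_self b)
        rw [insertLabel_apply, insertLabel_apply U, insertStep, insertStep, if_neg (lt_irrefl b),
          if_pos rfl, if_neg (lt_irrefl b), if_pos rfl, (insertLabel_below hU hUb v' b).1 le_rfl,
          (insertLabel_below hT hTa v b).1 le_rfl, below_congr hlt, Option.some_inj] at hM'
        exact Domino.corner_injective _ hM'
      · rcases Nat.lt_succ_iff_lt_or_eq.1 hm with hm | rfl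
        · exact hlt m hm
        · rw [hTa, hUb]

end DominoFilling

/-! ### Bijectivity -/

namespace StandardDominoTableau

variable {n : ℕ}

theorem ext_dom {S T : StandardDominoTableau n} (h : ∀ k, S.dom k = T.dom k) : S = T := by
  have h' : S.dom = T.dom := funext h
  refine StandardDominoTableau.ext ?_ h'
  apply YoungDiagram.ext
  rw [S.cells_eq, T.cells_eq, h']

theorem mem_cells_iff (S : StandardDominoTableau n) {x : ℕ × ℕ} :
    x ∈ S.shape.cells ↔ ∃ k, x ∈ S.dom k := by
  rw [S.cells_eq, Finset.mem_biUnion]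
  refine ⟨fun ⟨k, _, h⟩ => ⟨k, h⟩, fun ⟨k, h⟩ => ⟨k, ?_, h⟩⟩
  by_contra hc
  rw [S.eq_empty k (by simpa using hc)] at h
  simp at h

/-- The cells with labels `< m`. -/
def below (S : StandardDominoTableau n) (m : ℕ) : Finset (ℕ × ℕ) :=
  (Finset.range m).biUnion S.dom

theorem below_succ (S : StandardDominoTableau n) (m : ℕ) :
    S.below (m + 1) = S.below m ∪ S.dom m := by
  rw [below, Finset.range_add_one, Finset.biUnion_insert, Finset.union_comm]
  rfl

theorem below_eq_cells (S : StandardDominoTableau n) : S.below (n + 1) = S.shape.cells := by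
  ext x
  rw [S.mem_cells_iff, below, Finset.mem_biUnion]
  refine ⟨fun ⟨k, _, h⟩ => ⟨k, h⟩, fun ⟨k, h⟩ => ⟨k, ?_, h⟩⟩
  by_contra hc
  rw [Finset.mem_range] at hc
  rw [S.eq_empty k (by omega)] at h
  simp at h

theorem disjoint_below (S : StandardDominoTableau n) (m : ℕ) :
    Disjoint (S.dom m) (S.below m) := by
  rw [below, Finset.disjoint_biUnion_right]
  intro k hk
  exact S.disjoint m k (Finset.mem_range.1 hk).ne'

/-- Since the labels increase along rows and down columns, the cells with small labels form a
diagram. -/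
theorem isLowerSet_below (S : StandardDominoTableau n) (m : ℕ) :
    IsLowerSet (S.below m : Set (ℕ × ℕ)) := by
  rw [Domino.lower_iff]
  have key : ∀ x y, x ≤ y → y ∈ S.below m → (∀ k l, x ∈ S.dom k → y ∈ S.dom l → k ≤ l) →
      x ∈ S.below m := by
    intro x y hxy hy h
    obtain ⟨l, hl, hyl⟩ := Finset.mem_biUnion.1 hy
    have hxs : x ∈ S.shape.cells :=
      S.shape.isLowerSet hxy (S.mem_cells_iff.2 ⟨l, hyl⟩)
    obtain ⟨k, hk⟩ := S.mem_cells_iff.1 hxs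
    have := h k l hk hyl
    rw [Finset.mem_range] at hl
    exact Finset.mem_biUnion.2 ⟨k, Finset.mem_range.2 (by omega), hk⟩
  intro r c
  exact ⟨fun h => key (r, c) (r + 1, c) (Prod.mk_le_mk.2 ⟨by omega, le_rfl⟩) h
      fun k l h1 h2 => S.col_le k l r (r + 1) c h1 h2 (by omega),
    fun h => key (r, c) (r, c + 1) (Prod.mk_le_mk.2 ⟨le_rfl, by omega⟩) h
      fun k l h1 h2 => S.row_le k l r c (c + 1) h1 h2 (by omega)⟩

/-- A standard domino tableau as a filling. -/
noncomputable def toFilling (S : StandardDominoTableau n) : DominoFilling := fun k =>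
  if h : 1 ≤ k ∧ k ≤ n then some (S.isDomino k h.1 h.2).choose else none

theorem cellsAt_toFilling (S : StandardDominoTableau n) (k : ℕ) :
    S.toFilling.cellsAt k = S.dom k := by
  unfold DominoFilling.cellsAt toFilling
  split_ifs with h
  · exact (S.isDomino k h.1 h.2).choose_spec.symm
  · exact (S.eq_empty k h).symm

theorem below_toFilling (S : StandardDominoTableau n) (m : ℕ) :
    S.toFilling.below m = S.below m :=
  Finset.biUnion_congr rfl fun k _ => S.cellsAt_toFilling k

theorem isStandard_toFilling (S : StandardDominoTableau n) : S.toFilling.IsStandard := by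
  refine ⟨fun k => ?_, fun m => ?_⟩
  · rw [cellsAt_toFilling, below_toFilling]
    exact S.disjoint_below k
  · rw [below_toFilling]
    exact S.isLowerSet_below m

theorem toFilling_isSome (S : StandardDominoTableau n) (k : ℕ) :
    (S.toFilling k).isSome ↔ 1 ≤ k ∧ k ≤ n := by
  unfold toFilling
  split_ifs with h <;> simp [h]

end StandardDominoTableau

namespace DominoFilling

theorem eq_of_cellsAt_eq {T U : DominoFilling} {k : ℕ} (h : T.cellsAt k = U.cellsAt k) :
    T k = U k := by
  unfold cellsAt at h
  cases hT : T k with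
  | none =>
    cases hU : U k with
    | none => rfl
    | some d =>
      rw [hT, hU] at h
      exact absurd h.symm (Domino.cells_nonempty d).ne_empty
  | some d =>
    cases hU : U k with
    | none =>
      rw [hT, hU] at h
      exact absurd h (Domino.cells_nonempty d).ne_empty
    | some e =>
      rw [hT, hU] at h
      rw [Domino.cells_injective h]

theorem ofWord_congr {f g : ℕ → ℤ} {k : ℕ} (h : ∀ j, 1 ≤ j → j ≤ k → f j = g j) :
    ofWord f k = ofWord g k := by
  induction k with
  | zero => rfl
  | succ k ih =>
    rw [ofWord, ofWord, ih fun j h1 h2 => h j h1 (by omega), h (k + 1) (by omega) le_rfl]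

/-- Inside of two rows, a standard filling and a chain of diagrams that ends in its shape come
from a word. -/
theorem exists_ofWord_eq {n : ℕ} (S : StandardDominoTableau n) (M : ℕ) {k : ℕ} (hk : k ≤ n)
    {F : DominoFilling} (hF : F.IsStandard) (hM : ∀ m, M ≤ m → F m = none) (h0 : F 0 = none)
    (h2 : InTwoRows (F.below M)) (hS : F.below M = S.below (k + 1)) :
    ∃ f : ℕ → ℤ, ofWord f k = F ∧ (∀ j ≤ k, (ofWord f j).below M = S.below (j + 1)) ∧
      (∀ j, 1 ≤ j → j ≤ k → (F (f j).natAbs).isSome) ∧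
      ∀ i j, 1 ≤ i → i < j → j ≤ k → (f i).natAbs ≠ (f j).natAbs := by
  induction k generalizing F with
  | zero =>
    have hS0 : S.below (0 + 1) = ∅ := by
      rw [S.below_succ, S.eq_empty 0 (by omega)]
      rfl
    have hF0 : F = fun _ => none := by
      funext m
      rcases le_or_gt M m with hm | hm
      · exact hM m hm
      · apply eq_of_cellsAt_eq (U := fun _ => none)
        have : F.cellsAt m ⊆ F.below M :=
          Finset.subset_biUnion_of_mem F.cellsAt (Finset.mem_range.2 hm)
        rw [hS, hS0, Finset.subset_empty] at this
        exact this
    refine ⟨fun _ => 0, hF0.symm, fun j hj => ?_, fun j h1 h2 => by omega,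
      fun i j h1 h2 h3 => by omega⟩
    obtain rfl : j = 0 := by omega
    rw [hS0]
    exact below_none M
  | succ k ih =>
    obtain ⟨ε, hε⟩ := S.isDomino (k + 1) (by omega) hk
    have hS' := hS
    rw [S.below_succ, hε] at hS'
    obtain ⟨T, a, v, hT, hTa, haM, hTM, hTF, hTS⟩ := exists_insertLabel_eq M hF hM h2
      (S.isLowerSet_below (k + 1)) (hε ▸ S.disjoint_below (k + 1)) hS'
    have hsome := fun m => insertLabel_isSome T a v m
    rw [hTF] at hsome
    have ha0 : a ≠ 0 := by
      rintro rfl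
      have := (hsome 0).2 (Or.inl rfl)
      rw [h0] at this
      simp at this
    have hT0 : T 0 = none := by
      by_contra hc
      have := (hsome 0).2 (Or.inr (Option.isSome_iff_ne_none.2 hc))
      rw [h0] at this
      simp at this
    obtain ⟨f, hf1, hf2, hf3, hf4⟩ := ih (by omega) hT hTM hT0
      (hTS ▸ h2.mono (hS' ▸ Finset.subset_union_left)) hTS
    let g : ℕ → ℤ := fun j => if j = k + 1 then (if v then -(a : ℤ) else a) else f j
    have hgk : g (k + 1) = if v then -(a : ℤ) else a := if_pos rfl
    have hga : (g (k + 1)).natAbs = a := by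
      rw [hgk]; split_ifs <;> simp
    have hgv : decide (g (k + 1) < 0) = v := by
      rw [hgk]
      cases v
      · simp
      · simp; omega
    have hgf : ∀ j, j ≤ k → g j = f j := fun j hj => if_neg (by omega)
    have hofg : ∀ j, j ≤ k → ofWord g j = ofWord f j := fun j hj =>
      ofWord_congr fun i _ hi => hgf i (by omega)
    have hgF : ofWord g (k + 1) = F := by
      rw [ofWord, hofg k le_rfl, hf1, hga, hgv, hTF]
    refine ⟨g, hgF, fun j hj => ?_, fun j h1 h2 => ?_, fun i j h1 hij hj => ?_⟩
    · rcases eq_or_lt_of_le hj with rfl | hj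
      · rw [hgF, hS]
      · rw [hofg j (by omega), hf2 j (by omega)]
    · rw [hsome]
      rcases eq_or_lt_of_le h2 with rfl | hj
      · exact Or.inl hga
      · right
        rw [hgf j (by omega)]
        exact hf3 j h1 (by omega)
    · rcases eq_or_lt_of_le hj with rfl | hj
      · rw [hga, hgf i (by omega)]
        intro he
        have := hf3 i h1 (by omega)
        rw [he, hTa] at this
        simp at this
      · rw [hgf i (by omega), hgf j (by omega)]
        exact hf4 i j h1 hij (by omega)

end DominoFilling

namespace WeylB

/-- A word with entries `±1, …, ±n`, each absolute value occurring once, is the word of a signed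
permutation. -/
theorem exists_word_eq {n : ℕ} {f : ℕ → ℤ}
    (h1 : ∀ j, 1 ≤ j → j ≤ n → 1 ≤ (f j).natAbs ∧ (f j).natAbs ≤ n)
    (h2 : ∀ i j, 1 ≤ i → i < j → j ≤ n → (f i).natAbs ≠ (f j).natAbs) :
    ∃ w : W n, ∀ j, 1 ≤ j → j ≤ n → word w j = f j := by
  -- the odd extension of `f`, and the identity outside of `{±1, …, ±n}`
  let g : ℤ → ℤ := fun p => if p.natAbs ≤ n then p.sign * f p.natAbs else p
  have hg1 : ∀ p, p.natAbs ≤ n → g p = p.sign * f p.natAbs := fun p hp => if_pos hp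
  have hg2 : ∀ p, n < p.natAbs → g p = p := fun p hp => if_neg (not_le.2 hp)
  have hodd : ∀ p, g (-p) = -g p := by
    intro p
    rcases le_or_gt p.natAbs n with hp | hp
    · rw [hg1 p hp, hg1 (-p) (by omega), Int.sign_neg, Int.natAbs_neg, neg_mul]
    · rw [hg2 p hp, hg2 (-p) (by omega)]
  have habs : ∀ p, p.natAbs ≤ n → p ≠ 0 → (g p).natAbs = (f p.natAbs).natAbs := by
    intro p hp hp0
    rw [hg1 p hp, Int.natAbs_mul, Int.natAbs_sign_of_ne_zero hp0, one_mul]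
  have h0 : g 0 = 0 := by rw [hg1 0 (by simp)]; simp
  have hle : ∀ p, p.natAbs ≤ n → (g p).natAbs ≤ n := by
    intro p hp
    by_cases hp0 : p = 0
    · simp [hp0, h0]
    · rw [habs p hp hp0]
      exact (h1 _ (by omega) hp).2
  have hpos : ∀ p, p ≠ 0 → g p ≠ 0 := by
    intro p hp0
    rcases le_or_gt p.natAbs n with hp | hp
    · have := habs p hp hp0
      have := (h1 p.natAbs (by omega) hp).1
      omega
    · rwa [hg2 p hp]
  have hinj : Function.Injective g := by
    intro p q hpq
    rcases le_or_gt p.natAbs n with hp | hp <;> rcases le_or_gt q.natAbs n with hq | hq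
    · by_cases hp0 : p = 0
      · by_contra hne
        rw [hp0, h0] at hpq
        exact hpos q (by omega) hpq.symm
      by_cases hq0 : q = 0
      · rw [hq0, h0] at hpq
        exact absurd hpq (hpos p hp0)
      have he : (f p.natAbs).natAbs = (f q.natAbs).natAbs := by
        rw [← habs p hp hp0, ← habs q hq hq0, hpq]
      have he' : p.natAbs = q.natAbs := by
        rcases lt_trichotomy p.natAbs q.natAbs with h | h | h
        · exact absurd he (h2 _ _ (by omega) h hq)
        · exact h
        · exact absurd he.symm (h2 _ _ (by omega) h hp)
      rcases Int.natAbs_eq_natAbs_iff.1 he' with h | h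
      · exact h
      · rw [h, hodd] at hpq
        have := hpos q hq0
        omega
    · have := hle p hp
      rw [hpq, hg2 q hq] at this
      omega
    · have := hle q hq
      rw [← hpq, hg2 p hp] at this
      omega
    · rwa [hg2 p hp, hg2 q hq] at hpq
  have hsurj : Function.Surjective g := by
    intro y
    rcases le_or_gt y.natAbs n with hy | hy
    · have hmaps : Set.MapsTo g (Finset.Icc (-n : ℤ) n : Finset ℤ)
          (Finset.Icc (-n : ℤ) n : Finset ℤ) := by
        intro p hp
        rw [Finset.mem_coe, Finset.mem_Icc] at hp ⊢
        have := hle p (by omega)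
        omega
      obtain ⟨p, -, hp⟩ := Finset.surjOn_of_injOn_of_card_le g hmaps hinj.injOn le_rfl
        (Finset.mem_coe.2 (Finset.mem_Icc.2 (show -(n : ℤ) ≤ y ∧ y ≤ n by omega)))
      exact ⟨p, hp⟩
    · exact ⟨y, hg2 y hy⟩
  refine ⟨⟨Equiv.ofBijective g ⟨hinj, hsurj⟩, mem_W_of_isSigned ⟨hodd, hg2⟩⟩, fun j hj hjn => ?_⟩
  change g j = f j
  rw [hg1 j (by simpa using hjn), Int.natAbs_natCast, Int.sign_natCast_of_ne_zero (by omega),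
    one_mul]

theorem below_Q {n : ℕ} (w : W n) {k : ℕ} (hk : k ≤ n) :
    (Q w).below (k + 1) = (filling w k).below (n + 1) := newCells_biUnion w hk

theorem filling_eq_none {n : ℕ} (w : W n) {k : ℕ} (hk : k ≤ n) {m : ℕ} (hm : n + 1 ≤ m) :
    filling w k m = none := by
  by_contra hc
  obtain ⟨j, h1, h2, h3⟩ := ((filling_spec w k).2 m).1 (Option.isSome_iff_ne_none.2 hc)
  have := word_mem w h1 (h2.trans hk)
  omega

theorem eq_of_word_eq {n : ℕ} {w w' : W n} (h : ∀ j, 1 ≤ j → j ≤ n → word w j = word w' j) :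
    w = w' := by
  apply Subtype.ext
  have h1 := mem_W w.2
  have h2 := mem_W w'.2
  have hnat : ∀ j : ℕ, (w : Equiv.Perm ℤ) j = (w' : Equiv.Perm ℤ) j := by
    intro j
    rcases Nat.eq_zero_or_pos j with rfl | hj
    · have e1 := IsSigned.zero h1
      have e2 := IsSigned.zero h2
      exact e1.trans e2.symm
    · rcases le_or_gt j n with hjn | hjn
      · exact h j hj hjn
      · rw [h1.2 j (by simpa using hjn), h2.2 j (by simpa using hjn)]
  ext p
  rcases Int.natAbs_eq p with hp | hp
  · rw [hp, hnat]
  · rw [hp, h1.1, h2.1, hnat]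

/-- The letters of `w` are recovered from the last one to the first one. -/
theorem PQ_injOn (n : ℕ) : Set.InjOn (fun w : W n => (P w, Q w)) (Wb n) := by
  intro w hw w' _ h
  obtain ⟨hP, hQ⟩ := Prod.mk.inj h
  have hrows : InTwoRows ((filling w n).below (n + 1)) := by
    rw [← cells_P, inTwoRows_iff_colLen]
    exact (mem_Wb_iff_Sh w).1 hw
  have hbelow : ∀ k ≤ n, (filling w k).below (n + 1) = (filling w' k).below (n + 1) := by
    intro k hk
    rw [← below_Q w hk, ← below_Q w' hk, hQ]
  have hfill : ∀ d ≤ n, filling w (n - d) = filling w' (n - d) ∧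
      InTwoRows ((filling w (n - d)).below (n + 1)) ∧
      ∀ j, n - d < j → j ≤ n → word w j = word w' j := by
    intro d
    induction d with
    | zero =>
      intro _
      refine ⟨?_, hrows, fun j h1 h2 => by omega⟩
      funext k
      apply DominoFilling.eq_of_cellsAt_eq
      exact congrArg (fun S : StandardDominoTableau n => S.dom k) hP
    | succ d ih =>
      intro hd
      obtain ⟨k, hk⟩ : ∃ k, n - d = k + 1 := ⟨n - d - 1, by omega⟩
      obtain ⟨e1, e2, e3⟩ := ih (by omega)
      rw [show n - (d + 1) = k by omega]
      rw [hk] at e1 e2 e3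
      obtain ⟨δ, -, hδ⟩ := filling_growth w (k := k) (by omega)
      have hk1 := word_mem w (k := k + 1) (by omega) (by omega)
      have hk2 := word_mem w' (k := k + 1) (by omega) (by omega)
      have hins : ∀ m < n + 1,
          (filling w k).insertLabel (word w (k + 1)).natAbs (decide (word w (k + 1) < 0)) m =
          (filling w' k).insertLabel (word w' (k + 1)).natAbs (decide (word w' (k + 1) < 0)) m :=
        fun m _ => congrFun e1 m
      obtain ⟨u1, u2, u3⟩ := DominoFilling.insertLabel_unique (n + 1) (filling_spec w k).1
        (filling_spec w' k).1 (filling_unused w k) (filling_unused w' k) (by omega) (by omega)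
        hins (hbelow k (by omega)) e2
      refine ⟨?_, e2.mono (hδ ▸ Finset.subset_union_left), fun j h1 h2 => ?_⟩
      · funext m
        rcases Nat.lt_or_ge m (n + 1) with hm | hm
        · exact u3 m hm
        · rw [filling_eq_none w (by omega) hm, filling_eq_none w' (by omega) hm]
      · rcases Nat.lt_or_ge (k + 1) j with hj | hj
        · exact e3 j hj h2
        · obtain rfl : j = k + 1 := by omega
          rw [decide_eq_decide] at u2
          omega
  exact eq_of_word_eq fun j h1 h2 => (hfill n le_rfl).2.2 j (by omega) h2

/-- The tableau `S` is emptied by reversed insertions that follow the chain of diagrams of `T`. -/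
theorem PQ_surjOn (n : ℕ) : Set.SurjOn (fun w : W n => (P w, Q w)) (Wb n) (twoRowPairs n) := by
  rintro ⟨S, T⟩ ⟨hshape, hrows⟩
  simp only at hshape hrows
  have hnone : ∀ m, ¬ (1 ≤ m ∧ m ≤ n) → S.toFilling m = none := fun m hm => by
    by_contra hc
    exact hm ((S.toFilling_isSome m).1 (Option.isSome_iff_ne_none.2 hc))
  obtain ⟨f, hf1, hf2, hf3, hf4⟩ := DominoFilling.exists_ofWord_eq T (n + 1) (k := n) le_rfl
    S.isStandard_toFilling (fun m hm => hnone m (by omega)) (hnone 0 (by omega))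
    (by rw [S.below_toFilling, S.below_eq_cells, inTwoRows_iff_colLen]; exact hrows)
    (by rw [S.below_toFilling, S.below_eq_cells, T.below_eq_cells, hshape])
  obtain ⟨w, hw⟩ := exists_word_eq (n := n) (f := f)
    (fun j h1 h2 => (S.toFilling_isSome _).1 (hf3 j h1 h2)) hf4
  have hfill : ∀ k ≤ n, filling w k = DominoFilling.ofWord f k := fun k hk =>
    DominoFilling.ofWord_congr fun j h1 h2 => hw j h1 (h2.trans hk)
  have hP : P w = S := by
    apply StandardDominoTableau.ext_dom
    intro k
    rw [← S.cellsAt_toFilling, ← hf1, ← hfill n le_rfl]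
    rfl
  have hQ : Q w = T := by
    apply StandardDominoTableau.ext_dom
    intro k
    by_cases hk : 1 ≤ k ∧ k ≤ n
    · obtain ⟨k, rfl⟩ := Nat.exists_eq_add_of_le' hk.1
      have h1 : newCells w (k + 1) =
          (filling w (k + 1)).below (n + 1) \ (filling w k).below (n + 1) := if_pos hk
      change newCells w (k + 1) = T.dom (k + 1)
      rw [h1, hfill _ hk.2, hfill k (by omega), hf2 _ hk.2, hf2 k (by omega), T.below_succ,
        Finset.union_sdiff_left, Finset.sdiff_eq_self_of_disjoint (T.disjoint_below _)]
    · rw [(Q w).eq_empty k hk, T.eq_empty k hk]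
  refine ⟨w, ?_, ?_⟩
  · rw [mem_Wb_iff_Sh, Sh, hP]
    exact hrows
  · simp only [hP, hQ]

theorem PQ_mapsTo (n : ℕ) : Set.MapsTo (fun w : W n => (P w, Q w)) (Wb n) (twoRowPairs n) := by
  intro w hw
  refine ⟨YoungDiagram.ext ?_, (mem_Wb_iff_Sh w).1 hw⟩
  rw [cells_P, ← below_Q w le_rfl, (Q w).below_eq_cells]

end WeylB

theorem mainTheorem3 (n : ℕ) :
    (∀ w : WeylB.W n, w ∈ WeylB.Wb n ↔ (WeylB.Sh w).colLen 0 ≤ 2) ∧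
      Set.BijOn (fun w : WeylB.W n => (WeylB.P w, WeylB.Q w)) (WeylB.Wb n) (twoRowPairs n) :=
  ⟨WeylB.mem_Wb_iff_Sh, WeylB.PQ_mapsTo n, WeylB.PQ_injOn n, WeylB.PQ_surjOn n⟩
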